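/- Consider the Massively Parallel Computation (MPC) model: the edges of a graph with $n$ vertices and $m$ edges are distributed arbitrarily across $M$ machines with $S$ words of $O(\log n)$ bits each, with $M\cdot S$ at least the input size and $O(n+m)$. In each round every machine performs an arbitrary (randomized) computation on its local data and sends messages to the other machines, which are delivered before the next round; each machine sends and receives at most $S$ words in total per round. An algorithm succeeds on an input if it respects these limits and its output is correct; "with high probability" means with probability at least $1-n^{-c}$, for a constant $c>1$. The diameter of a graph is the largest diameter of its connected components. Identifying the components means that every vertex is given a label, written by exactly one machine, such that two vertices have equal labels if and only if they lie in the same component. The 2-Cycle conjecture states: every MPC algorithm with $S\le n^{1-\Omega(1)}$ that with high probability distinguishes one cycle on $n$ vertices from two disjoint cycles on $n/2$ vertices each ($n$ even) takes $\Omega(\log n)$ rounds. **Theorem.** Let $c>1$ and assume the 2-Cycle conjecture (with this $c$ in "with high probability"). Let $\rho\in(0,1)$ be a constant and let $D'=D'(n)$ be integers with $\log^{1+\rho} n\le D'\le n$ for all large $n$. Then every MPC algorithm with $S\le n^{1-\Omega(1)}$ that with high probability (with the same $c$) identifies the connected components of every $n$-vertex graph of diameter at most $D'$ takes $\Omega(\log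 D')$ rounds. -/

import Mathlib

open Filter

/-- The local memory of a machine: `S` words. A word holds the name of one vertex, that is
`log₂ n` bits, so that words of `O(log n)` bits are the same up to a constant factor in `S`. -/
abbrev MPCMemory (n S : ℕ) : Type := Fin S → Fin n

/-- A randomized algorithm for `M` machines with `S` words of memory each, on graphs with vertex
set `Fin n`. The local computations are arbitrary functions of the local data. The random string
`seed` is drawn uniformly from a finite set; all machines may read it, so that independent private
coins (a string with one part for each machine and round) are a special case. Every machine
produces an output of type `O` at the end. -/
structure MPCAlgorithm (n M S : ℕ) (O : Type) where
  Seed : Type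
  [seedFintype : Fintype Seed]
  [seedNonempty : Nonempty Seed]
  /-- the initial memory of a machine, computed from the input edges placed on it -/
  load : Seed → Fin M → Finset (Sym2 (Fin n)) → MPCMemory n S
  /-- `send seed t i x j` is the message (a list of words) from machine `i` to machine `j` in
  round `t`, when the memory of machine `i` is `x` -/
  send : Seed → ℕ → Fin M → MPCMemory n S → Fin M → List (Fin n)
  /-- `update seed t i x msgs` is the memory of machine `i` after round `t`, when it was `x` before
  that round and `msgs j` is the message that arrived from machine `j` -/
  update : Seed → ℕ → Fin M → MPCMemory n S → (Fin M → List (Fin n)) → MPCMemory n S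
  /-- the output of a machine, computed from its final memory -/
  output : Seed → Fin M → MPCMemory n S → O

attribute [instance] MPCAlgorithm.seedFintype MPCAlgorithm.seedNonempty

namespace MPCAlgorithm

variable {n M S : ℕ} {O : Type}

/-- The memories of all machines after `t` rounds, on the input that places the set `inp i` of
edges on machine `i`. -/
def memAfter (A : MPCAlgorithm n M S O) (inp : Fin M → Finset (Sym2 (Fin n))) (s : A.Seed) :
    ℕ → Fin M → MPCMemory n S
  | 0 => fun i => A.load s i (inp i)
  | t + 1 => fun i =>
      A.update s t i (A.memAfter inp s t i) (fun j => A.send s t j (A.memAfter inp s t j) i)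

/-- The message from machine `i` to machine `j` in round `t`. -/
def message (A : MPCAlgorithm n M S O) (inp : Fin M → Finset (Sym2 (Fin n))) (s : A.Seed)
    (t : ℕ) (i j : Fin M) : List (Fin n) :=
  A.send s t i (A.memAfter inp s t i) j

/-- In each of the first `T` rounds, every machine sends at most `S` words in total and receives
at most `S` words in total. -/
def RespectsBandwidth (A : MPCAlgorithm n M S O) (inp : Fin M → Finset (Sym2 (Fin n)))
    (s : A.Seed) (T : ℕ) : Prop :=
  ∀ t < T, ∀ i : Fin M,
    (∑ j, (A.message inp s t i j).length) ≤ S ∧ (∑ j, (A.message inp s t j i).length) ≤ S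

/-- The outputs of all machines after `T` rounds. -/
def outputs (A : MPCAlgorithm n M S O) (inp : Fin M → Finset (Sym2 (Fin n))) (s : A.Seed)
    (T : ℕ) : Fin M → O :=
  fun i => A.output s i (A.memAfter inp s T i)

open Classical in
/-- The probability, over the random string, that the algorithm run for `T` rounds respects the
communication limits and that the outputs of its machines are correct. -/
noncomputable def successProb (A : MPCAlgorithm n M S O)
    (inp : Fin M → Finset (Sym2 (Fin n))) (T : ℕ) (correct : (Fin M → O) → Prop) : ℝ :=
  ((Finset.univ.filter fun s : A.Seed =>
      A.RespectsBandwidth inp s T ∧ correct (A.outputs inp s T)).card : ℝ) / Fintype.card A.Seed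

end MPCAlgorithm

/-- `inp` distributes the edges of `G` across `M` machines with `S` words of space: every edge is
placed on exactly one machine, and the edges on a machine (two words each) fit into its space. -/
def IsEdgeDistribution {n M : ℕ} (G : SimpleGraph (Fin n)) (S : ℕ)
    (inp : Fin M → Finset (Sym2 (Fin n))) : Prop :=
  (∀ i, ∀ e ∈ inp i, e ∈ G.edgeSet) ∧ (∀ e ∈ G.edgeSet, ∃! i, e ∈ inp i) ∧
    ∀ i, 2 * (inp i).card ≤ S

/-- The connected components of `G` are identified by the machines' outputs, where `out i v = some a`
says that machine `i` outputs the label `a` for the vertex `v`: what a machine outputs (two words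
for a vertex with its label) fits into its space, every vertex receives its label from exactly one
machine, and two vertices have equal labels if and only if they lie in the same component. -/
def IdentifiesComponents {n M : ℕ} (G : SimpleGraph (Fin n)) (S : ℕ)
    (out : Fin M → Fin n → Option (Fin n)) : Prop :=
  (∀ i, 2 * (Finset.univ.filter fun v => (out i v).isSome).card ≤ S) ∧
    (∀ v, ∃! i, (out i v).isSome) ∧
    ∀ u v i j a b, out i u = some a → out j v = some b → (a = b ↔ G.Reachable u v)

/-- `G` is a cycle on `n` vertices. -/
def IsOneCycle {n : ℕ} (G : SimpleGraph (Fin n)) : Prop :=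
  Nonempty (G ≃g SimpleGraph.cycleGraph n)

/-- `G` consists of two disjoint cycles on `n / 2` vertices each (used for even `n`). -/
def IsTwoCycles {n : ℕ} (G : SimpleGraph (Fin n)) : Prop :=
  Nonempty (G ≃g (SimpleGraph.cycleGraph (n / 2) ⊕g SimpleGraph.cycleGraph (n / 2)))

/-- Every machine outputs `true` if `G` is one cycle and `false` if `G` is two cycles. -/
def DistinguishesCycles {n M : ℕ} (G : SimpleGraph (Fin n)) (out : Fin M → Bool) : Prop :=
  (IsOneCycle G → ∀ i, out i = true) ∧ (IsTwoCycles G → ∀ i, out i = false)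

/-- The diameter of `G` is at most `D`, where the diameter of a possibly disconnected graph is the
largest diameter of its components. -/
def DiameterAtMost {n : ℕ} (G : SimpleGraph (Fin n)) (D : ℕ) : Prop :=
  ∀ u v, G.Reachable u v → G.dist u v ≤ D

/-- The 2-Cycle conjecture, where "with high probability" means with probability at least
`1 - n ^ (-c)`: every MPC algorithm with `n ^ (1 - Ω(1))` words of space per machine (and total
space linear in the input, which has `n` edges, and enough to hold it) that distinguishes with high
probability one cycle of size `n` from two cycles of size `n / 2`, for every distribution of the
edges across the machines, takes `Ω(log n)` rounds. -/
def TwoCycleConjecture (c : ℝ) : Prop :=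
  ∀ (M S T : ℕ → ℕ) (A : ∀ n, MPCAlgorithm n (M n) (S n) Bool),
    (∃ ε : ℝ, 0 < ε ∧ ∀ᶠ n : ℕ in atTop, (S n : ℝ) ≤ (n : ℝ) ^ (1 - ε)) →
    (∃ C : ℕ, ∀ᶠ n : ℕ in atTop, M n * S n ≤ C * n) →
    (∀ᶠ n : ℕ in atTop, n ≤ M n * (S n / 2)) →
    (∀ᶠ n : ℕ in atTop, Even n →
      ∀ G : SimpleGraph (Fin n), IsOneCycle G ∨ IsTwoCycles G →
      ∀ inp : Fin (M n) → Finset (Sym2 (Fin n)), IsEdgeDistribution G (S n) inp →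
        1 - (n : ℝ) ^ (-c) ≤ (A n).successProb inp (T n) (DistinguishesCycles G)) →
    ∃ κ : ℝ, 0 < κ ∧ ∀ᶠ n : ℕ in atTop, Even n → κ * Real.log n ≤ T n

/-!
An algorithm that finds components in graphs of diameter at most `D'` can be used as a subroutine to
tell one cycle from two. Give every edge `K` independent hash values in `Fin q`, and let phase `j`
contract all remaining edges whose `j`-th hash value is not zero. The edges contracted in a phase
form, on the current vertices, a graph whose components are paths; with high probability these have
at most `D'` edges, so that the subroutine finds the components of this graph in `T` rounds, and a
constant number of further rounds replaces all labels by the new ones. After `K` phases every edge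
has survived with probability `q ^ (-K)`. With `q` a small power of `D'` (this is where
`D' ≥ log ^ (1 + ρ) n` is needed: `D' / q` must exceed `log n` by a large factor) and `q ^ K`
between `n ^ (1 / 5)` and `n ^ (1 / 2)`, every cycle keeps some edge and all remaining edges fit
onto one machine, which then knows whether the graph is connected. As `K = O(log n / log D')`, the
2-Cycle conjecture gives `K * (T + O(1)) = Ω(log n)`, that is `T = Ω(log D')`.

Three points need care.

* The `K` calls of the subroutine fail with total probability up to `K * n ^ (-c)`, which is too
  much by a factor `K`. Three independent copies with a majority vote bring this down to
  `O(K ^ 2 * n ^ (-2 * c))`, which is at most `n ^ (-c)` for large `n` (`exists_amplified`). A copy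
  that fails may try to send too much, and this must not spoil the other copies. Therefore every
  round is replaced by three guarded rounds, in which the lengths of the messages are announced and
  messages beyond the limit are dropped (`Step.guard`).
* The subroutine solves graphs on `N` vertices, and the conjecture only speaks about even `n`. Both
  `N = n` and `N = n + 1` are used, with isolated vertices added where labels are not in use, and
  this covers all `N` (`TwoCycleConjecture.eventually_le_of_even`).
* The number of machines of the subroutine depends on the number of edges, so that each machine has
  to simulate a block of its machines (`Setup`, `Setup.exists_fits`).

The algorithm is written as a sequence of rounds with structured states and messages (`Step`);
`exists_compile` turns such a sequence into an algorithm in the sense of the model by counting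
states and records. The combinatorics of contracting edges of a union of cycles is in
`IsCycleCover.not_isDiag_map`, `IsCycleCover.injOn_map` and `IsCycleCover.dist_labelGraph_le`, the
correctness of the rounds in `Setup.run_steps`, the probabilities in `pr_not_goodHashes_le` and
`Setup.pr_not_ok_le`, and the choice of `q` and `K` in `exists_parameters`.
-/

/-! ### Uniform probability on a finite type -/

open Classical in
/-- The probability of an event under the uniform distribution on a finite type. -/
noncomputable def pr {Ω : Type*} [Fintype Ω] (P : Ω → Prop) : ℝ :=
  ((Finset.univ.filter P).card : ℝ) / Fintype.card Ω

section pr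

variable {Ω Ω' : Type*} [Fintype Ω] [Fintype Ω']

theorem pr_nonneg (P : Ω → Prop) : 0 ≤ pr P := by unfold pr; positivity

theorem pr_mono {P Q : Ω → Prop} (h : ∀ ω, P ω → Q ω) : pr P ≤ pr Q := by
  classical
  unfold pr
  gcongr
  exact h _

theorem pr_or_le (P Q : Ω → Prop) : pr (fun ω => P ω ∨ Q ω) ≤ pr P + pr Q := by
  classical
  unfold pr
  rw [← add_div]
  gcongr
  have : (Finset.univ.filter fun ω => P ω ∨ Q ω) = Finset.univ.filter P ∪ Finset.univ.filter Q := by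
    ext; simp
  have h2 := Finset.card_union_le (Finset.univ.filter P) (Finset.univ.filter Q)
  rw [← this] at h2
  convert (Nat.cast_le (α := ℝ)).2 h2 using 1
  · congr
  · push_cast; rfl

theorem pr_false : pr (fun _ : Ω => False) = 0 := by simp [pr]

theorem pr_exists_le {ι : Type*} (s : Finset ι) (P : ι → Ω → Prop) :
    pr (fun ω => ∃ i ∈ s, P i ω) ≤ ∑ i ∈ s, pr (P i) := by
  classical
  induction s using Finset.induction_on with
  | empty => simp [pr_false]
  | insert a s ha ih =>
    rw [Finset.sum_insert ha]
    refine le_trans (le_trans (pr_mono ?_) (pr_or_le (P a) (fun ω => ∃ i ∈ s, P i ω))) (by gcongr)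
    intro ω
    simp

theorem pr_not [Nonempty Ω] (P : Ω → Prop) : pr (fun ω => ¬ P ω) = 1 - pr P := by
  classical
  have h0 : (Fintype.card Ω : ℝ) ≠ 0 := by exact_mod_cast Fintype.card_ne_zero
  unfold pr
  rw [eq_sub_iff_add_eq, ← add_div, div_eq_one_iff_eq h0, add_comm]
  have h1 := Finset.card_filter_add_card_filter_not (s := Finset.univ) P
  rw [Finset.card_univ] at h1
  rw [← h1]
  push_cast
  congr

theorem pr_equiv (e : Ω' ≃ Ω) (P : Ω → Prop) : pr (fun ω => P (e ω)) = pr P := by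
  classical
  unfold pr
  rw [Fintype.card_congr e]
  congr 2
  refine Finset.card_bij (fun a _ => e a) ?_ (fun _ _ _ _ h => e.injective h) ?_
  · intro a ha; simpa using ha
  · intro b hb; exact ⟨e.symm b, by simpa using hb, by simp⟩

/-- A probability on a product is the average of the probabilities on the fibres, and hence at most
`p` if these are. -/
theorem pr_prod_le_of_fst {P : Ω × Ω' → Prop} {p : ℝ} (hp : 0 ≤ p)
    (h : ∀ y, pr (fun x => P (x, y)) ≤ p) : pr P ≤ p := by
  classical
  have key : ((Finset.univ.filter P).card : ℝ) =
      ∑ y : Ω', ((Finset.univ.filter fun x => P (x, y)).card : ℝ) := by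
    rw [← Nat.cast_sum]
    congr 1
    rw [Finset.card_eq_sum_card_fiberwise (f := Prod.snd) (t := Finset.univ) (by simp)]
    refine Finset.sum_congr rfl fun y _ => ?_
    refine Finset.card_bij (fun a _ => a.1) ?_ ?_ ?_
    · rintro ⟨a, b⟩ hab; simp at hab ⊢; obtain ⟨h1, rfl⟩ := hab; exact h1
    · rintro ⟨a, b⟩ hab ⟨a', b'⟩ hab' h; simp at hab hab' h ⊢; exact ⟨h, hab.2.trans hab'.2.symm⟩
    · intro x hx; exact ⟨(x, y), by simpa using hx, rfl⟩
  rcases isEmpty_or_nonempty Ω with hΩ | hΩ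
  · simpa [pr] using hp
  have hc : (0 : ℝ) < Fintype.card Ω := by exact_mod_cast Fintype.card_pos
  unfold pr
  rw [key]
  refine div_le_of_le_mul₀ (by positivity) hp ?_
  have : ∀ y : Ω', ((Finset.univ.filter fun x => P (x, y)).card : ℝ) ≤ p * Fintype.card Ω := by
    intro y
    have := h y
    unfold pr at this
    rwa [div_le_iff₀ hc] at this
  calc _ ≤ ∑ y : Ω', p * (Fintype.card Ω : ℝ) := Finset.sum_le_sum fun y _ => this y
    _ = _ := by simp [Fintype.card_prod]; ring

theorem pr_prod_le_of_snd {P : Ω × Ω' → Prop} {p : ℝ} (hp : 0 ≤ p)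
    (h : ∀ x, pr (fun y => P (x, y)) ≤ p) : pr P ≤ p := by
  rw [← pr_equiv (Equiv.prodComm Ω' Ω)]
  exact pr_prod_le_of_fst hp h

/-- Conditioning on all coordinates but one. -/
theorem pr_pi_le {ι : Type*} [Fintype ι] [DecidableEq ι] {X : ι → Type*} [∀ i, Fintype (X i)]
    {P : (∀ i, X i) → Prop} {p : ℝ} (hp : 0 ≤ p) (j : ι)
    (h : ∀ ω, pr (fun x : X j => P (Function.update ω j x)) ≤ p) : pr P ≤ p := by
  classical
  rw [← pr_equiv (Equiv.piSplitAt j X).symm]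
  refine pr_prod_le_of_fst hp fun f => ?_
  rcases isEmpty_or_nonempty (X j) with hX | ⟨⟨x0⟩⟩
  · simpa [pr] using hp
  refine le_trans (pr_mono fun x hx => ?_) (h ((Equiv.piSplitAt j X).symm (x0, f)))
  convert hx using 1
  funext i
  by_cases hi : i = j
  · subst hi; simp [Equiv.piSplitAt]
  · simp [Equiv.piSplitAt, hi]

theorem pr_pi_eval_le {ι : Type*} [Fintype ι] [DecidableEq ι] {X : ι → Type*} [∀ i, Fintype (X i)]
    (j : ι) (P : X j → Prop) : pr (fun ω : ∀ i, X i => P (ω j)) ≤ pr P :=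
  pr_pi_le (pr_nonneg _) j fun ω => by simp

/-- Two independent events, at two different coordinates. -/
theorem pr_pi_two_le {ι : Type*} [Fintype ι] [DecidableEq ι] {P : Ω → Prop} {i j : ι}
    (hij : i ≠ j) : pr (fun ω : ι → Ω => P (ω i) ∧ P (ω j)) ≤ pr P ^ 2 := by
  classical
  let e := Equiv.piSplitAt i (fun _ : ι => Ω)
  rw [← pr_equiv e.symm]
  have h1 : ∀ x : Ω × (∀ k : {k // k ≠ i}, Ω), (P (e.symm x i) ∧ P (e.symm x j)) ↔
      (P x.1 ∧ P (x.2 ⟨j, hij.symm⟩)) := by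
    intro x; simp [e, Equiv.piSplitAt, hij.symm]
  simp only [h1]
  have h2 := pr_pi_eval_le (X := fun _ : {k // k ≠ i} => Ω) ⟨j, hij.symm⟩ P
  have h3 : pr (fun x : Ω × (∀ k : {k // k ≠ i}, Ω) => P x.1 ∧ P (x.2 ⟨j, hij.symm⟩)) =
      pr P * pr (fun ω : {k // k ≠ i} → Ω => P (ω ⟨j, hij.symm⟩)) := by
    unfold pr
    rw [div_mul_div_comm, Fintype.card_prod]
    push_cast
    congr 1
    rw [← Nat.cast_mul, ← Finset.card_product]
    congr 2
    ext x
    simp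
  rw [h3, sq]
  exact mul_le_mul_of_nonneg_left h2 (pr_nonneg _)

/-- Of three independent samples, at least two fall into an event of probability `p` with
probability at most `3 * p ^ 2`. -/
theorem pr_two_of_three_le {P : Ω → Prop} :
    pr (fun ω : Fin 3 → Ω => ∃ i j, i ≠ j ∧ P (ω i) ∧ P (ω j)) ≤ 3 * pr P ^ 2 := by
  have h1 := pr_pi_two_le (P := P) (i := (0 : Fin 3)) (j := 1) (by decide)
  have h2 := pr_pi_two_le (P := P) (i := (0 : Fin 3)) (j := 2) (by decide)
  have h3 := pr_pi_two_le (P := P) (i := (1 : Fin 3)) (j := 2) (by decide)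
  have h4 := pr_or_le (fun ω : Fin 3 → Ω => P (ω 0) ∧ P (ω 1))
    (fun ω => (P (ω 0) ∧ P (ω 2)) ∨ (P (ω 1) ∧ P (ω 2)))
  have h5 := pr_or_le (fun ω : Fin 3 → Ω => P (ω 0) ∧ P (ω 2)) (fun ω => (P (ω 1) ∧ P (ω 2)))
  refine le_trans (pr_mono (Q := fun ω : Fin 3 → Ω => (P (ω 0) ∧ P (ω 1)) ∨
    ((P (ω 0) ∧ P (ω 2)) ∨ (P (ω 1) ∧ P (ω 2)))) ?_) (by linarith)
  rintro ω ⟨i, j, hij, hi, hj⟩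
  fin_cases i <;> fin_cases j <;> simp_all

end pr

/-! ### Rounds with abstract states and messages -/

/-- One round of communication between `M` machines whose states are elements of an arbitrary
type `X` and whose messages are lists of records of type `α`. -/
structure Step (M : ℕ) (X α : Type) where
  /-- the message from a machine in the given state to another machine -/
  send : Fin M → X → Fin M → List α
  /-- the new state of a machine, given the messages that it received -/
  update : Fin M → X → (Fin M → List α) → X

namespace Step

variable {M : ℕ} {X α Y Z : Type}

/-- The states of all machines after a round. -/
def apply (s : Step M X α) (x : Fin M → X) : Fin M → X :=
  fun i => s.update i (x i) fun j => s.send j (x j) i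

/-- The states of all machines after `t` rounds. -/
def run (P : ℕ → Step M X α) (x : Fin M → X) : ℕ → Fin M → X
  | 0 => x
  | t + 1 => (P t).apply (run P x t)

/-- Every machine sends and receives at most `B` records. -/
def Bounded (s : Step M X α) (B : ℕ) (x : Fin M → X) : Prop :=
  ∀ i, (∑ j, (s.send i (x i) j).length) ≤ B ∧ (∑ j, (s.send j (x j) i).length) ≤ B

/-- The message of a machine in the coded state `y`, suppressed if it exceeds the limit `B`. -/
def guardedMessage (s : Step M X α) (B : ℕ) (dec : Fin M → Y → X) (code : α → Z)
    (i : Fin M) (y : Y) (j : Fin M) : List Z :=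
  if (∑ k, (s.send i (dec i y) k).length) ≤ B then (s.send i (dec i y) j).map code else []

theorem sum_guardedMessage_le (s : Step M X α) (B : ℕ) (dec : Fin M → Y → X) (code : α → Z)
    (i : Fin M) (y : Y) : ∑ j, (s.guardedMessage B dec code i y j).length ≤ B := by
  unfold guardedMessage
  split_ifs with h
  · simpa using h
  · simp

theorem length_guardedMessage_le (s : Step M X α) (B : ℕ) (dec : Fin M → Y → X) (code : α → Z)
    (i : Fin M) (y : Y) (j : Fin M) : (s.guardedMessage B dec code i y j).length ≤ B :=
  (Finset.single_le_sum (f := fun j => (s.guardedMessage B dec code i y j).length)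
    (fun _ _ => Nat.zero_le _) (Finset.mem_univ j)).trans (s.sum_guardedMessage_le B dec code i y)

/-- First part of a guarded round: every machine announces the lengths of its messages, and
computes whether it could receive everything that is announced to it. -/
def announce (s : Step M X α) (B : ℕ) (dec : Fin M → Y → X) (code : α → Z) :
    Step M (Y × (Fin M → Bool)) (Fin (B + 1) ⊕ Z) where
  send i y j := [Sum.inl ⟨(s.guardedMessage B dec code i y.1 j).length,
    Nat.lt_succ_of_le (s.length_guardedMessage_le B dec code i y.1 j)⟩]
  update _ y ms := (y.1, fun _ => decide
    ((∑ j, ((ms j).map (fun r => (Sum.elim (fun c : Fin (B + 1) => (c : ℕ)) (fun _ => 0) r))).sum)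
      ≤ B))

/-- Second part of a guarded round: every machine tells the others whether it accepts messages. -/
def acknowledge (B : ℕ) : Step M (Y × (Fin M → Bool)) (Fin (B + 1) ⊕ Z) where
  send _ y j := if y.2 j then [Sum.inl 0] else []
  update _ y ms := (y.1, fun j => !(ms j).isEmpty)

/-- Third part of a guarded round: the messages are sent to the machines that accept them. -/
def deliver (s : Step M X α) (B : ℕ) (enc : Fin M → X → Y) (dec : Fin M → Y → X) (code : α → Z)
    (decode : Z → α) : Step M (Y × (Fin M → Bool)) (Fin (B + 1) ⊕ Z) where
  send i y j := if y.2 j then (s.guardedMessage B dec code i y.1 j).map Sum.inr else []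
  update i y ms := (enc i (s.update i (dec i y.1) fun j =>
    (ms j).filterMap fun r => r.getRight?.map decode), fun _ => false)

/-- The guarded version of a sequence of rounds, with three rounds for each of its rounds and with
states and records replaced by codes for them. It never exceeds the limit `B` on the communication,
and it agrees with the given sequence as long as that one does not exceed it either. -/
def guard (P : ℕ → Step M X α) (B : ℕ) (enc : Fin M → X → Y) (dec : Fin M → Y → X) (code : α → Z)
    (decode : Z → α) (t : ℕ) : Step M (Y × (Fin M → Bool)) (Fin (B + 1) ⊕ Z) :=
  if t % 3 = 0 then (P (t / 3)).announce B dec code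
  else if t % 3 = 1 then acknowledge B
  else (P (t / 3)).deliver B enc dec code decode

section guard

variable (P : ℕ → Step M X α) (B : ℕ) (enc : Fin M → X → Y) (dec : Fin M → Y → X) (code : α → Z)
  (decode : Z → α)

theorem guard_zero (t : ℕ) : guard P B enc dec code decode (3 * t) = (P t).announce B dec code := by
  have h1 : 3 * t % 3 = 0 := by omega
  have h2 : 3 * t / 3 = t := by omega
  simp [guard, h1, h2]

theorem guard_one (t : ℕ) : guard P B enc dec code decode (3 * t + 1) = acknowledge B := by
  have h1 : (3 * t + 1) % 3 = 1 := by omega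
  simp [guard, h1]

theorem guard_two (t : ℕ) :
    guard P B enc dec code decode (3 * t + 2) = (P t).deliver B enc dec code decode := by
  have h1 : (3 * t + 2) % 3 = 2 := by omega
  have h2 : (3 * t + 2) / 3 = t := by omega
  simp [guard, h1, h2]

/-- Whether machine `i` accepts the messages announced to it. -/
def accepts (s : Step M X α) (y : Fin M → Y) (i : Fin M) : Bool :=
  decide ((∑ j, (s.guardedMessage B dec code j (y j) i).length) ≤ B)

theorem apply_announce (s : Step M X α) (y : Fin M → Y × (Fin M → Bool)) :
    (s.announce B dec code).apply y =
      fun i => ((y i).1, fun _ => s.accepts B dec code (fun j => (y j).1) i) := by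
  funext i
  simp [apply, announce, accepts]

theorem apply_acknowledge (y : Fin M → Y × (Fin M → Bool)) (f : Fin M → Bool)
    (hf : ∀ i, (y i).2 = fun _ => f i) :
    (acknowledge (M := M) (Y := Y) (Z := Z) B).apply y = fun i => ((y i).1, f) := by
  funext i
  simp only [apply, acknowledge, hf]
  congr 1
  funext j
  cases f j <;> simp

variable {P B enc dec code decode}

theorem run_guard_one (y0 : Fin M → Y × (Fin M → Bool)) (t : ℕ) :
    run (guard P B enc dec code decode) y0 (3 * t + 1) =
      fun i => ((run (guard P B enc dec code decode) y0 (3 * t) i).1, fun _ =>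
        (P t).accepts B dec code
          (fun j => (run (guard P B enc dec code decode) y0 (3 * t) j).1) i) := by
  conv_lhs => rw [run, guard_zero, apply_announce]

theorem run_guard_two (y0 : Fin M → Y × (Fin M → Bool)) (t : ℕ) :
    run (guard P B enc dec code decode) y0 (3 * t + 2) =
      fun i => ((run (guard P B enc dec code decode) y0 (3 * t) i).1,
        (P t).accepts B dec code
          (fun j => (run (guard P B enc dec code decode) y0 (3 * t) j).1)) := by
  conv_lhs => rw [run, guard_one, run_guard_one]
  rw [apply_acknowledge B _ ((P t).accepts B dec code
    (fun j => (run (guard P B enc dec code decode) y0 (3 * t) j).1)) (fun i => rfl)]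

theorem guard_bounded (hM : M ≤ B) (y0 : Fin M → Y × (Fin M → Bool)) (t : ℕ) :
    (guard P B enc dec code decode t).Bounded B (run (guard P B enc dec code decode) y0 t) := by
  obtain ⟨k, hk | hk | hk⟩ : ∃ k, t = 3 * k ∨ t = 3 * k + 1 ∨ t = 3 * k + 2 := ⟨t / 3, by omega⟩
  · subst hk
    intro i
    rw [guard_zero]
    simp [announce, hM]
  · subst hk
    have aux : ∀ b : Bool,
        (if b = true then [Sum.inl 0] else [] : List (Fin (B + 1) ⊕ Z)).length ≤ 1 := by
      intro b; cases b <;> simp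
    intro i
    rw [guard_one]
    exact ⟨(Finset.sum_le_card_nsmul _ _ 1 fun j _ => aux _).trans (by simpa using hM),
      (Finset.sum_le_card_nsmul _ _ 1 fun j _ => aux _).trans (by simpa using hM)⟩
  · subst hk
    intro i
    rw [guard_two, run_guard_two]
    simp only [deliver]
    constructor
    · refine le_trans (Finset.sum_le_sum fun j _ => ?_)
        ((P k).sum_guardedMessage_le B dec code i
          (run (guard P B enc dec code decode) y0 (3 * k) i).1)
      split_ifs <;> simp
    · by_cases h : (P k).accepts B dec code
          (fun j => (run (guard P B enc dec code decode) y0 (3 * k) j).1) i = true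
      · simp only [h, if_true, List.length_map]
        simpa [accepts] using h
      · simp [h]

/-- As long as the original rounds respect all limits, the guarded rounds agree with them. -/
theorem run_guard {x0 : Fin M → X} {T : ℕ}
    (hB : ∀ t < T, (P t).Bounded B (run P x0 t))
    (hmsg : ∀ t < T, ∀ i j, ∀ a ∈ (P t).send i (run P x0 t i) j, decode (code a) = a)
    (hst : ∀ t ≤ T, ∀ i, dec i (enc i (run P x0 t i)) = run P x0 t i) :
    ∀ t ≤ T, run (guard P B enc dec code decode) (fun i => (enc i (x0 i), fun _ => false)) (3 * t) =
      fun i => (enc i (run P x0 t i), fun _ => false) := by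
  intro t
  induction t with
  | zero => intro _; rfl
  | succ t ih =>
    intro ht
    have ih := ih (by omega)
    have ht' : t < T := by omega
    rw [show 3 * (t + 1) = 3 * t + 2 + 1 by ring, run, guard_two, run_guard_two, ih]
    have hm : ∀ i j, (P t).guardedMessage B dec code i (enc i (run P x0 t i)) j =
        ((P t).send i (run P x0 t i) j).map code := by
      intro i j
      rw [guardedMessage, hst t ht'.le, if_pos (hB t ht' i).1]
    have hacc : ∀ i, (P t).accepts B dec code (fun j => enc j (run P x0 t j)) i = true := by
      intro i
      simpa [accepts, hm] using (hB t ht' i).2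
    funext i
    simp only [apply, deliver, hacc, if_true, hm, hst t ht'.le, run]
    congr 3
    funext j
    rw [List.filterMap_map, List.filterMap_map]
    conv_rhs => rw [← List.filterMap_some (l := (P t).send j (run P x0 t j) i)]
    refine List.filterMap_congr fun a ha => ?_
    simp [hmsg t ht' j i a ha]

end guard

/-! ### Three independent copies -/

/-- Three sequences of rounds, run in parallel. -/
def triple (Q : Fin 3 → ℕ → Step M X α) (t : ℕ) : Step M (Fin 3 → X) (Fin 3 × α) where
  send i x j := (List.finRange 3).flatMap fun r => ((Q r t).send i (x r) j).map fun a => (r, a)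
  update i x ms := fun r => (Q r t).update i (x r) fun j =>
    (ms j).filterMap fun a => if a.1 = r then some a.2 else none

theorem run_triple (Q : Fin 3 → ℕ → Step M X α) (x0 : Fin M → Fin 3 → X) (t : ℕ) :
    run (triple Q) x0 t = fun i r => run (Q r) (fun i => x0 i r) t i := by
  induction t with
  | zero => rfl
  | succ t ih =>
    funext i r
    simp only [run, apply, ih, triple]
    congr 1
    funext j
    fin_cases r <;> simp [List.finRange_succ, List.filterMap_map]

theorem triple_bounded {Q : Fin 3 → ℕ → Step M X α} {x0 : Fin M → Fin 3 → X} {t B : ℕ}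
    (h : ∀ r, (Q r t).Bounded B (run (Q r) (fun i => x0 i r) t)) :
    (triple Q t).Bounded (3 * B) (run (triple Q) x0 t) := by
  intro i
  rw [run_triple]
  have h0 := h 0 i
  have h1 := h 1 i
  have h2 := h 2 i
  simp only [triple, List.finRange_succ, List.finRange_zero]
  simp [Finset.sum_add_distrib]
  omega

end Step

/-! ### Coding into words -/

theorem exists_injective_code {X Y : Type*} [Fintype X] [Fintype Y]
    (h : Fintype.card X ≤ Fintype.card Y) : ∃ f : X → Y, Function.Injective f := by
  obtain ⟨f⟩ := Function.Embedding.nonempty_of_card_le h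
  exact ⟨f, f.injective⟩

/-- A set with at most as many elements as `Y` has a code in `Y`. -/
theorem exists_code {X Y : Type*} [Nonempty X] [Nonempty Y] [Fintype Y] (s : Set X)
    (hs : s.Finite) (h : s.ncard ≤ Fintype.card Y) :
    ∃ (enc : X → Y) (dec : Y → X), ∀ x ∈ s, dec (enc x) = x := by
  classical
  have := hs.fintype
  rw [Set.ncard_eq_toFinset_card', Set.toFinset_card] at h
  obtain ⟨f, hf⟩ := exists_injective_code h
  refine ⟨fun x => if hx : x ∈ s then f ⟨x, hx⟩ else Classical.arbitrary Y,
    fun y => if hy : ∃ x : s, f x = y then hy.choose else Classical.arbitrary X, fun x hx => ?_⟩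
  have hy : ∃ x' : s, f x' = f ⟨x, hx⟩ := ⟨_, rfl⟩
  simp only [hx, dif_pos, hy]
  exact congrArg Subtype.val (hf hy.choose_spec)

/-- There are at most `(card Y + 1) ^ k` sets of at most `k` elements of `Y`. -/
theorem ncard_finset_le {Y : Type*} [Fintype Y] (k : ℕ) :
    {E : Finset Y | E.card ≤ k}.ncard ≤ (Fintype.card Y + 1) ^ k := by
  classical
  have h : {E : Finset Y | E.card ≤ k} ⊆
      Set.range (fun f : Fin k → Option Y => Finset.univ.filter fun y => ∃ i, f i = some y) := by
    intro E hE
    refine ⟨fun i => E.toList[(i : ℕ)]?, ?_⟩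
    ext y
    simp only [Finset.mem_filter, Finset.mem_univ, true_and]
    rw [← Finset.mem_toList, List.mem_iff_getElem?]
    constructor
    · rintro ⟨i, hi⟩; exact ⟨i, hi⟩
    · rintro ⟨i, hi⟩
      have : i < E.toList.length := (List.getElem?_eq_some_iff.1 hi).1
      rw [Finset.length_toList] at this
      exact ⟨⟨i, this.trans_le hE⟩, hi⟩
  refine (Set.ncard_le_ncard h (Set.finite_range _)).trans ?_
  rw [← Set.image_univ]
  refine (Set.ncard_image_le Set.finite_univ).trans ?_
  simp [Set.ncard_univ]

/-- The concatenation of the words of the records of a list. -/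
def flatCode {α β : Type*} {w : ℕ} (f : α → Fin w → β) (l : List α) : List β :=
  l.flatMap fun a => List.ofFn (f a)

theorem length_flatCode {α β : Type*} {w : ℕ} (f : α → Fin w → β) (l : List α) :
    (flatCode f l).length = w * l.length := by
  simp [flatCode, List.length_flatMap, mul_comm]

theorem flatCode_injective {α β : Type*} {w : ℕ} (hw : 0 < w) {f : α → Fin w → β}
    (hf : Function.Injective f) : Function.Injective (flatCode f) := by
  intro l
  induction l with
  | nil =>
    intro l' h
    have := congrArg List.length h
    simp only [length_flatCode, List.length_nil, mul_zero] at this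
    have : l'.length = 0 := by
      rcases Nat.mul_eq_zero.1 this.symm with h | h
      · omega
      · exact h
    exact (List.length_eq_zero_iff.1 this).symm
  | cons a l ih =>
    intro l' h
    cases l' with
    | nil =>
      have := congrArg List.length h
      simp only [length_flatCode, List.length_nil, mul_zero, List.length_cons] at this
      have := Nat.mul_eq_zero.1 this
      omega
    | cons b l' =>
      simp only [flatCode, List.flatMap_cons] at h
      obtain ⟨h1, h2⟩ := List.append_inj h (by simp)
      rw [hf (List.ofFn_injective h1), ih h2]

/-! ### Compilation to algorithms in words -/

/-- The algorithm that first moves every edge `e` to the machine `own e` and then performs the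
given rounds, all states and messages being written in words by means of the given codes. -/
@[reducible] noncomputable def compile {n M S : ℕ} {Ω X α : Type} [Fintype Ω] [Nonempty Ω]
    (P : Ω → ℕ → Step M X α) (init : Fin M → Finset (Sym2 (Fin n)) → X) (out : Fin M → X → Bool)
    (own : Sym2 (Fin n) → Fin M)
    (enc0 : Finset (Sym2 (Fin n)) → MPCMemory n S) (dec0 : MPCMemory n S → Finset (Sym2 (Fin n)))
    (encX : X → MPCMemory n S) (decX : MPCMemory n S → X)
    (encE : List (Sym2 (Fin n)) → List (Fin n)) (decE : List (Fin n) → List (Sym2 (Fin n)))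
    (encA : List α → List (Fin n)) (decA : List (Fin n) → List α) :
    MPCAlgorithm n M S Bool where
  Seed := Ω
  load _ _ E := enc0 E
  send s t i x j :=
    match t with
    | 0 => encE ((dec0 x).toList.filter fun e => own e = j)
    | t + 1 => encA ((P s t).send i (decX x) j)
  update s t i x ms :=
    match t with
    | 0 => encX (init i (Finset.univ.filter fun e => ∃ k, e ∈ decE (ms k)))
    | t + 1 => encX ((P s t).update i (decX x) fun j => decA (ms j))
  output _ i x := out i (decX x)

theorem sum_length_filter_eq {ι κ : Type*} [Fintype κ] [DecidableEq κ] (l : List ι) (f : ι → κ) :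
    ∑ k, (l.filter fun e => f e = k).length = l.length := by
  induction l with
  | nil => simp
  | cons a l ih =>
    simp only [List.filter_cons, decide_eq_true_eq]
    have : ∀ k, (if f a = k then a :: l.filter (fun e => decide (f e = k))
        else l.filter fun e => decide (f e = k)).length =
        (l.filter fun e => decide (f e = k)).length + if f a = k then 1 else 0 := by
      intro k; split_ifs <;> simp
    simp [this, Finset.sum_add_distrib, ih]

/-- The edges of `G` that are moved to machine `k`. -/
noncomputable def ownedEdges {n M : ℕ} (G : SimpleGraph (Fin n)) (own : Sym2 (Fin n) → Fin M)
    (k : Fin M) : Finset (Sym2 (Fin n)) := by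
  classical exact Finset.univ.filter fun e => e ∈ G.edgeSet ∧ own e = k

/-- The sets of edges that may be placed on a machine can be coded into its memory. -/
theorem ncard_edgeSets_le {n S : ℕ} [NeZero n] :
    {E : Finset (Sym2 (Fin n)) | 2 * E.card ≤ S ∧ ∀ e ∈ E, ¬ e.IsDiag}.ncard ≤ n ^ S := by
  classical
  have hsub : {E : Finset (Sym2 (Fin n)) | 2 * E.card ≤ S ∧ ∀ e ∈ E, ¬ e.IsDiag} ⊆
      (fun E : Finset {e : Sym2 (Fin n) // ¬ e.IsDiag} => E.map (Function.Embedding.subtype _)) ''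
        {E | E.card ≤ S / 2} := by
    rintro E ⟨h1, h2⟩
    refine ⟨E.subtype _, ?_, ?_⟩
    · rw [Set.mem_ofPred_eq, Finset.card_subtype, Finset.filter_true_of_mem h2]
      omega
    · simp only [Finset.subtype_map]
      exact Finset.filter_true_of_mem h2
  have hn : 0 < n := NeZero.pos n
  refine (Set.ncard_le_ncard hsub (Set.toFinite _)).trans ?_
  refine (Set.ncard_image_le (Set.toFinite _)).trans ?_
  refine (ncard_finset_le _).trans ?_
  rw [Sym2.card_subtype_not_diag, Fintype.card_fin]
  have h1 : n.choose 2 + 1 ≤ n ^ 2 := by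
    rw [Nat.choose_two_right]
    have : n * (n - 1) / 2 * 2 ≤ n * (n - 1) := Nat.div_mul_le_self _ _
    obtain ⟨k, rfl⟩ : ∃ k, n = k + 1 := ⟨n - 1, by omega⟩
    simp only [Nat.add_sub_cancel] at *
    nlinarith
  calc (n.choose 2 + 1) ^ (S / 2) ≤ (n ^ 2) ^ (S / 2) := Nat.pow_le_pow_left h1 _
    _ = n ^ (2 * (S / 2)) := by rw [pow_mul]
    _ ≤ n ^ S := Nat.pow_le_pow_right hn (by omega)

/-- Rounds whose states and records are few enough for the given numbers of words can be performed
by an MPC algorithm, after one round that moves the edges to given machines. -/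
theorem exists_compile {n M S B w : ℕ} [NeZero n] {Ω X α : Type} [Fintype Ω] [Nonempty Ω]
    [Fintype X] [Nonempty X] [Fintype α]
    (P : Ω → ℕ → Step M X α) (init : Fin M → Finset (Sym2 (Fin n)) → X) (out : Fin M → X → Bool)
    (own : Sym2 (Fin n) → Fin M)
    (hX : Fintype.card X ≤ n ^ S) (hα : Fintype.card α ≤ n ^ w) (hw : 0 < w) (hB : w * B ≤ S)
    (T : ℕ)
    (hP : ∀ s t G, t < T →
      (P s t).Bounded B (Step.run (P s) (fun i => init i (ownedEdges G own i)) t)) :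
    ∃ A : MPCAlgorithm n M S Bool, ∀ G : SimpleGraph (Fin n),
      (∀ k, 2 * (ownedEdges G own k).card ≤ S) →
      ∀ inp : Fin M → Finset (Sym2 (Fin n)), IsEdgeDistribution G S inp →
      ∀ correct : (Fin M → Bool) → Prop,
      pr (fun s => correct fun i =>
        out i (Step.run (P s) (fun i => init i (ownedEdges G own i)) T i)) ≤
        A.successProb inp (T + 1) correct := by
  classical
  have hn : 0 < n := NeZero.pos n
  have : Nonempty (Fin n) := ⟨⟨0, hn⟩⟩
  obtain ⟨enc0, dec0, h0⟩ := exists_code (Y := MPCMemory n S)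
    {E : Finset (Sym2 (Fin n)) | 2 * E.card ≤ S ∧ ∀ e ∈ E, ¬ e.IsDiag} (Set.toFinite _)
    (by simpa using ncard_edgeSets_le)
  obtain ⟨encX, hencX⟩ := exists_injective_code (X := X) (Y := MPCMemory n S) (by simpa using hX)
  obtain ⟨cE, hcE⟩ := exists_injective_code (X := Sym2 (Fin n)) (Y := Fin 2 → Fin n) (by
    rw [Sym2.card, Fintype.card_fin, Fintype.card_fun, Fintype.card_fin, Fintype.card_fin,
      Nat.choose_two_right]
    have : (n + 1) * (n + 1 - 1) / 2 * 2 ≤ (n + 1) * (n + 1 - 1) := Nat.div_mul_le_self _ _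
    simp only [Nat.add_sub_cancel] at *
    nlinarith)
  obtain ⟨cA, hcA⟩ := exists_injective_code (X := α) (Y := Fin w → Fin n) (by simpa using hα)
  have hE := Function.leftInverse_invFun (flatCode_injective two_pos hcE)
  have hA := Function.leftInverse_invFun (flatCode_injective hw hcA)
  have hXi := Function.leftInverse_invFun hencX
  let A := compile P init out own enc0 dec0 encX (Function.invFun encX) (flatCode cE)
    (Function.invFun (flatCode cE)) (flatCode cA) (Function.invFun (flatCode cA))
  refine ⟨A, fun G hG inp hinp correct => ?_⟩
  have hdec : ∀ i, dec0 (enc0 (inp i)) = inp i := fun i =>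
    h0 _ ⟨hinp.2.2 i, fun e he => G.not_isDiag_of_mem_edgeSet (hinp.1 i e he)⟩
  have hmem : ∀ s t, A.memAfter inp s (t + 1) =
      fun i => encX (Step.run (P s) (fun i => init i (ownedEdges G own i)) t i) := by
    intro s t
    induction t with
    | zero =>
      funext i
      change encX (init i (Finset.univ.filter fun e => ∃ k, e ∈ Function.invFun (flatCode cE)
        (flatCode cE ((dec0 (enc0 (inp k))).toList.filter fun e => own e = i)))) = _
      simp only [hE _, hdec]
      congr 2
      ext e
      simp only [ownedEdges, Finset.mem_filter, Finset.mem_univ, true_and, List.mem_filter,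
        Finset.mem_toList, decide_eq_true_eq]
      constructor
      · rintro ⟨k, hk, rfl⟩; exact ⟨hinp.1 k e hk, rfl⟩
      · rintro ⟨he, rfl⟩
        obtain ⟨k, hk, -⟩ := hinp.2.1 e he
        exact ⟨k, hk, rfl⟩
    | succ t ih =>
      funext i
      change encX ((P s t).update i (Function.invFun encX (A.memAfter inp s (t + 1) i)) fun j =>
        Function.invFun (flatCode cA) (flatCode cA
          ((P s t).send j (Function.invFun encX (A.memAfter inp s (t + 1) j)) i))) = _
      simp only [ih, hA _, hXi _]
      rfl
  have hband : ∀ s, A.RespectsBandwidth inp s (T + 1) := by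
    intro s t ht i
    cases t with
    | zero =>
      change (∑ j, (flatCode cE ((dec0 (enc0 (inp i))).toList.filter fun e =>
          own e = j)).length) ≤ S
        ∧ (∑ j, (flatCode cE ((dec0 (enc0 (inp j))).toList.filter fun e => own e = i)).length) ≤ S
      simp only [hdec, length_flatCode, ← Finset.mul_sum]
      constructor
      · rw [sum_length_filter_eq, Finset.length_toList]
        exact hinp.2.2 i
      · refine le_trans (Nat.mul_le_mul_left 2 ?_) (hG i)
        have h2 : ∀ j, ((inp j).toList.filter fun e => own e = i).length =
            ((inp j).filter fun e => own e = i).card := by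
          intro j
          rw [← List.toFinset_card_of_nodup ((Finset.nodup_toList _).filter _)]
          congr 1
          ext e
          simp
        simp only [h2]
        rw [← Finset.card_biUnion]
        · refine Finset.card_le_card fun e he => ?_
          simp only [Finset.mem_biUnion, Finset.mem_univ, true_and, Finset.mem_filter,
            ownedEdges] at he ⊢
          obtain ⟨j, hj, h⟩ := he
          exact ⟨hinp.1 j e hj, h⟩
        · intro j _ k _ hjk
          refine Finset.disjoint_left.2 fun e he he' => hjk ?_
          simp only [Finset.mem_filter] at he he'
          exact (hinp.2.1 e (hinp.1 j e he.1)).unique he.1 he'.1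
    | succ t =>
      change (∑ j, (flatCode cA
          ((P s t).send i (Function.invFun encX (A.memAfter inp s (t + 1) i)) j)).length) ≤ S ∧
        (∑ j, (flatCode cA
          ((P s t).send j (Function.invFun encX (A.memAfter inp s (t + 1) j)) i)).length) ≤ S
      simp only [hmem, hXi _, length_flatCode, ← Finset.mul_sum]
      have := hP s t G (by omega) i
      exact ⟨(Nat.mul_le_mul_left w this.1).trans hB, (Nat.mul_le_mul_left w this.2).trans hB⟩
  refine le_trans (pr_mono (Ω := Ω) (Q := fun s : Ω => A.RespectsBandwidth inp s (T + 1) ∧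
    correct (A.outputs inp s (T + 1))) fun s hs => ⟨hband s, ?_⟩) (le_of_eq ?_)
  · have : A.outputs inp s (T + 1) = fun i =>
        out i (Step.run (P s) (fun i => init i (ownedEdges G own i)) T i) := by
      funext i
      change out i (Function.invFun encX (A.memAfter inp s (T + 1) i)) = _
      rw [hmem, hXi _]
    rw [this]
    exact hs
  · unfold pr MPCAlgorithm.successProb
    congr

/-- Amplification: three guarded copies of randomized rounds with a majority vote. If, with
probability at least `1 - p`, the rounds respect the limits on states, records and communication and
give the answer `ans` on every machine, then the resulting algorithm gives this answer with
probability at least `1 - 3 * p ^ 2`. The states of machine `i` are limited to the set `GX i`, and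
the records to the set `Gα`. -/
theorem exists_amplified {n M S B a w : ℕ} [NeZero n] {Ω X α : Type} [Fintype Ω] [Nonempty Ω]
    [Nonempty X] [Nonempty α]
    (P : Ω → ℕ → Step M X α) (init : Fin M → Finset (Sym2 (Fin n)) → X) (out : X → Bool)
    (own : Sym2 (Fin n) → Fin M) (GX : Fin M → Set X) (Gα : Set α)
    (hn : 2 ≤ n) (hGX : ∀ i, (GX i).Finite ∧ (GX i).ncard ≤ n ^ a)
    (hGα : Gα.Finite ∧ Gα.ncard ≤ n ^ w) (hBn : B + 1 ≤ n ^ w) (hM : M ≤ B)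
    (hS : 3 * (a + M) ≤ S) (hB : (w + 3) * (3 * B) ≤ S) (T : ℕ) :
    ∃ A : MPCAlgorithm n M S Bool, ∀ G : SimpleGraph (Fin n),
      (∀ k, 2 * (ownedEdges G own k).card ≤ S) →
      ∀ inp : Fin M → Finset (Sym2 (Fin n)), IsEdgeDistribution G S inp →
      ∀ (ans : Bool) (p : ℝ),
      pr (fun s => ¬ ((∀ t ≤ T, ∀ i,
          Step.run (P s) (fun i => init i (ownedEdges G own i)) t i ∈ GX i)
        ∧ (∀ t < T, (P s t).Bounded B (Step.run (P s) (fun i => init i (ownedEdges G own i)) t))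
        ∧ (∀ t < T, ∀ i j, ∀ a ∈ (P s t).send i
          (Step.run (P s) (fun i => init i (ownedEdges G own i)) t i) j, a ∈ Gα)
        ∧ ∀ i, out (Step.run (P s) (fun i => init i (ownedEdges G own i)) T i) = ans)) ≤ p →
      1 - 3 * p ^ 2 ≤ A.successProb inp (3 * T + 1) (fun o => ∀ i, o i = ans) := by
  classical
  have hn0 : 0 < n := by omega
  have : Nonempty (Fin n) := ⟨⟨0, hn0⟩⟩
  choose enc dec hdec using fun i => exists_code (Y := Fin a → Fin n) (GX i) (hGX i).1
    (by simpa using (hGX i).2)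
  obtain ⟨code, decode, hcode⟩ := exists_code (Y := Fin w → Fin n) Gα hGα.1 (by simpa using hGα.2)
  let Q : (Fin 3 → Ω) → ℕ → Step M (Fin 3 → (Fin a → Fin n) × (Fin M → Bool))
      (Fin 3 × (Fin (B + 1) ⊕ (Fin w → Fin n))) := fun s =>
    Step.triple fun r => Step.guard (P (s r)) B enc dec code decode
  let i0 : Fin M → Finset (Sym2 (Fin n)) → Fin 3 → (Fin a → Fin n) × (Fin M → Bool) :=
    fun i E _ => (enc i (init i E), fun _ => false)
  let o : Fin M → (Fin 3 → (Fin a → Fin n) × (Fin M → Bool)) → Bool := fun i y =>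
    (out (dec i (y 0).1) && out (dec i (y 1).1)) || (out (dec i (y 0).1) && out (dec i (y 2).1)) ||
      (out (dec i (y 1).1) && out (dec i (y 2).1))
  have hcX : Fintype.card (Fin 3 → (Fin a → Fin n) × (Fin M → Bool)) ≤ n ^ S := by
    simp only [Fintype.card_fun, Fintype.card_prod, Fintype.card_fin, Fintype.card_bool]
    calc (n ^ a * 2 ^ M) ^ 3 ≤ (n ^ a * n ^ M) ^ 3 := by gcongr
      _ = n ^ (3 * (a + M)) := by rw [← pow_add, ← pow_mul, mul_comm]
      _ ≤ n ^ S := Nat.pow_le_pow_right hn0 hS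
  have hcα : Fintype.card (Fin 3 × (Fin (B + 1) ⊕ (Fin w → Fin n))) ≤ n ^ (w + 3) := by
    simp only [Fintype.card_prod, Fintype.card_sum, Fintype.card_fun, Fintype.card_fin]
    have h8 : 2 ^ 3 ≤ n ^ 3 := Nat.pow_le_pow_left hn 3
    rw [pow_add]
    nlinarith [Nat.zero_le (n ^ w)]
  have hbd : ∀ s t G, t < 3 * T → (Q s t).Bounded (3 * B)
      (Step.run (Q s) (fun i => i0 i (ownedEdges G own i)) t) := by
    intro s t G _
    exact Step.triple_bounded fun r => Step.guard_bounded hM _ t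
  obtain ⟨A, hA⟩ := exists_compile (n := n) (M := M) (S := S) (B := 3 * B) (w := w + 3)
    Q i0 o own hcX hcα (by omega) hB (3 * T) hbd
  refine ⟨A, fun G hG inp hinp ans p hp => le_trans ?_
    (hA G hG inp hinp (fun o => ∀ i, o i = ans))⟩
  set x0 : Fin M → X := fun i => init i (ownedEdges G own i) with hx0
  set good : Ω → Prop := fun s => (∀ t ≤ T, ∀ i, Step.run (P s) x0 t i ∈ GX i)
      ∧ (∀ t < T, (P s t).Bounded B (Step.run (P s) x0 t))
      ∧ (∀ t < T, ∀ i j, ∀ a ∈ (P s t).send i (Step.run (P s) x0 t i) j, a ∈ Gα)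
      ∧ ∀ i, out (Step.run (P s) x0 T i) = ans with hgood
  have h1 := pr_two_of_three_le (P := fun s => ¬ good s)
  have h2 : pr (fun s => ¬ good s) ^ 2 ≤ p ^ 2 := pow_le_pow_left₀ (pr_nonneg _) hp 2
  have h3 := pr_not (fun ω : Fin 3 → Ω => ∃ i j, i ≠ j ∧ ¬ good (ω i) ∧ ¬ good (ω j))
  refine le_trans (by linarith) (h3.symm.le.trans (pr_mono fun ω hω i => ?_))
  have hrun : ∀ r, good (ω r) →
      out (dec i (Step.run (Q ω) (fun i => i0 i (ownedEdges G own i)) (3 * T) i r).1) = ans := by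
    intro r hr
    rw [Step.run_triple]
    have := Step.run_guard (B := B) (enc := enc) (dec := dec) (code := code) (decode := decode)
      (P := P (ω r)) (x0 := x0) (T := T) hr.2.1
      (fun t ht i j a ha => hcode a (hr.2.2.1 t ht i j a ha))
      (fun t ht i => hdec i _ (hr.1 t ht i)) T le_rfl
    simp only [i0]
    rw [this]
    simp only
    rw [hdec i _ (hr.1 T le_rfl i)]
    exact hr.2.2.2 i
  have two : ∀ r r' : Fin 3, r ≠ r' → good (ω r) ∨ good (ω r') := by
    intro r r' hrr
    by_contra hcon
    rw [not_or] at hcon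
    exact hω ⟨r, r', hrr, hcon⟩
  have t1 := (two 0 1 (by decide)).imp (hrun 0) (hrun 1)
  have t2 := (two 0 2 (by decide)).imp (hrun 0) (hrun 2)
  have t3 := (two 1 2 (by decide)).imp (hrun 1) (hrun 2)
  simp only [o]
  generalize out (dec i
    (Step.run (Q ω) (fun i => i0 i (ownedEdges G own i)) (3 * T) i 0).1) = b0 at *
  generalize out (dec i
    (Step.run (Q ω) (fun i => i0 i (ownedEdges G own i)) (3 * T) i 1).1) = b1 at *
  generalize out (dec i
    (Step.run (Q ω) (fun i => i0 i (ownedEdges G own i)) (3 * T) i 2).1) = b2 at *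
  revert t1 t2 t3
  clear * -
  revert b0 b1 b2 ans
  decide

/-! ### Graphs that are unions of cycles -/

/-- The edges of `G` join every vertex to its successor under the permutation `σ`, whose cycles
have length at least three: `G` is a disjoint union of cycles. -/
structure IsCycleCover {V : Type*} (G : SimpleGraph V) (σ : Equiv.Perm V) : Prop where
  adj : ∀ u v, G.Adj u v ↔ v = σ u ∨ u = σ v
  two : ∀ v, σ (σ v) ≠ v

section

variable {V : Type*} {G : SimpleGraph V} {σ : Equiv.Perm V}

theorem perm_pow_succ_apply (σ : Equiv.Perm V) (i : ℕ) (u : V) :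
    (σ ^ (i + 1)) u = σ ((σ ^ i) u) := by
  rw [pow_succ', Equiv.Perm.mul_apply]

namespace IsCycleCover

theorem ne (h : IsCycleCover G σ) (v : V) : σ v ≠ v := by
  intro hv
  exact h.two v (by rw [hv, hv])

theorem mem_edgeSet (h : IsCycleCover G σ) (v : V) : s(v, σ v) ∈ G.edgeSet :=
  (h.adj _ _).2 (Or.inl rfl)

theorem edge_injective (h : IsCycleCover G σ) : Function.Injective fun v => s(v, σ v) := by
  intro v w hvw
  rcases Sym2.eq_iff.1 hvw with ⟨h1, -⟩ | ⟨h1, h2⟩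
  · exact h1
  · exact absurd (by rw [← h1, h2]) (h.two w)

theorem exists_eq_of_mem_edgeSet (h : IsCycleCover G σ) {e : Sym2 V} (he : e ∈ G.edgeSet) :
    ∃ v, e = s(v, σ v) := by
  induction e using Sym2.ind with
  | _ x y =>
    rcases (h.adj x y).1 he with rfl | rfl
    · exact ⟨x, rfl⟩
    · exact ⟨y, Sym2.eq_swap⟩

end IsCycleCover

/-- The graph on the labels that arises from the edges in `F`. -/
def labelGraph {W : Type*} (L : V → W) (F : Set (Sym2 V)) : SimpleGraph W :=
  SimpleGraph.fromEdgeSet (Sym2.map L '' F)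

/-- If the labels are the components of `G` without `E`, then the components of the graph on the
labels with the edges in `E \ E'` are those of `G` without `E'`. -/
theorem labelGraph_reachable {W : Type*} {L : V → W} {E E' : Set (Sym2 V)} (hE : E ⊆ G.edgeSet)
    (hE' : E' ⊆ E) (hL : ∀ u v, L u = L v ↔ (G.deleteEdges E).Reachable u v) (u v : V) :
    (labelGraph L (E \ E')).Reachable (L u) (L v) ↔ (G.deleteEdges E').Reachable u v := by
  constructor
  · intro hr
    have key : ∀ x y, (labelGraph L (E \ E')).Reachable x y → ∀ u, x = L u →
        ∃ v, y = L v ∧ (G.deleteEdges E').Reachable u v := by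
      rintro x y ⟨p⟩
      induction p with
      | nil => intro u hu; exact ⟨u, hu, SimpleGraph.Reachable.refl _⟩
      | @cons a b c hab p ih =>
        intro u hu
        rw [labelGraph, SimpleGraph.fromEdgeSet_adj] at hab
        obtain ⟨⟨e, he, hab⟩, -⟩ := hab
        have : ∃ s t, e = s(s, t) ∧ L s = a ∧ L t = b := by
          induction e using Sym2.ind with
          | _ s t =>
            rw [Sym2.map_mk, Sym2.eq_iff] at hab
            rcases hab with ⟨h1, h2⟩ | ⟨h1, h2⟩
            · exact ⟨s, t, rfl, h1, h2⟩
            · exact ⟨t, s, Sym2.eq_swap, h2, h1⟩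
        obtain ⟨s, t, rfl, h1, h2⟩ := this
        obtain ⟨v, hv, hr⟩ := ih t h2.symm
        refine ⟨v, hv, ?_⟩
        have h3 : (G.deleteEdges E).Reachable u s := (hL u s).1 (hu.symm.trans h1.symm)
        have h4 : (G.deleteEdges E').Adj s t := by
          rw [SimpleGraph.deleteEdges_adj]; exact ⟨hE he.1, he.2⟩
        exact (h3.mono (SimpleGraph.deleteEdges_anti hE')).trans (h4.reachable.trans hr)
    obtain ⟨v', hv', hr'⟩ := key _ _ hr u rfl
    exact hr'.trans (((hL v' v).1 hv'.symm).mono (SimpleGraph.deleteEdges_anti hE'))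
  · rintro ⟨p⟩
    induction p with
    | nil => exact SimpleGraph.Reachable.refl _
    | @cons a b c hab p ih =>
      refine SimpleGraph.Reachable.trans ?_ ih
      rw [SimpleGraph.deleteEdges_adj] at hab
      by_cases he : s(a, b) ∈ E
      · by_cases hl : L a = L b
        · rw [hl]
        · refine SimpleGraph.Adj.reachable ?_
          rw [labelGraph, SimpleGraph.fromEdgeSet_adj]
          exact ⟨⟨s(a, b), ⟨he, hab.2⟩, Sym2.map_mk _ _ _⟩, hl⟩
      · rw [(hL a b).2 (SimpleGraph.Adj.reachable (by
          rw [SimpleGraph.deleteEdges_adj]; exact ⟨hab.1, he⟩))]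

variable [DecidableEq V]

/-- The edges on the arc of `w` steps that starts at `u`. -/
def arc (σ : Equiv.Perm V) (u : V) (w : ℕ) : Finset (Sym2 V) :=
  (Finset.range w).image fun i => s((σ ^ i) u, (σ ^ (i + 1)) u)

theorem mem_arc {u : V} {w : ℕ} {e : Sym2 V} :
    e ∈ arc σ u w ↔ ∃ i < w, s((σ ^ i) u, (σ ^ (i + 1)) u) = e := by
  simp [arc]

theorem arc_succ (u : V) (w : ℕ) :
    arc σ u (w + 1) = insert s((σ ^ w) u, (σ ^ (w + 1)) u) (arc σ u w) := by
  simp [arc, Finset.range_add_one, Finset.image_insert]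

theorem arc_mono (u : V) {w w' : ℕ} (h : w ≤ w') : arc σ u w ⊆ arc σ u w' :=
  Finset.image_subset_image (Finset.range_subset_range.2 h)

namespace IsCycleCover

/-- A component of the graph without some edges is an arc. -/
theorem arc_of_reachable (h : IsCycleCover G σ) {E : Set (Sym2 V)} {u v : V}
    (huv : (G.deleteEdges E).Reachable u v) :
    (∃ w, v = (σ ^ w) u ∧ ∀ e ∈ arc σ u w, e ∉ E) ∨
      ∃ w, u = (σ ^ w) v ∧ ∀ e ∈ arc σ v w, e ∉ E := by
  obtain ⟨p⟩ := huv
  induction p with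
  | nil => exact Or.inl ⟨0, rfl, by simp [arc]⟩
  | @cons a b c hab p ih =>
    rw [SimpleGraph.deleteEdges_adj] at hab
    rcases (h.adj a b).1 hab.1 with hb | hb
    · rcases ih with ⟨w, hw, hE⟩ | ⟨w, hw, hE⟩
      · refine Or.inl ⟨w + 1, ?_, ?_⟩
        · rw [hw, hb, pow_succ, Equiv.Perm.mul_apply]
        · intro e he
          obtain ⟨i, hi, rfl⟩ := mem_arc.1 he
          cases i with
          | zero => simpa [← hb] using hab.2
          | succ i =>
            refine hE _ (mem_arc.2 ⟨i, by omega, ?_⟩)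
            rw [hb, ← Equiv.Perm.mul_apply, ← Equiv.Perm.mul_apply, ← pow_succ, ← pow_succ]
      · cases w with
        | zero =>
          refine Or.inl ⟨1, ?_, ?_⟩
          · simp at hw; rw [← hw, hb]; simp
          · intro e he
            obtain ⟨i, hi, rfl⟩ := mem_arc.1 he
            obtain rfl : i = 0 := by omega
            simpa [← hb] using hab.2
        | succ w =>
          refine Or.inr ⟨w, ?_, fun e he => hE e (arc_mono _ (Nat.le_succ w) he)⟩
          rw [hb, perm_pow_succ_apply] at hw
          exact σ.injective hw
    · rcases ih with ⟨w, hw, hE⟩ | ⟨w, hw, hE⟩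
      · cases w with
        | zero =>
          refine Or.inr ⟨1, ?_, ?_⟩
          · simp at hw; rw [hw, hb]; simp
          · intro e he
            obtain ⟨i, hi, rfl⟩ := mem_arc.1 he
            obtain rfl : i = 0 := by omega
            simp at hw
            have := hab.2
            rw [Sym2.eq_swap] at this
            simpa [hw, ← hb] using this
        | succ w =>
          refine Or.inl ⟨w, ?_, fun e he => ?_⟩
          · rw [hw, hb, pow_succ, Equiv.Perm.mul_apply]
          · obtain ⟨i, hi, rfl⟩ := mem_arc.1 he
            refine hE _ (mem_arc.2 ⟨i + 1, by omega, ?_⟩)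
            rw [hb, ← Equiv.Perm.mul_apply, ← Equiv.Perm.mul_apply, ← pow_succ, ← pow_succ]
      · refine Or.inr ⟨w + 1, ?_, ?_⟩
        · rw [hb, hw, perm_pow_succ_apply]
        · intro e he
          rw [arc_succ, Finset.mem_insert] at he
          rcases he with rfl | he
          · have := hab.2
            rw [Sym2.eq_swap] at this
            rw [perm_pow_succ_apply, ← hw, ← hb]
            exact this
          · exact hE e he

/-- A component of the graph without the edges in `E` has at most one outgoing edge in `E` ... -/
theorem eq_of_reachable_of_mem (h : IsCycleCover G σ) {E : Set (Sym2 V)} {u v : V}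
    (huv : (G.deleteEdges E).Reachable u v) (hu : s(u, σ u) ∈ E) (hv : s(v, σ v) ∈ E) : u = v := by
  have aux : ∀ u v : V, s(u, σ u) ∈ E → (∃ w, v = (σ ^ w) u ∧ ∀ e ∈ arc σ u w, e ∉ E) → u = v := by
    rintro u v hu ⟨w, hw, hE⟩
    cases w with
    | zero => simpa using hw.symm
    | succ w => exact absurd hu (hE _ (mem_arc.2 ⟨0, by omega, by simp⟩))
  rcases h.arc_of_reachable huv with hw | hw
  · exact aux u v hu hw
  · exact (aux v u hv hw).symm

/-- ... and at most one incoming edge in `E`. -/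
theorem eq_of_reachable_succ_of_mem (h : IsCycleCover G σ) {E : Set (Sym2 V)} {u v : V}
    (huv : (G.deleteEdges E).Reachable (σ u) (σ v)) (hu : s(u, σ u) ∈ E) (hv : s(v, σ v) ∈ E) :
    u = v := by
  have aux : ∀ u v : V, s(v, σ v) ∈ E →
      (∃ w, σ v = (σ ^ w) (σ u) ∧ ∀ e ∈ arc σ (σ u) w, e ∉ E) → u = v := by
    rintro u v hv ⟨w, hw, hE⟩
    cases w with
    | zero => exact (σ.injective (by simpa using hw)).symm
    | succ w =>
      refine absurd hv (hE _ (mem_arc.2 ⟨w, by omega, ?_⟩))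
      rw [perm_pow_succ_apply] at hw ⊢
      rw [← σ.injective hw]
  rcases h.arc_of_reachable huv with hw | hw
  · exact aux u v hv hw
  · exact (aux v u hu hw).symm

/-- If `E` meets every cycle, then the graph without the edges in `E` is acyclic. -/
theorem not_reachable (h : IsCycleCover G σ) {E : Set (Sym2 V)}
    (hE : ∀ v, ∃ w : ℕ, s((σ ^ w) v, (σ ^ (w + 1)) v) ∈ E) {x y : V} (hxy : G.Adj x y)
    (hxE : s(x, y) ∉ E) : ¬ (G.deleteEdges (insert s(x, y) E)).Reachable x y := by
  have aux : ∀ v, s(v, σ v) ∉ E → ¬ (G.deleteEdges (insert s(v, σ v) E)).Reachable v (σ v) := by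
    intro v hv hr
    rcases h.arc_of_reachable hr with ⟨w, hw, ha⟩ | ⟨w, hw, ha⟩
    · cases w with
      | zero => exact h.ne v (by simpa using hw)
      | succ w => exact ha s(v, σ v) (mem_arc.2 ⟨0, by omega, by simp⟩) (Set.mem_insert _ _)
    · have hper : (σ ^ (w + 1)) v = v := by
        rw [pow_succ, Equiv.Perm.mul_apply, ← hw]
      obtain ⟨k, hk⟩ := hE v
      have hall : ∀ i < w + 1, s((σ ^ i) v, (σ ^ (i + 1)) v) ∉ E := by
        intro i hi hi'
        cases i with
        | zero => exact hv (by simpa using hi')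
        | succ i =>
          refine ha _ (mem_arc.2 ⟨i, by omega, rfl⟩) (Set.mem_insert_of_mem _ ?_)
          rwa [← Equiv.Perm.mul_apply, ← Equiv.Perm.mul_apply, ← pow_succ, ← pow_succ]
      have hmod : (σ ^ k) v = (σ ^ (k % (w + 1))) v := by
        conv_lhs => rw [← Nat.mod_add_div k (w + 1), pow_add, Equiv.Perm.mul_apply, pow_mul]
        congr 1
        exact Function.IsFixedPt.perm_pow hper _
      refine hall (k % (w + 1)) (Nat.mod_lt _ (by omega)) ?_
      rw [perm_pow_succ_apply] at hk ⊢
      rwa [← hmod]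
  rcases (h.adj x y).1 hxy with rfl | rfl
  · exact aux x hxE
  · rw [Sym2.eq_swap] at hxE ⊢
    exact fun hr => aux y hxE hr.symm

end IsCycleCover

namespace IsCycleCover

variable {W : Type*} {L : V → W} {E E' : Set (Sym2 V)}

/-- If `E'` meets every cycle, then no edge in `E \ E'` becomes a loop. -/
theorem not_isDiag_map (h : IsCycleCover G σ) (hE : E ⊆ G.edgeSet) (hE' : E' ⊆ E)
    (hL : ∀ u v, L u = L v ↔ (G.deleteEdges E).Reachable u v)
    (horb : ∀ v, ∃ w : ℕ, s((σ ^ w) v, (σ ^ (w + 1)) v) ∈ E') {e : Sym2 V} (he : e ∈ E \ E') :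
    ¬ (e.map L).IsDiag := by
  induction e using Sym2.ind with
  | _ x y =>
    rw [Sym2.map_mk, Sym2.mk_isDiag_iff, hL]
    intro hr
    refine h.not_reachable horb (hE he.1) he.2 (hr.mono (SimpleGraph.deleteEdges_anti ?_))
    exact Set.insert_subset he.1 hE'

/-- If `E'` meets every cycle, then no two edges in `E \ E'` become parallel. -/
theorem injOn_map (h : IsCycleCover G σ) (hE : E ⊆ G.edgeSet) (hE' : E' ⊆ E)
    (hL : ∀ u v, L u = L v ↔ (G.deleteEdges E).Reachable u v)
    (horb : ∀ v, ∃ w : ℕ, s((σ ^ w) v, (σ ^ (w + 1)) v) ∈ E') :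
    Set.InjOn (Sym2.map L) (E \ E') := by
  have aux : ∀ x y x' y', s(x, y) ∈ E \ E' → s(x', y') ∈ E \ E' → L x = L x' → L y = L y' →
      s(x, y) = s(x', y') := by
    intro x y x' y' he he' hx hy
    by_contra hne
    rw [hL] at hx hy
    have hsub : insert s(x, y) E' ⊆ E := Set.insert_subset he.1 hE'
    have hadj : (G.deleteEdges (insert s(x, y) E')).Adj x' y' := by
      rw [SimpleGraph.deleteEdges_adj]
      refine ⟨hE he'.1, ?_⟩
      rintro (h1 | h1)
      · exact hne h1.symm
      · exact he'.2 h1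
    exact h.not_reachable horb (hE he.1) he.2
      ((hx.mono (SimpleGraph.deleteEdges_anti hsub)).trans
        (hadj.reachable.trans (hy.symm.mono (SimpleGraph.deleteEdges_anti hsub))))
  intro e he e' he' hee
  induction e using Sym2.ind with
  | _ x y =>
    induction e' using Sym2.ind with
    | _ x' y' =>
      rw [Sym2.map_mk, Sym2.map_mk, Sym2.eq_iff] at hee
      rcases hee with ⟨h1, h2⟩ | ⟨h1, h2⟩
      · exact aux _ _ _ _ he he' h1 h2
      · rw [Sym2.eq_swap (a := x')] at he' ⊢
        exact aux _ _ _ _ he he' h1 h2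

/-- At most two edges in `E` have an endpoint in a given component of `G` without `E`. -/
theorem card_incident_le [Fintype V] [DecidableEq W] (h : IsCycleCover G σ)
    {E : Finset (Sym2 V)} (hE : (E : Set (Sym2 V)) ⊆ G.edgeSet)
    (hL : ∀ u v, L u = L v ↔ (G.deleteEdges (E : Set (Sym2 V))).Reachable u v) (x : W) :
    (E.filter fun e => x ∈ e.map L).card ≤ 2 := by
  classical
  have hsub : (E.filter fun e => x ∈ e.map L) ⊆
      ((Finset.univ.filter fun v => s(v, σ v) ∈ E ∧ L v = x).image fun v => s(v, σ v)) ∪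
      ((Finset.univ.filter fun v => s(v, σ v) ∈ E ∧ L (σ v) = x).image fun v => s(v, σ v)) := by
    intro e he
    rw [Finset.mem_filter] at he
    obtain ⟨v, rfl⟩ := h.exists_eq_of_mem_edgeSet (hE he.1)
    rw [Sym2.map_mk, Sym2.mem_iff] at he
    rcases he.2 with h1 | h1
    · exact Finset.mem_union_left _ (Finset.mem_image.2 ⟨v, by simp [he.1, h1], rfl⟩)
    · exact Finset.mem_union_right _ (Finset.mem_image.2 ⟨v, by simp [he.1, h1], rfl⟩)
  refine (Finset.card_le_card hsub).trans ((Finset.card_union_le _ _).trans ?_)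
  have h1 : (Finset.univ.filter fun v => s(v, σ v) ∈ E ∧ L v = x).card ≤ 1 := by
    refine Finset.card_le_one.2 fun u hu v hv => ?_
    simp only [Finset.mem_filter, Finset.mem_univ, true_and] at hu hv
    exact h.eq_of_reachable_of_mem ((hL u v).1 (hu.2.trans hv.2.symm)) hu.1 hv.1
  have h2 : (Finset.univ.filter fun v => s(v, σ v) ∈ E ∧ L (σ v) = x).card ≤ 1 := by
    refine Finset.card_le_one.2 fun u hu v hv => ?_
    simp only [Finset.mem_filter, Finset.mem_univ, true_and] at hu hv
    exact h.eq_of_reachable_succ_of_mem ((hL _ _).1 (hu.2.trans hv.2.symm)) hu.1 hv.1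
  have := Finset.card_image_le (f := fun v => s(v, σ v))
    (s := Finset.univ.filter fun v => s(v, σ v) ∈ E ∧ L v = x)
  have := Finset.card_image_le (f := fun v => s(v, σ v))
    (s := Finset.univ.filter fun v => s(v, σ v) ∈ E ∧ L (σ v) = x)
  omega

/-- Along an arc without edges in `E'`, the distance in the graph on the labels is at most the
number of edges in `E`. -/
theorem exists_walk_of_arc (h : IsCycleCover G σ) {E E' : Finset (Sym2 V)}
    (hL : ∀ u v, L u = L v ↔ (G.deleteEdges (E : Set (Sym2 V))).Reachable u v) (u : V) (w : ℕ)
    (hw : ∀ e ∈ arc σ u w, e ∉ E') :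
    ∃ p : (labelGraph L ((E : Set (Sym2 V)) \ E')).Walk (L u) (L ((σ ^ w) u)),
      p.length ≤ (E ∩ arc σ u w).card := by
  induction w using Nat.strong_induction_on with
  | _ w ih =>
    cases w with
    | zero => exact ⟨(SimpleGraph.Walk.nil : (labelGraph L _).Walk (L u) (L u)), Nat.zero_le _⟩
    | succ w =>
      by_cases hrep : s((σ ^ w) u, (σ ^ (w + 1)) u) ∈ arc σ u w
      · obtain ⟨i, hi, hi'⟩ := mem_arc.1 hrep
        have : (σ ^ i) u = (σ ^ w) u := by
          rw [perm_pow_succ_apply, perm_pow_succ_apply] at hi'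
          exact h.edge_injective hi'
        have h2 : (σ ^ (w + 1)) u = (σ ^ (i + 1)) u := by
          rw [perm_pow_succ_apply, perm_pow_succ_apply, this]
        rw [h2]
        obtain ⟨p, hp⟩ := ih (i + 1) (by omega) fun e he => hw e (arc_mono _ (by omega) he)
        exact ⟨p, hp.trans (Finset.card_le_card
          (Finset.inter_subset_inter_left (arc_mono _ (by omega))))⟩
      · obtain ⟨p, hp⟩ := ih w (by omega) fun e he => hw e (arc_mono _ (by omega) he)
        have hadj : G.Adj ((σ ^ w) u) ((σ ^ (w + 1)) u) := by
          rw [perm_pow_succ_apply]; exact h.mem_edgeSet _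
        have hE' : s((σ ^ w) u, (σ ^ (w + 1)) u) ∉ E' :=
          hw _ (mem_arc.2 ⟨w, by omega, rfl⟩)
        rw [arc_succ]
        by_cases he : s((σ ^ w) u, (σ ^ (w + 1)) u) ∈ E
        · rw [Finset.inter_insert_of_mem he, Finset.card_insert_of_notMem
            (fun hh => hrep (Finset.mem_inter.1 hh).2)]
          by_cases hl : L ((σ ^ w) u) = L ((σ ^ (w + 1)) u)
          · rw [← hl]; exact ⟨p, by omega⟩
          · refine ⟨p.concat ?_, by rw [SimpleGraph.Walk.length_concat]; omega⟩
            rw [labelGraph, SimpleGraph.fromEdgeSet_adj]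
            exact ⟨⟨_, ⟨he, hE'⟩, Sym2.map_mk _ _ _⟩, hl⟩
        · rw [Finset.inter_insert_of_notMem he]
          have : L ((σ ^ w) u) = L ((σ ^ (w + 1)) u) := by
            rw [hL]
            refine SimpleGraph.Adj.reachable ?_
            rw [SimpleGraph.deleteEdges_adj]
            exact ⟨hadj, he⟩
          rw [← this]
          exact ⟨p, hp⟩

/-- If every arc with `D` edges in `E` has an edge in `E'`, then the graph on the labels with the
edges in `E \ E'` has diameter at most `D`. -/
theorem dist_labelGraph_le (h : IsCycleCover G σ) {E E' : Finset (Sym2 V)} {D : ℕ}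
    (hE : (E : Set (Sym2 V)) ⊆ G.edgeSet) (hE' : E' ⊆ E)
    (hL : ∀ u v, L u = L v ↔ (G.deleteEdges (E : Set (Sym2 V))).Reachable u v)
    (hwin : ∀ u w, D ≤ (E ∩ arc σ u w).card → ∃ e ∈ arc σ u w, e ∈ E') (x y : W)
    (hxy : (labelGraph L ((E : Set (Sym2 V)) \ E')).Reachable x y) :
    (labelGraph L ((E : Set (Sym2 V)) \ E')).dist x y ≤ D := by
  have isLabel : ∀ {a b}, (labelGraph L ((E : Set (Sym2 V)) \ E')).Adj a b → ∃ u, a = L u := by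
    intro a b hab
    rw [labelGraph, SimpleGraph.fromEdgeSet_adj] at hab
    obtain ⟨⟨e, -, he⟩, -⟩ := hab
    have : a ∈ Sym2.map L e := by rw [he]; simp
    obtain ⟨u, -, hu⟩ := Sym2.mem_map.1 this
    exact ⟨u, hu.symm⟩
  by_cases hne : x = y
  · subst hne; simp
  obtain ⟨u, rfl⟩ : ∃ u, x = L u := by
    obtain ⟨p⟩ := hxy
    cases p with
    | nil => exact absurd rfl hne
    | cons hab p => exact isLabel hab
  obtain ⟨v, rfl⟩ : ∃ v, y = L v := by
    obtain ⟨p⟩ := hxy.symm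
    cases p with
    | nil => exact absurd rfl hne
    | cons hab p => exact isLabel hab
  have aux : ∀ u v, (∃ w, v = (σ ^ w) u ∧ ∀ e ∈ arc σ u w, e ∉ (E' : Set (Sym2 V))) →
      (labelGraph L ((E : Set (Sym2 V)) \ E')).dist (L u) (L v) ≤ D := by
    rintro u _ ⟨w, rfl, hw⟩
    obtain ⟨p, hp⟩ := h.exists_walk_of_arc hL u w hw
    refine (SimpleGraph.dist_le p).trans (hp.trans ?_)
    by_contra hlt
    obtain ⟨e, he, he'⟩ := hwin u w (by omega)
    exact hw e he he'
  have hr := (labelGraph_reachable (G := G) hE (Finset.coe_subset.2 hE') hL u v).1 hxy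
  rcases h.arc_of_reachable hr with hw | hw
  · exact aux u v hw
  · rw [SimpleGraph.dist_comm]; exact aux v u hw

end IsCycleCover

end

/-! ### One cycle and two cycles -/

/-- Every cycle of `σ` has at least `k` elements. -/
def HasLargeCycles {V : Type*} (σ : Equiv.Perm V) (k : ℕ) : Prop :=
  ∀ v, ∃ s : Finset V, k ≤ s.card ∧ ∀ x ∈ s, ∃ w : ℕ, x = (σ ^ w) v

theorem cycleGraph_isCycleCover (m : ℕ) :
    ∃ σ : Equiv.Perm (Fin (m + 3)), IsCycleCover (SimpleGraph.cycleGraph (m + 3)) σ ∧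
      HasLargeCycles σ (m + 3) := by
  refine ⟨Equiv.addRight 1, ⟨fun u v => ?_, fun v => ?_⟩, fun v =>
    ⟨Finset.univ, by simp, fun x _ => ⟨(x - v : Fin (m + 3)), ?_⟩⟩⟩
  · rw [SimpleGraph.cycleGraph_adj]
    change _ ↔ v = u + 1 ∨ u = v + 1
    rw [or_comm, sub_eq_iff_eq_add', sub_eq_iff_eq_add', add_comm u, add_comm v, add_comm 1 u,
      add_comm 1 v]
  · change v + 1 + 1 ≠ v
    rw [add_assoc, Ne, add_eq_left]
    simp [Fin.ext_iff, Fin.val_add, Nat.mod_eq_of_lt]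
  · have : ∀ w : ℕ, ((Equiv.addRight (1 : Fin (m + 3))) ^ w) v = v + Fin.ofNat (m + 3) w := by
      intro w
      induction w with
      | zero => simp
      | succ w ih =>
        rw [perm_pow_succ_apply, ih]
        change v + Fin.ofNat (m + 3) w + 1 = v + Fin.ofNat (m + 3) (w + 1)
        rw [add_assoc]
        congr 1
        ext
        simp [Fin.val_add]
    rw [this, Fin.ofNat_val_eq_self]
    abel

theorem IsCycleCover.of_iso {V W : Type*} {G : SimpleGraph V} {H : SimpleGraph W} (φ : G ≃g H)
    {σ : Equiv.Perm W} (h : IsCycleCover H σ) {k : ℕ} (hk : HasLargeCycles σ k) :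
    ∃ τ : Equiv.Perm V, IsCycleCover G τ ∧ HasLargeCycles τ k := by
  classical
  let τ : Equiv.Perm V := (φ.toEquiv.trans σ).trans φ.toEquiv.symm
  have hτ : ∀ v, τ v = φ.symm (σ (φ v)) := fun v => rfl
  have hpow : ∀ (w : ℕ) v, (τ ^ w) v = φ.symm ((σ ^ w) (φ v)) := by
    intro w v
    induction w with
    | zero => simp
    | succ w ih => rw [perm_pow_succ_apply, perm_pow_succ_apply, ih, hτ, RelIso.apply_symm_apply]
  refine ⟨τ, ⟨fun u v => ?_, fun v => ?_⟩, fun v => ?_⟩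
  · rw [← φ.map_adj_iff, h.adj, hτ, hτ]
    constructor
    · rintro (h1 | h1)
      · exact Or.inl (by rw [← h1]; simp)
      · exact Or.inr (by rw [← h1]; simp)
    · rintro (h1 | h1)
      · exact Or.inl (by rw [h1]; simp)
      · exact Or.inr (by rw [h1]; simp)
  · rw [hτ, hτ, RelIso.apply_symm_apply]
    intro h1
    exact h.two (φ v) (by conv_rhs => rw [← h1, RelIso.apply_symm_apply])
  · obtain ⟨s, hs, hs'⟩ := hk (φ v)
    refine ⟨s.map φ.symm.toEquiv.toEmbedding, by simpa using hs, fun x hx => ?_⟩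
    obtain ⟨y, hy, rfl⟩ := Finset.mem_map.1 hx
    obtain ⟨w, rfl⟩ := hs' y hy
    exact ⟨w, (hpow w v).symm⟩

theorem IsCycleCover.sum {V W : Type*} {G : SimpleGraph V} {H : SimpleGraph W}
    {σ : Equiv.Perm V} {τ : Equiv.Perm W} (hσ : IsCycleCover G σ) (hτ : IsCycleCover H τ) {k : ℕ}
    (hσk : HasLargeCycles σ k) (hτk : HasLargeCycles τ k) :
    IsCycleCover (G ⊕g H) (Equiv.sumCongr σ τ) ∧ HasLargeCycles (Equiv.sumCongr σ τ) k := by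
  classical
  have hl : ∀ (w : ℕ) v, ((Equiv.sumCongr σ τ : Equiv.Perm (V ⊕ W)) ^ w) (Sum.inl v) =
      Sum.inl ((σ ^ w) v) := by
    intro w v
    induction w with
    | zero => simp
    | succ w ih => rw [perm_pow_succ_apply, perm_pow_succ_apply, ih]; rfl
  have hr : ∀ (w : ℕ) v, ((Equiv.sumCongr σ τ : Equiv.Perm (V ⊕ W)) ^ w) (Sum.inr v) =
      Sum.inr ((τ ^ w) v) := by
    intro w v
    induction w with
    | zero => simp
    | succ w ih => rw [perm_pow_succ_apply, perm_pow_succ_apply, ih]; rfl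
  refine ⟨⟨?_, ?_⟩, ?_⟩
  · rintro (u | u) (v | v)
    · simpa using hσ.adj u v
    · simp
    · simp
    · simpa using hτ.adj u v
  · rintro (v | v)
    · simpa using hσ.two v
    · simpa using hτ.two v
  · rintro (v | v)
    · obtain ⟨s, hs, hs'⟩ := hσk v
      refine ⟨s.map Function.Embedding.inl, by simpa using hs, fun x hx => ?_⟩
      obtain ⟨y, hy, rfl⟩ := Finset.mem_map.1 hx
      obtain ⟨w, rfl⟩ := hs' y hy
      exact ⟨w, (hl w v).symm⟩
    · obtain ⟨s, hs, hs'⟩ := hτk v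
      refine ⟨s.map Function.Embedding.inr, by simpa using hs, fun x hx => ?_⟩
      obtain ⟨y, hy, rfl⟩ := Finset.mem_map.1 hx
      obtain ⟨w, rfl⟩ := hs' y hy
      exact ⟨w, (hr w v).symm⟩

theorem exists_isCycleCover {n : ℕ} (hn : 6 ≤ n) {G : SimpleGraph (Fin n)}
    (hG : IsOneCycle G ∨ IsTwoCycles G) :
    ∃ σ : Equiv.Perm (Fin n), IsCycleCover G σ ∧ HasLargeCycles σ (n / 2) := by
  rcases hG with ⟨⟨φ⟩⟩ | ⟨⟨φ⟩⟩
  · obtain ⟨m, rfl⟩ : ∃ m, n = m + 3 := ⟨n - 3, by omega⟩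
    obtain ⟨σ, h1, h2⟩ := cycleGraph_isCycleCover m
    obtain ⟨τ, h3, h4⟩ := h1.of_iso φ h2
    refine ⟨τ, h3, fun v => ?_⟩
    obtain ⟨s, hs, hs'⟩ := h4 v
    exact ⟨s, by omega, hs'⟩
  · obtain ⟨m, hm⟩ : ∃ m, n / 2 = m + 3 := ⟨n / 2 - 3, by omega⟩
    rw [hm] at φ ⊢
    obtain ⟨σ, h1, h2⟩ := cycleGraph_isCycleCover m
    obtain ⟨h3, h4⟩ := h1.sum h1 h2 h2
    exact h3.of_iso φ h4

theorem IsOneCycle.preconnected {n : ℕ} {G : SimpleGraph (Fin n)} (h : IsOneCycle G) :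
    G.Preconnected := by
  obtain ⟨φ⟩ := h
  intro u v
  rw [← φ.reachable_iff]
  exact SimpleGraph.cycleGraph_preconnected _ _

theorem IsTwoCycles.not_preconnected {n : ℕ} (hn : 2 ≤ n) {G : SimpleGraph (Fin n)}
    (h : IsTwoCycles G) : ¬ G.Preconnected := by
  obtain ⟨φ⟩ := h
  intro hp
  have : NeZero (n / 2) := ⟨by omega⟩
  refine SimpleGraph.not_reachable_sum_inl_inr (G := SimpleGraph.cycleGraph (n / 2))
    (H := SimpleGraph.cycleGraph (n / 2)) 0 0 ?_
  rw [← φ.symm.reachable_iff]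
  exact hp _ _

/-! ### The rounds of the contraction algorithm -/

theorem Sym2.mk_inf_sup_eq {n : ℕ} (e : Sym2 (Fin n)) : s(e.inf, e.sup) = e := by
  induction e using Sym2.ind with
  | _ x y =>
    rcases le_total x y with h | h
    · simp [h]
    · simp [h, Sym2.eq_swap]

/-- The data of the contraction algorithm on `M` machines: an algorithm for graphs with vertex set
`Fin N` for every number `m` of edges, and the placement of its parts on the machines. -/
structure Setup (n N M : ℕ) where
  /-- the numbers of machines of the simulated algorithms -/
  MA : ℕ → ℕ
  /-- the numbers of words of the simulated algorithms -/
  SA : ℕ → ℕ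
  /-- the simulated algorithms -/
  A : ∀ m, MPCAlgorithm N (MA m) (SA m) (Fin N → Option (Fin N))
  /-- the number of rounds of the simulated algorithms -/
  T : ℕ
  /-- the machine that simulates a given machine of the `m`-th algorithm -/
  blk : ∀ m, Fin (MA m) → Fin M
  /-- the machine of the `m`-th algorithm that receives the edge with a given rank -/
  slot : ∀ m, Fin m → Fin (MA m)
  /-- the machine that looks up the new label of an old label -/
  own : Fin N → Fin M
  /-- the machine that stores an edge -/
  ownE : Sym2 (Fin n) → Fin M
  /-- the machine that computes the answer -/
  root : Fin M

/-- An edge together with the labels of its endpoints. -/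
abbrev EdgeRec (n N : ℕ) : Type := Sym2 (Fin n) × Fin N × Fin N

/-- A record in a message. Depending on the round, the numbers are a count, the names of simulated
machines, or tell questions from answers, and the last two components are labels or words. -/
abbrev Msg (N : ℕ) : Type := ℕ × ℕ × Fin N × Fin N

/-- The state of a machine. -/
@[ext] structure St {n N M : ℕ} (P : Setup n N M) where
  /-- the remaining edges on this machine -/
  recs : Finset (EdgeRec n N)
  /-- the number of edges to be contracted on the machines before this one -/
  off : ℕ
  /-- the number of edges to be contracted, and the memories of the simulated machines (zero for
  machines that are simulated elsewhere) -/
  mem : Σ m : Fin (n + 1), Fin (P.MA m) → MPCMemory N (P.SA m)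
  /-- the answers `(k, v, a)` to be sent: machine `k` is told that the new label of `v` is `a` -/
  ans : Finset (Fin M × Fin N × Fin N)
  /-- the final answer -/
  fin : Bool

namespace Setup

open Classical in
/-- Every machine tells all others how many of its edges are to be contracted. -/
noncomputable def cntStep {n N M : ℕ} [NeZero N] (P : Setup n N M) (keep : Sym2 (Fin n) → Bool) :
    Step M (St P) (Msg N) where
  send _ x _ := [((x.recs.filter fun r => ¬ keep r.1).card, 0, 0, 0)]
  update I x ms := { x with
    off := ∑ k ∈ Finset.univ.filter (· < I), ((ms k).map (·.1)).sum
    mem := ⟨Fin.ofNat (n + 1) (∑ k, ((ms k).map (·.1)).sum), fun _ _ => 0⟩ }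

/-- The simulated machine that receives the edge `r`, which is determined by the rank of the edge
among all edges to be contracted: `F` are those on the same machine, and `off` is the number of
those on the machines before it. -/
noncomputable def place {n N M : ℕ} (P : Setup n N M) (off : ℕ) (m : Fin (n + 1))
    (F : Finset (EdgeRec n N)) (r : EdgeRec n N) : Option (Fin (P.MA m)) :=
  if h : off + F.toList.idxOf r < m then some (P.slot m ⟨_, h⟩) else none

open Classical in
/-- The edges to be contracted are sent to the simulated machines, which load them. -/
noncomputable def loadStep {n N M : ℕ} [NeZero N] (P : Setup n N M) (keep : Sym2 (Fin n) → Bool)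
    (sd : ∀ m : Fin (n + 1), (P.A m).Seed) : Step M (St P) (Msg N) where
  send _ x J := (x.recs.filter fun r => ¬ keep r.1).toList.filterMap fun r =>
    (P.place x.off x.mem.1 (x.recs.filter fun r => ¬ keep r.1) r).bind fun i =>
      if P.blk x.mem.1 i = J then some ((i : ℕ), 0, r.2.1, r.2.2) else none
  update I x ms := { x with
    mem := ⟨x.mem.1, fun i => if P.blk x.mem.1 i = I then
      (P.A x.mem.1).load (sd x.mem.1) i (Finset.univ.filter fun e =>
        ∃ k, ∃ r ∈ ms k, r.1 = i ∧ e = s(r.2.2.1, r.2.2.2)) else fun _ => 0⟩ }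

/-- A round of the simulated algorithm. -/
noncomputable def simStep {n N M : ℕ} [NeZero N] (P : Setup n N M)
    (sd : ∀ m : Fin (n + 1), (P.A m).Seed) (t : ℕ) : Step M (St P) (Msg N) where
  send I x J := (List.finRange (P.MA x.mem.1)).flatMap fun i => if P.blk x.mem.1 i = I then
    (List.finRange (P.MA x.mem.1)).flatMap fun j => if P.blk x.mem.1 j = J then
      ((P.A x.mem.1).send (sd x.mem.1) t i (x.mem.2 i) j).map fun w => ((i : ℕ), (j : ℕ), w, 0)
      else [] else []
  update I x ms := { x with
    mem := ⟨x.mem.1, fun j => if P.blk x.mem.1 j = I then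
      (P.A x.mem.1).update (sd x.mem.1) t j (x.mem.2 j) (fun i =>
        (ms (P.blk x.mem.1 i)).filterMap fun r =>
          if r.1 = (i : ℕ) ∧ r.2.1 = (j : ℕ) then some r.2.2.1 else none) else fun _ => 0⟩ }

open Classical in
/-- The outputs of the simulated algorithm are sent to the machines that look them up, and every
machine asks for the new labels of the endpoints of its edges. -/
noncomputable def outStep {n N M : ℕ} [NeZero N] (P : Setup n N M)
    (sd : ∀ m : Fin (n + 1), (P.A m).Seed) : Step M (St P) (Msg N) where
  send I x J :=
    (Finset.univ.filter fun p : Fin N × Fin N => P.own p.1 = J ∧ ∃ i, P.blk x.mem.1 i = I ∧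
      (P.A x.mem.1).output (sd x.mem.1) i (x.mem.2 i) p.1 = some p.2).toList.map
        (fun p => (0, 0, p.1, p.2)) ++
    ((x.recs.image (·.2.1) ∪ x.recs.image (·.2.2)).filter fun v => P.own v = J).toList.map
        (fun v => (1, 0, v, 0))
  update _ x ms := { x with
    ans := Finset.univ.filter fun p => (1, 0, p.2.1, 0) ∈ ms p.1 ∧
      ∃ k, (0, 0, p.2.1, p.2.2) ∈ ms k }

open Classical in
/-- The new label of `v` according to the messages of the other machines. -/
noncomputable def lookup {N M : ℕ} (ms : Fin M → List (Msg N)) (v : Fin N) : Fin N :=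
  if h : ∃ a k, (0, 0, v, a) ∈ ms k then h.choose else v

open Classical in
/-- The answers are sent, contracted edges are dropped and the labels of the others are updated. -/
noncomputable def replyStep {n N M : ℕ} (P : Setup n N M) (keep : Sym2 (Fin n) → Bool) :
    Step M (St P) (Msg N) where
  send _ x J := ((x.ans.filter fun p => p.1 = J).image (·.2)).toList.map fun p => (0, 0, p.1, p.2)
  update _ x ms := { x with
    recs := (x.recs.filter fun r => keep r.1).image fun r =>
      (r.1, lookup ms r.2.1, lookup ms r.2.2) }

open Classical in
/-- The remaining edges are sent to one machine, which decides whether they are connected. -/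
noncomputable def gatherStep {n N M : ℕ} (P : Setup n N M) : Step M (St P) (Msg N) where
  send _ x J := if J = P.root then x.recs.toList.map fun r => (0, 0, r.2.1, r.2.2) else []
  update _ x ms := { x with
    fin := decide (∀ k k', ∀ r ∈ ms k, ∀ r' ∈ ms k',
      (SimpleGraph.fromEdgeSet {e | ∃ k, ∃ r ∈ ms k, e = s(r.2.2.1, r.2.2.2)}).Reachable
        r.2.2.1 r'.2.2.1) }

open Classical in
/-- The answer is sent to all machines. -/
noncomputable def castStep {n N M : ℕ} [NeZero N] (P : Setup n N M) : Step M (St P) (Msg N) where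
  send I x _ := if I = P.root then [(if x.fin then 1 else 0, 0, 0, 0)] else []
  update _ x ms := { x with fin := decide ((1, 0, 0, 0) ∈ ms P.root) }

/-- A phase of `T + 4` rounds: the edges that are not kept are contracted. -/
noncomputable def phaseStep {n N M : ℕ} [NeZero N] (P : Setup n N M) (keep : Sym2 (Fin n) → Bool)
    (sd : ∀ m : Fin (n + 1), (P.A m).Seed) (t : ℕ) : Step M (St P) (Msg N) :=
  if t = 0 then P.cntStep keep
  else if t = 1 then P.loadStep keep sd
  else if t < P.T + 2 then P.simStep sd (t - 2)
  else if t = P.T + 2 then P.outStep sd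
  else P.replyStep keep

/-! ### Invariants -/

/-- The limits on the state of machine `I`. -/
def okState {n N M : ℕ} [NeZero N] (P : Setup n N M) (s : ℕ) (I : Fin M) : Set (St P) :=
  {x | x.recs.card ≤ s ∧ x.off ≤ n ∧ (∀ i, P.blk x.mem.1 i ≠ I → x.mem.2 i = fun _ => 0) ∧
    x.ans.card ≤ 2 * s}

/-- The limits on records, such that few of them exist and `O(1)` words suffice for each. -/
def okMsg (N R : ℕ) : Set (Msg N) := {r | r.1 ≤ R ∧ r.2.1 ≤ R}

/-- The number of machines is small, and every machine has a small part of the objects that are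
placed on the machines. -/
structure Fits {n N M : ℕ} (P : Setup n N M) (s : ℕ) : Prop where
  machines : M ≤ s
  blk : ∀ m ≤ n, ∀ I, (Finset.univ.filter fun i => P.blk m i = I).card * P.SA m ≤ s
  slot : ∀ m ≤ n, ∀ i, 2 * (Finset.univ.filter fun r => P.slot m r = i).card ≤ P.SA m
  own : ∀ I, (Finset.univ.filter fun v => P.own v = I).card ≤ s

/-- The records of machine `k` if `E` is the set of remaining edges and `L` are the labels. -/
noncomputable def idealRecs {n N M : ℕ} (P : Setup n N M) (E : Finset (Sym2 (Fin n)))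
    (L : Fin n → Fin N) (k : Fin M) : Finset (EdgeRec n N) :=
  (E.filter fun e => P.ownE e = k).image fun e => (e, L e.inf, L e.sup)

/-- The remaining edges and the labels are such that the messages are not too long. -/
structure Balanced {n N M : ℕ} (P : Setup n N M) (s : ℕ) (E : Finset (Sym2 (Fin n)))
    (L : Fin n → Fin N) : Prop where
  card : E.card ≤ n
  own : ∀ k, (E.filter fun e => P.ownE e = k).card ≤ s
  label : ∀ v, (E.filter fun e => v ∈ e.map L).card ≤ 2

/-- The states respect the limits, `E` is the set of remaining edges and `L` are the labels. -/
structure Inv {n N M : ℕ} [NeZero N] (P : Setup n N M) (s : ℕ) (E : Finset (Sym2 (Fin n)))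
    (L : Fin n → Fin N) (x : Fin M → St P) : Prop where
  recs : ∀ k, (x k).recs = P.idealRecs E L k
  ok : ∀ k, x k ∈ P.okState s k

/-- The messages of a round respect the limits. -/
def OkStep {n N M : ℕ} {P : Setup n N M} (st : Step M (St P) (Msg N)) (s R : ℕ)
    (x : Fin M → St P) : Prop :=
  st.Bounded (3 * s) x ∧ ∀ i j, ∀ a ∈ st.send i (x i) j, a ∈ okMsg N R

section

variable {n N M : ℕ} {P : Setup n N M} {s R : ℕ} {E : Finset (Sym2 (Fin n))}
  {L : Fin n → Fin N} {keep : Sym2 (Fin n) → Bool}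

/-- The edges to be contracted. -/
def contracted (E : Finset (Sym2 (Fin n))) (keep : Sym2 (Fin n) → Bool) :
    Finset (Sym2 (Fin n)) := E.filter fun e => ¬ keep e

theorem idealRecs_filter (p : Sym2 (Fin n) → Prop) [DecidablePred p] (k : Fin M) :
    (P.idealRecs E L k).filter (fun r => p r.1) = P.idealRecs (E.filter p) L k := by
  ext r
  simp only [idealRecs, Finset.mem_filter, Finset.mem_image]
  constructor
  · rintro ⟨⟨e, he, rfl⟩, h⟩; exact ⟨e, ⟨⟨he.1, h⟩, he.2⟩, rfl⟩
  · rintro ⟨e, ⟨⟨he, h⟩, he'⟩, rfl⟩; exact ⟨⟨e, ⟨he, he'⟩, rfl⟩, h⟩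

theorem mem_idealRecs {k : Fin M} {r : EdgeRec n N} :
    r ∈ P.idealRecs E L k ↔ r.1 ∈ E ∧ P.ownE r.1 = k ∧ r.2.1 = L r.1.inf ∧ r.2.2 = L r.1.sup := by
  simp only [idealRecs, Finset.mem_image, Finset.mem_filter]
  constructor
  · rintro ⟨e, ⟨he, he'⟩, rfl⟩; exact ⟨he, he', rfl, rfl⟩
  · rintro ⟨h1, h2, h3, h4⟩
    exact ⟨r.1, ⟨h1, h2⟩, by rw [← h3, ← h4]⟩

theorem card_idealRecs (k : Fin M) :
    (P.idealRecs E L k).card = (E.filter fun e => P.ownE e = k).card :=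
  Finset.card_image_of_injective _ fun _ _ h => congrArg Prod.fst h

theorem sum_card_own (E : Finset (Sym2 (Fin n))) :
    ∑ k, (E.filter fun e => P.ownE e = k).card = E.card :=
  (Finset.card_eq_sum_card_fiberwise (f := P.ownE) (t := Finset.univ) (by simp)).symm

/-- The number of edges to be contracted on the machines before machine `k`. -/
noncomputable def offset (P : Setup n N M) (E : Finset (Sym2 (Fin n))) (keep : Sym2 (Fin n) → Bool)
    (k : Fin M) : ℕ :=
  ∑ k' ∈ Finset.univ.filter (· < k), ((contracted E keep).filter fun e => P.ownE e = k').card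

/-- The number of edges to be contracted. -/
def numContracted (E : Finset (Sym2 (Fin n))) (keep : Sym2 (Fin n) → Bool) : Fin (n + 1) :=
  Fin.ofNat (n + 1) (contracted E keep).card

theorem contracted_subset : contracted E keep ⊆ E := Finset.filter_subset _ _

theorem val_numContracted (hE : E.card ≤ n) :
    (numContracted E keep : ℕ) = (contracted E keep).card := by
  have := Finset.card_le_card (contracted_subset (E := E) (keep := keep))
  simp only [numContracted, Fin.val_ofNat]
  exact Nat.mod_eq_of_lt (by omega)

variable [NeZero N] {x : Fin M → St P}

theorem card_filter_recs (hx : P.Inv s E L x) (k : Fin M) :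
    (((x k).recs.filter fun r => ¬ keep r.1)).card =
      ((contracted E keep).filter fun e => P.ownE e = k).card := by
  rw [hx.recs, idealRecs_filter (fun e => ¬ keep e), card_idealRecs]
  rfl

theorem apply_cntStep (hb : P.Balanced s E L) (hx : P.Inv s E L x) :
    P.Inv s E L ((P.cntStep keep).apply x) ∧
      (∀ k, ((P.cntStep keep).apply x k).off = P.offset E keep k) ∧
      ∀ k, ((P.cntStep keep).apply x k).mem = ⟨numContracted E keep, fun _ _ => 0⟩ := by
  have hoff : ∀ k, ((P.cntStep keep).apply x k).off = P.offset E keep k := by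
    intro k
    simp only [Step.apply, cntStep, List.map_cons, List.map_nil, List.sum_cons, List.sum_nil,
      add_zero, card_filter_recs hx, offset]
  have hmem : ∀ k, ((P.cntStep keep).apply x k).mem = ⟨numContracted E keep, fun _ _ => 0⟩ := by
    intro k
    have h : ∑ j, (((P.cntStep keep).send j (x j) k).map (·.1)).sum = (contracted E keep).card := by
      simp only [cntStep, List.map_cons, List.map_nil, List.sum_cons, List.sum_nil,
        add_zero, card_filter_recs hx, sum_card_own]
    exact congrArg (fun m => (⟨Fin.ofNat (n + 1) m, fun _ _ => 0⟩ :
      Σ m : Fin (n + 1), Fin (P.MA m) → MPCMemory N (P.SA m))) h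
  refine ⟨⟨hx.recs, fun k => ⟨(hx.ok k).1, ?_, ?_, (hx.ok k).2.2.2⟩⟩, hoff, hmem⟩
  · rw [hoff]
    refine le_trans (Finset.sum_le_sum_of_subset (Finset.filter_subset _ _)) ?_
    rw [sum_card_own]
    exact (Finset.card_le_card contracted_subset).trans hb.card
  · rw [hmem]
    exact fun i _ => rfl

theorem okStep_cntStep (hs : P.Fits s) (hR : n ≤ R) (hb : P.Balanced s E L) (hx : P.Inv s E L x) :
    OkStep (P.cntStep keep) s R x := by
  refine ⟨fun i => ?_, fun i j a ha => ?_⟩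
  · have := hs.machines
    simp only [cntStep, List.length_cons, List.length_nil, Finset.sum_const, Finset.card_univ,
      Fintype.card_fin, smul_eq_mul]
    omega
  · simp only [cntStep, List.mem_singleton] at ha
    subst ha
    refine ⟨?_, Nat.zero_le _⟩
    simp only
    rw [card_filter_recs hx]
    exact (Finset.card_filter_le _ _).trans
      (((Finset.card_le_card contracted_subset).trans hb.card).trans hR)

end

end Setup

/-! ### Loading the simulated algorithm -/

theorem List.flatMap_eq_of_nodup {α β : Type*} {l : List α} (hl : l.Nodup) {a : α} (ha : a ∈ l)
    {f : α → List β} (hf : ∀ b ∈ l, b ≠ a → f b = []) : l.flatMap f = f a := by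
  induction l with
  | nil => simp at ha
  | cons c l ih =>
    rw [List.flatMap_cons]
    rw [List.nodup_cons] at hl
    rcases List.mem_cons.1 ha with rfl | ha'
    · have : l.flatMap f = [] := by
        rw [List.flatMap_eq_nil_iff]
        intro b hb
        exact hf b (List.mem_cons_of_mem _ hb) fun h => hl.1 (h ▸ hb)
      rw [this, List.append_nil]
    · rw [hf c List.mem_cons_self fun h => hl.1 (h ▸ ha'), List.nil_append,
        ih hl.2 ha' fun b hb => hf b (List.mem_cons_of_mem _ hb)]

/-- A sum of cardinalities is bounded by means of an injection from the pairs. -/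
theorem Finset.sum_card_le_card_of_injOn {κ β γ : Type*} [Fintype κ] {S : κ → Finset β}
    {U : Finset γ} (f : κ → β → γ) (hf : ∀ k, ∀ b ∈ S k, f k b ∈ U)
    (hinj : ∀ k k' b b', b ∈ S k → b' ∈ S k' → f k b = f k' b' → k = k' ∧ b = b') :
    ∑ k, (S k).card ≤ U.card := by
  classical
  rw [← Finset.card_sigma]
  refine Finset.card_le_card_of_injOn (fun p => f p.1 p.2) ?_ ?_
  · rintro ⟨k, b⟩ h
    exact hf k b (by simpa using h)
  · rintro ⟨k, b⟩ h ⟨k', b'⟩ h' hh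
    obtain ⟨rfl, rfl⟩ := hinj k k' b b' (by simpa using h) (by simpa using h') hh
    rfl

namespace Setup

section

variable {n N M : ℕ} {P : Setup n N M} {s R : ℕ} {E : Finset (Sym2 (Fin n))}
  {L : Fin n → Fin N} {keep : Sym2 (Fin n) → Bool}

/-- The rank of an edge among the edges to be contracted. -/
noncomputable def rank (P : Setup n N M) (E : Finset (Sym2 (Fin n))) (L : Fin n → Fin N)
    (keep : Sym2 (Fin n) → Bool) (e : Sym2 (Fin n)) : ℕ :=
  P.offset E keep (P.ownE e) +
    (P.idealRecs (contracted E keep) L (P.ownE e)).toList.idxOf (e, L e.inf, L e.sup)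

/-- The machine of the simulated algorithm that loads an edge. -/
noncomputable def dest (P : Setup n N M) (E : Finset (Sym2 (Fin n))) (L : Fin n → Fin N)
    (keep : Sym2 (Fin n) → Bool) (e : Sym2 (Fin n)) : Option (Fin (P.MA (numContracted E keep))) :=
  if h : P.rank E L keep e < numContracted E keep then some (P.slot _ ⟨_, h⟩) else none

/-- The edges that a machine of the simulated algorithm loads. -/
noncomputable def simInput (P : Setup n N M) (E : Finset (Sym2 (Fin n))) (L : Fin n → Fin N)
    (keep : Sym2 (Fin n) → Bool) (i : Fin (P.MA (numContracted E keep))) : Finset (Sym2 (Fin N)) :=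
  ((contracted E keep).filter fun e => P.dest E L keep e = some i).image (Sym2.map L)

theorem idxOf_lt {e : Sym2 (Fin n)} (he : e ∈ contracted E keep) :
    (P.idealRecs (contracted E keep) L (P.ownE e)).toList.idxOf (e, L e.inf, L e.sup) <
      ((contracted E keep).filter fun e' => P.ownE e' = P.ownE e).card := by
  rw [← card_idealRecs (L := L), ← Finset.length_toList]
  refine List.idxOf_lt_length_of_mem ?_
  rw [Finset.mem_toList, mem_idealRecs]
  exact ⟨he, rfl, rfl, rfl⟩

theorem offset_add_le {k k' : Fin M} (h : k < k') :
    P.offset E keep k + ((contracted E keep).filter fun e => P.ownE e = k).card ≤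
      P.offset E keep k' := by
  unfold offset
  rw [add_comm, ← Finset.sum_insert (f := fun k =>
    ((contracted E keep).filter fun e => P.ownE e = k).card) (by simp)]
  refine Finset.sum_le_sum_of_subset fun a ha => ?_
  simp only [Finset.mem_insert, Finset.mem_filter, Finset.mem_univ, true_and] at ha ⊢
  rcases ha with rfl | ha
  · exact h
  · exact ha.trans h

theorem rank_lt (hE : E.card ≤ n) {e : Sym2 (Fin n)} (he : e ∈ contracted E keep) :
    P.rank E L keep e < numContracted E keep := by
  rw [val_numContracted hE, ← sum_card_own (P := P)]
  refine lt_of_lt_of_le (Nat.add_lt_add_left (idxOf_lt he) _) ?_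
  unfold offset
  rw [add_comm, ← Finset.sum_insert (f := fun k =>
    ((contracted E keep).filter fun e => P.ownE e = k).card) (by simp)]
  exact Finset.sum_le_sum_of_subset (Finset.subset_univ _)

theorem rank_injOn : Set.InjOn (P.rank E L keep) (contracted E keep) := by
  intro e he e' he' h
  have aux : ∀ {e e'}, e ∈ contracted E keep → P.ownE e < P.ownE e' →
      P.rank E L keep e < P.rank E L keep e' := by
    intro e e' he hlt
    have h1 := idxOf_lt (P := P) (L := L) he
    have h2 := offset_add_le (P := P) (E := E) (keep := keep) hlt
    unfold rank
    omega
  rcases lt_trichotomy (P.ownE e) (P.ownE e') with hlt | heq | hlt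
  · exact absurd h (aux he hlt).ne
  · unfold rank at h
    rw [heq, Nat.add_left_cancel_iff, List.idxOf_inj] at h
    · exact congrArg Prod.fst h
    · rw [Finset.mem_toList, mem_idealRecs]
      exact ⟨he, heq, rfl, rfl⟩
  · exact absurd h.symm (aux he' hlt).ne

theorem exists_dest_eq (hE : E.card ≤ n) {e : Sym2 (Fin n)} (he : e ∈ contracted E keep) :
    ∃ i, P.dest E L keep e = some i := ⟨_, dif_pos (rank_lt hE he)⟩

theorem card_dest_le (i : Fin (P.MA (numContracted E keep))) :
    ((contracted E keep).filter fun e => P.dest E L keep e = some i).card ≤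
      (Finset.univ.filter fun r => P.slot (numContracted E keep) r = i).card := by
  rw [← Finset.card_map Fin.valEmbedding]
  refine Finset.card_le_card_of_injOn (P.rank E L keep) ?_
    (rank_injOn.mono (Finset.coe_subset.2 (Finset.filter_subset _ _)))
  intro e he
  obtain ⟨he, h⟩ := Finset.mem_filter.1 he
  unfold dest at h
  split_ifs at h with h'
  rw [Finset.mem_coe, Finset.mem_map]
  exact ⟨⟨_, h'⟩, Finset.mem_filter.2 ⟨Finset.mem_univ _, by simpa using h⟩, rfl⟩

/-- The edges that are loaded are a distribution of the edges of the graph on the labels. -/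
theorem isEdgeDistribution_simInput (hs : P.Fits s) (hE : E.card ≤ n)
    (hdiag : ∀ e ∈ contracted E keep, ¬ (e.map L).IsDiag)
    (hinj : Set.InjOn (Sym2.map L) (contracted E keep)) :
    IsEdgeDistribution (labelGraph L (contracted E keep)) (P.SA (numContracted E keep))
      (P.simInput E L keep) := by
  classical
  refine ⟨fun i e he => ?_, fun e he => ?_, fun i => ?_⟩
  · simp only [simInput, Finset.mem_image, Finset.mem_filter] at he
    obtain ⟨e, ⟨he, -⟩, rfl⟩ := he
    rw [labelGraph, SimpleGraph.edgeSet_fromEdgeSet]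
    exact ⟨⟨e, he, rfl⟩, hdiag e he⟩
  · rw [labelGraph, SimpleGraph.edgeSet_fromEdgeSet] at he
    obtain ⟨⟨e, he, rfl⟩, -⟩ := he
    obtain ⟨i, hi⟩ := exists_dest_eq (P := P) (L := L) hE he
    refine ⟨i, Finset.mem_image.2 ⟨e, Finset.mem_filter.2 ⟨he, hi⟩, rfl⟩, fun j hj => ?_⟩
    obtain ⟨e', he', hee⟩ := Finset.mem_image.1 hj
    rw [Finset.mem_filter] at he'
    obtain rfl := hinj he'.1 he hee
    simpa [hi] using he'.2.symm
  · refine le_trans (Nat.mul_le_mul_left 2 ?_)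
      (hs.slot _ (Nat.le_of_lt_succ (numContracted E keep).2) i)
    exact Finset.card_image_le.trans (card_dest_le i)

theorem sum_fiberwise_all {m : ℕ} (g : Fin (P.MA m) → ℕ) :
    ∑ k, ∑ i with P.blk m i = k, g i = ∑ i, g i :=
  Finset.sum_fiberwise _ _ _

variable [NeZero N] {x : Fin M → St P} {sd : ∀ m : Fin (n + 1), (P.A m).Seed}

/-- The states when the simulated algorithm has run for `t` rounds. -/
structure SimInv (P : Setup n N M) (s : ℕ) (E : Finset (Sym2 (Fin n))) (L : Fin n → Fin N)
    (keep : Sym2 (Fin n) → Bool) (sd : ∀ m : Fin (n + 1), (P.A m).Seed) (t : ℕ)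
    (x : Fin M → St P) : Prop where
  inv : P.Inv s E L x
  mem : ∀ k, (x k).mem = ⟨numContracted E keep, fun i =>
    if P.blk (numContracted E keep) i = k then
      (P.A (numContracted E keep)).memAfter (P.simInput E L keep) (sd _) t i else fun _ => 0⟩

theorem recs_filter (hx : P.Inv s E L x) (k : Fin M) :
    ((x k).recs.filter fun r => ¬ keep r.1) = P.idealRecs (contracted E keep) L k := by
  rw [hx.recs, idealRecs_filter (fun e => ¬ keep e)]
  rfl

theorem send_loadStep (hx : P.Inv s E L x) {k : Fin M} (hoff : (x k).off = P.offset E keep k)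
    {f : Fin (P.MA (numContracted E keep)) → MPCMemory N (P.SA (numContracted E keep))}
    (hmem : (x k).mem = ⟨numContracted E keep, f⟩) (J : Fin M) :
    (P.loadStep keep sd).send k (x k) J =
      (P.idealRecs (contracted E keep) L k).toList.filterMap fun r => (P.dest E L keep r.1).bind
        fun i => if P.blk _ i = J then some ((i : ℕ), 0, r.2.1, r.2.2) else none := by
  simp only [loadStep]
  rw [hmem, recs_filter hx, hoff]
  refine List.filterMap_congr fun r hr => ?_
  have : P.place (P.offset E keep k) (numContracted E keep) (P.idealRecs (contracted E keep) L k) r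
      = P.dest E L keep r.1 := by
    rw [Finset.mem_toList, mem_idealRecs] at hr
    obtain ⟨h1, rfl, h2, h3⟩ := hr
    simp only [place, dest, rank, ← h2, ← h3]
  rw [this]

theorem mem_send_loadStep (hx : P.Inv s E L x) {k : Fin M} (hoff : (x k).off = P.offset E keep k)
    {f : Fin (P.MA (numContracted E keep)) → MPCMemory N (P.SA (numContracted E keep))}
    (hmem : (x k).mem = ⟨numContracted E keep, f⟩) {J : Fin M} {a : Msg N} :
    a ∈ (P.loadStep keep sd).send k (x k) J ↔ ∃ e ∈ contracted E keep, P.ownE e = k ∧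
      ∃ i, P.dest E L keep e = some i ∧ P.blk _ i = J ∧ a = ((i : ℕ), 0, L e.inf, L e.sup) := by
  rw [send_loadStep hx hoff hmem, List.mem_filterMap]
  constructor
  · rintro ⟨r, hr, h⟩
    rw [Finset.mem_toList, mem_idealRecs] at hr
    obtain ⟨i, hi, h⟩ := Option.bind_eq_some_iff.1 h
    split_ifs at h with hJ
    refine ⟨r.1, hr.1, hr.2.1, i, hi, hJ, ?_⟩
    rw [← hr.2.2.1, ← hr.2.2.2]
    exact (Option.some_injective _ h).symm
  · rintro ⟨e, he, hk, i, hi, hJ, rfl⟩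
    refine ⟨(e, L e.inf, L e.sup), ?_, ?_⟩
    · rw [Finset.mem_toList, mem_idealRecs]; exact ⟨he, hk, rfl, rfl⟩
    · simp [hi, hJ]

theorem length_send_loadStep (hx : P.Inv s E L x) {k : Fin M}
    (hoff : (x k).off = P.offset E keep k)
    {f : Fin (P.MA (numContracted E keep)) → MPCMemory N (P.SA (numContracted E keep))}
    (hmem : (x k).mem = ⟨numContracted E keep, f⟩) (J : Fin M) :
    ((P.loadStep keep sd).send k (x k) J).length =
      ((contracted E keep).filter fun e => P.ownE e = k ∧
        ∃ i, P.dest E L keep e = some i ∧ P.blk _ i = J).card := by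
  rw [send_loadStep hx hoff hmem, List.length_filterMap_eq_countP, List.countP_eq_length_filter]
  rw [← List.toFinset_card_of_nodup ((Finset.nodup_toList _).filter _)]
  symm
  refine Finset.card_bij (fun e _ => (e, L e.inf, L e.sup)) ?_ ?_ ?_
  · intro e he
    rw [Finset.mem_filter] at he
    obtain ⟨he, hk, i, hi, hJ⟩ := he
    simp [mem_idealRecs, he, hk, hi, hJ]
  · intro e _ e' _ h
    exact congrArg Prod.fst h
  · intro r hr
    rw [List.mem_toFinset, List.mem_filter, Finset.mem_toList, mem_idealRecs] at hr
    obtain ⟨⟨h1, h2, h3, h4⟩, h5⟩ := hr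
    refine ⟨r.1, ?_, by rw [← h3, ← h4]⟩
    rw [Finset.mem_filter]
    refine ⟨h1, h2, ?_⟩
    obtain ⟨a, ha⟩ := Option.isSome_iff_exists.1 h5
    obtain ⟨i, hi, h⟩ := Option.bind_eq_some_iff.1 ha
    split_ifs at h with hJ
    exact ⟨i, hi, hJ⟩

theorem okStep_loadStep (hs : P.Fits s) (hb : P.Balanced s E L)
    (hR : P.MA (numContracted E keep) ≤ R) (hx : P.Inv s E L x)
    (hoff : ∀ k, (x k).off = P.offset E keep k)
    (hmem : ∀ k, (x k).mem = ⟨numContracted E keep, fun _ _ => 0⟩) :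
    OkStep (P.loadStep keep sd) s R x := by
  refine ⟨fun k => ⟨?_, ?_⟩, fun i j a ha => ?_⟩
  · simp only [length_send_loadStep hx (hoff k) (hmem k)]
    refine le_trans ?_ ((hb.own k).trans (by omega))
    refine Finset.sum_card_le_card_of_injOn (fun _ e => e) ?_ ?_
    · intro J e he
      rw [Finset.mem_filter] at he ⊢
      exact ⟨contracted_subset he.1, he.2.1⟩
    · intro J J' e e' he he' h
      subst h
      rw [Finset.mem_filter] at he he'
      obtain ⟨-, -, i, hi, rfl⟩ := he
      obtain ⟨-, -, i', hi', rfl⟩ := he'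
      rw [hi] at hi'
      exact ⟨by rw [Option.some_injective _ hi'], rfl⟩
  · have h1 : ∀ j, ((P.loadStep keep sd).send j (x j) k).length = _ := fun j =>
      length_send_loadStep hx (hoff j) (hmem j) k
    simp only [h1]
    refine le_trans (b := ((contracted E keep).filter fun e => ∃ i, P.dest E L keep e = some i ∧
      P.blk _ i = k).card) ?_ ?_
    · refine Finset.sum_card_le_card_of_injOn (fun _ e => e) ?_ ?_
      · intro j e he
        rw [Finset.mem_filter] at he ⊢
        exact ⟨he.1, he.2.2⟩
      · intro j j' e e' he he' h
        subst h
        rw [Finset.mem_filter] at he he'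
        exact ⟨he.2.1.symm.trans he'.2.1, rfl⟩
    · have hm := Nat.le_of_lt_succ (numContracted E keep).2
      refine le_trans (b := ((Finset.univ.filter fun i =>
        P.blk (numContracted E keep) i = k).biUnion fun i =>
          (contracted E keep).filter fun e => P.dest E L keep e = some i).card) ?_ ?_
      · refine Finset.card_le_card fun e he => ?_
        rw [Finset.mem_filter] at he
        obtain ⟨he, i, hi, hk⟩ := he
        exact Finset.mem_biUnion.2 ⟨i, by simp [hk], Finset.mem_filter.2 ⟨he, hi⟩⟩
      · refine (Finset.card_biUnion_le_card_mul _ _ (P.SA (numContracted E keep))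
          fun i _ => (card_dest_le i).trans ?_).trans ((hs.blk _ hm k).trans (by omega))
        have := hs.slot _ hm i
        omega
  · obtain ⟨e, -, -, i', -, -, rfl⟩ := (mem_send_loadStep hx (hoff i) (hmem i)).1 ha
    exact ⟨i'.2.le.trans hR, Nat.zero_le _⟩

theorem mem_loadStep_update (f : Fin M → List (Msg N)) {y : St P} {m : Fin (n + 1)}
    {g : Fin (P.MA m) → MPCMemory N (P.SA m)} (hmem : y.mem = ⟨m, g⟩) (k : Fin M) :
    ((P.loadStep keep sd).update k y f).mem = ⟨m, fun i => if P.blk m i = k then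
      (P.A m).load (sd m) i (Finset.univ.filter fun e =>
        ∃ k, ∃ r ∈ f k, r.1 = i ∧ e = s(r.2.2.1, r.2.2.2)) else fun _ => 0⟩ := by
  classical
  simp only [loadStep]
  rw [hmem]

theorem apply_loadStep (hx : P.Inv s E L x)
    (hoff : ∀ k, (x k).off = P.offset E keep k)
    (hmem : ∀ k, (x k).mem = ⟨numContracted E keep, fun _ _ => 0⟩) :
    P.SimInv s E L keep sd 0 ((P.loadStep keep sd).apply x) := by
  have h : ∀ k, ((P.loadStep keep sd).apply x k).mem = ⟨numContracted E keep, fun i =>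
      if P.blk (numContracted E keep) i = k then
      (P.A (numContracted E keep)).memAfter (P.simInput E L keep) (sd _) 0 i else fun _ => 0⟩ := by
    intro k
    rw [Step.apply, mem_loadStep_update _ (hmem k)]
    congr 1
    funext i
    refine if_ctx_congr Iff.rfl (fun hik => ?_) fun _ => rfl
    rw [MPCAlgorithm.memAfter]
    congr 1
    ext e
    rw [Finset.mem_filter, simInput, Finset.mem_image]
    simp only [Finset.mem_univ, true_and, Finset.mem_filter]
    constructor
    · rintro ⟨k', r, hr, h1, rfl⟩
      obtain ⟨e, he, hk, i', hi', hJ, rfl⟩ := (mem_send_loadStep hx (hoff k') (hmem k')).1 hr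
      obtain rfl : i' = i := Fin.ext h1
      exact ⟨e, ⟨he, hi'⟩, by conv_lhs => rw [← Sym2.mk_inf_sup_eq e, Sym2.map_mk]⟩
    · rintro ⟨e, ⟨he, hi⟩, rfl⟩
      refine ⟨P.ownE e, ((i : ℕ), 0, L e.inf, L e.sup),
        (mem_send_loadStep hx (hoff _) (hmem _)).2 ⟨e, he, rfl, i, hi, hik, rfl⟩, rfl, ?_⟩
      conv_lhs => rw [← Sym2.mk_inf_sup_eq e, Sym2.map_mk]
  refine ⟨⟨hx.recs, fun k => ⟨(hx.ok k).1, (hx.ok k).2.1, ?_, (hx.ok k).2.2.2⟩⟩, h⟩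
  rw [h]
  intro i hi
  simp only at hi
  simp [hi]

/-! ### Simulating a round -/

theorem send_simStep {t t' : ℕ} (hx : P.SimInv s E L keep sd t x) (k J : Fin M) :
    (P.simStep sd t').send k (x k) J =
      (List.finRange (P.MA (numContracted E keep))).flatMap fun i => if P.blk _ i = k then
        (List.finRange (P.MA (numContracted E keep))).flatMap fun j => if P.blk _ j = J then
          ((P.A (numContracted E keep)).send (sd _) t' i
            ((P.A (numContracted E keep)).memAfter (P.simInput E L keep) (sd _) t i) j).map
              fun w => ((i : ℕ), (j : ℕ), w, 0)
        else [] else [] := by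
  simp only [simStep]
  rw [hx.mem k]
  congr 1
  funext i
  by_cases h : P.blk (numContracted E keep) i = k
  · simp [h]
  · simp [h]

theorem length_send_simStep {t : ℕ} (hx : P.SimInv s E L keep sd t x) (k J : Fin M) :
    ((P.simStep sd t).send k (x k) J).length =
      ∑ i with P.blk (numContracted E keep) i = k, ∑ j with P.blk (numContracted E keep) j = J,
        ((P.A (numContracted E keep)).message (P.simInput E L keep) (sd _) t i j).length := by
  rw [send_simStep hx, List.length_flatMap, ← Fin.sum_univ_def, Finset.sum_filter]
  refine Finset.sum_congr rfl fun i _ => ?_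
  split_ifs with h
  · rw [List.length_flatMap, ← Fin.sum_univ_def, Finset.sum_filter]
    refine Finset.sum_congr rfl fun j _ => ?_
    split_ifs with h'
    · simp [MPCAlgorithm.message]
    · simp
  · simp

theorem okStep_simStep (hs : P.Fits s) (hR : P.MA (numContracted E keep) ≤ R) {t : ℕ}
    (hx : P.SimInv s E L keep sd t x)
    (hband : ∀ i : Fin (P.MA (numContracted E keep)),
      (∑ j, ((P.A (numContracted E keep)).message (P.simInput E L keep) (sd _) t i j).length) ≤
        P.SA (numContracted E keep) ∧
      (∑ j, ((P.A (numContracted E keep)).message (P.simInput E L keep) (sd _) t j i).length) ≤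
        P.SA (numContracted E keep)) :
    OkStep (P.simStep sd t) s R x := by
  have hm := Nat.le_of_lt_succ (numContracted E keep).2
  refine ⟨fun k => ⟨?_, ?_⟩, fun i j a ha => ?_⟩
  · simp only [length_send_simStep hx]
    rw [Finset.sum_comm]
    simp only [sum_fiberwise_all]
    refine (Finset.sum_le_card_nsmul _ _ _ fun i _ => (hband i).1).trans ?_
    exact (hs.blk _ hm k).trans (by omega)
  · have h1 : ∀ j, ((P.simStep sd t).send j (x j) k).length = _ := fun j =>
      length_send_simStep hx j k
    simp only [h1]
    rw [sum_fiberwise_all (fun i => ∑ j with P.blk (numContracted E keep) j = k,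
        ((P.A (numContracted E keep)).message (P.simInput E L keep) (sd _) t i j).length),
      Finset.sum_comm]
    refine (Finset.sum_le_card_nsmul _ _ _ fun i _ => (hband i).2).trans ?_
    exact (hs.blk _ hm k).trans (by omega)
  · rw [send_simStep hx] at ha
    obtain ⟨i', -, ha⟩ := List.mem_flatMap.1 ha
    split_ifs at ha
    · obtain ⟨j', -, ha⟩ := List.mem_flatMap.1 ha
      split_ifs at ha
      · obtain ⟨w, -, rfl⟩ := List.mem_map.1 ha
        exact ⟨i'.2.le.trans hR, j'.2.le.trans hR⟩
      · simp at ha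
    · simp at ha

theorem apply_simStep {t : ℕ} (hx : P.SimInv s E L keep sd t x) :
    P.SimInv s E L keep sd (t + 1) ((P.simStep sd t).apply x) := by
  have hdec : ∀ i j, ((P.simStep sd t).send (P.blk (numContracted E keep) i)
      (x (P.blk (numContracted E keep) i)) (P.blk (numContracted E keep) j)).filterMap
        (fun r => if r.1 = (i : ℕ) ∧ r.2.1 = (j : ℕ) then some r.2.2.1 else none) =
      (P.A (numContracted E keep)).send (sd _) t i
        ((P.A (numContracted E keep)).memAfter (P.simInput E L keep) (sd _) t i) j := by
    intro i j
    rw [send_simStep hx, List.filterMap_flatMap,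
      List.flatMap_eq_of_nodup (List.nodup_finRange _) (List.mem_finRange i), if_pos rfl,
      List.filterMap_flatMap,
      List.flatMap_eq_of_nodup (List.nodup_finRange _) (List.mem_finRange j), if_pos rfl,
      List.filterMap_map]
    · simp
    · intro j' _ hj'
      have : (j' : ℕ) ≠ j := fun h => hj' (Fin.ext h)
      split_ifs <;> simp [this]
    · intro i' _ hi'
      have : (i' : ℕ) ≠ i := fun h => hi' (Fin.ext h)
      split_ifs
      · rw [List.filterMap_eq_nil_iff]
        intro a ha
        obtain ⟨j', -, ha⟩ := List.mem_flatMap.1 ha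
        split_ifs at ha
        · obtain ⟨w, -, rfl⟩ := List.mem_map.1 ha
          simp [this]
        · simp at ha
      · simp
  have hmem : ∀ k, ((P.simStep sd t).apply x k).mem = ⟨numContracted E keep, fun i =>
      if P.blk (numContracted E keep) i = k then
      (P.A (numContracted E keep)).memAfter (P.simInput E L keep) (sd _) (t + 1) i
        else fun _ => 0⟩ := by
    intro k
    have : ((P.simStep sd t).apply x k).mem = ⟨(x k).mem.1, fun j => if P.blk (x k).mem.1 j = k then
      (P.A (x k).mem.1).update (sd (x k).mem.1) t j ((x k).mem.2 j) (fun i =>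
        ((P.simStep sd t).send (P.blk (x k).mem.1 i) (x (P.blk (x k).mem.1 i)) k).filterMap fun r =>
          if r.1 = (i : ℕ) ∧ r.2.1 = (j : ℕ) then some r.2.2.1 else none) else fun _ => 0⟩ := rfl
    rw [this, hx.mem k]
    congr 1
    funext j
    refine if_ctx_congr Iff.rfl (fun hjk => ?_) fun _ => rfl
    have hdec' : ∀ i, ((P.simStep sd t).send (P.blk (numContracted E keep) i)
        (x (P.blk (numContracted E keep) i)) k).filterMap
        (fun r => if r.1 = (i : ℕ) ∧ r.2.1 = (j : ℕ) then some r.2.2.1 else none) = _ :=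
      fun i => hjk ▸ hdec i j
    simp only [hdec', hjk, if_true]
    rfl
  refine ⟨⟨hx.inv.recs, fun k => ⟨(hx.inv.ok k).1, (hx.inv.ok k).2.1, ?_,
    (hx.inv.ok k).2.2.2⟩⟩, hmem⟩
  rw [hmem]
  intro i hi
  simp only at hi
  simp [hi]

end

end Setup

/-! ### New labels -/

namespace Setup

section

variable {n N M : ℕ} {P : Setup n N M} {s R : ℕ} {E : Finset (Sym2 (Fin n))}
  {L : Fin n → Fin N} {keep : Sym2 (Fin n) → Bool} {sd : ∀ m : Fin (n + 1), (P.A m).Seed}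

/-- The outputs of the simulated algorithm in a phase. -/
noncomputable def simOutputs (P : Setup n N M) (E : Finset (Sym2 (Fin n))) (L : Fin n → Fin N)
    (keep : Sym2 (Fin n) → Bool) (sd : ∀ m : Fin (n + 1), (P.A m).Seed) :
    Fin (P.MA (numContracted E keep)) → Fin N → Option (Fin N) :=
  (P.A (numContracted E keep)).outputs (P.simInput E L keep) (sd _) P.T

/-- The simulated algorithm succeeds in a phase. -/
structure PhaseOk (P : Setup n N M) (E : Finset (Sym2 (Fin n))) (L : Fin n → Fin N)
    (keep : Sym2 (Fin n) → Bool) (sd : ∀ m : Fin (n + 1), (P.A m).Seed) : Prop where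
  band : (P.A (numContracted E keep)).RespectsBandwidth (P.simInput E L keep) (sd _) P.T
  ident : IdentifiesComponents (labelGraph L (contracted E keep)) (P.SA (numContracted E keep))
    (P.simOutputs E L keep sd)

open Classical in
/-- The new label of an old label. -/
noncomputable def newLabel (P : Setup n N M) (E : Finset (Sym2 (Fin n))) (L : Fin n → Fin N)
    (keep : Sym2 (Fin n) → Bool) (sd : ∀ m : Fin (n + 1), (P.A m).Seed) (v : Fin N) : Fin N :=
  if h : ∃ a i, P.simOutputs E L keep sd i v = some a then h.choose else v

namespace PhaseOk

variable (h : P.PhaseOk E L keep sd)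
include h

theorem exists_output (v : Fin N) :
    ∃ i, P.simOutputs E L keep sd i v = some (P.newLabel E L keep sd v) := by
  obtain ⟨i, hi, -⟩ := h.ident.2.1 v
  have hex : ∃ a i, P.simOutputs E L keep sd i v = some a := by
    obtain ⟨a, ha⟩ := Option.isSome_iff_exists.1 hi
    exact ⟨a, i, ha⟩
  unfold newLabel
  rw [dif_pos hex]
  exact hex.choose_spec

theorem output_unique {i j : Fin (P.MA (numContracted E keep))} {v a b : Fin N}
    (hi : P.simOutputs E L keep sd i v = some a) (hj : P.simOutputs E L keep sd j v = some b) :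
    i = j ∧ a = b := by
  have : i = j := (h.ident.2.1 v).unique (by simp [hi]) (by simp [hj])
  subst this
  rw [hi] at hj
  exact ⟨rfl, Option.some_injective _ hj⟩

theorem output_eq {i : Fin (P.MA (numContracted E keep))} {v a : Fin N}
    (hi : P.simOutputs E L keep sd i v = some a) : a = P.newLabel E L keep sd v := by
  obtain ⟨j, hj⟩ := h.exists_output v
  exact (h.output_unique hi hj).2

theorem newLabel_eq_iff (u v : Fin N) :
    P.newLabel E L keep sd u = P.newLabel E L keep sd v ↔
      (labelGraph L (contracted E keep)).Reachable u v := by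
  obtain ⟨i, hi⟩ := h.exists_output u
  obtain ⟨j, hj⟩ := h.exists_output v
  exact h.ident.2.2 u v i j _ _ hi hj

theorem SA_pos [NeZero N] : 0 < P.SA (numContracted E keep) := by
  obtain ⟨i, hi⟩ := h.exists_output 0
  have h1 := h.ident.1 i
  have h2 : 0 < (Finset.univ.filter fun v => (P.simOutputs E L keep sd i v).isSome).card :=
    Finset.card_pos.2 ⟨0, by simp [hi]⟩
  omega

end PhaseOk

/-- A label is asked for by at most two machines. -/
theorem card_askers_le (hb : P.Balanced s E L) (v : Fin N) :
    (Finset.univ.filter fun k => ∃ e ∈ E, P.ownE e = k ∧ v ∈ e.map L).card ≤ 2 := by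
  refine le_trans (le_trans (Finset.card_le_card (t := (E.filter fun e => v ∈ e.map L).image P.ownE)
    fun k hk => ?_) Finset.card_image_le) (hb.label v)
  simp only [Finset.mem_filter, Finset.mem_univ, true_and, Finset.mem_image] at hk ⊢
  obtain ⟨e, he, hk, hv⟩ := hk
  exact ⟨e, ⟨he, hv⟩, hk⟩

theorem sum_card_askers_le (hs : P.Fits s) (hb : P.Balanced s E L) (J : Fin M) :
    ∑ v with P.own v = J,
      (Finset.univ.filter fun k => ∃ e ∈ E, P.ownE e = k ∧ v ∈ e.map L).card ≤ 2 * s := by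
  refine (Finset.sum_le_card_nsmul _ _ 2 fun v _ => card_askers_le hb v).trans ?_
  have := hs.own J
  rw [smul_eq_mul]
  omega

variable [NeZero N] {x : Fin M → St P}

/-! ### Looking up the new labels -/

theorem mem_labels (hx : P.Inv s E L x) {k : Fin M} {v : Fin N} :
    v ∈ (x k).recs.image (·.2.1) ∪ (x k).recs.image (·.2.2) ↔
      ∃ e ∈ E, P.ownE e = k ∧ v ∈ e.map L := by
  simp only [hx.recs, Finset.mem_union, Finset.mem_image, mem_idealRecs]
  have hmem : ∀ e : Sym2 (Fin n), v ∈ e.map L ↔ v = L e.inf ∨ v = L e.sup := by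
    intro e
    conv_lhs => rw [← Sym2.mk_inf_sup_eq e, Sym2.map_mk, Sym2.mem_iff]
  constructor
  · rintro (⟨r, ⟨h1, h2, h3, h4⟩, rfl⟩ | ⟨r, ⟨h1, h2, h3, h4⟩, rfl⟩)
    · exact ⟨r.1, h1, h2, (hmem _).2 (Or.inl h3)⟩
    · exact ⟨r.1, h1, h2, (hmem _).2 (Or.inr h4)⟩
  · rintro ⟨e, he, hk, hv⟩
    rcases (hmem e).1 hv with rfl | rfl
    · exact Or.inl ⟨(e, L e.inf, L e.sup), ⟨he, hk, rfl, rfl⟩, rfl⟩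
    · exact Or.inr ⟨(e, L e.inf, L e.sup), ⟨he, hk, rfl, rfl⟩, rfl⟩

theorem card_labels_le (hx : P.Inv s E L x) (k : Fin M) :
    ((x k).recs.image (·.2.1) ∪ (x k).recs.image (·.2.2)).card ≤ 2 * s := by
  refine (Finset.card_union_le _ _).trans ?_
  have h1 : (x k).recs.card ≤ s := (hx.ok k).1
  have h2 := Finset.card_image_le (s := (x k).recs) (f := fun r => r.2.1)
  have h3 := Finset.card_image_le (s := (x k).recs) (f := fun r => r.2.2)
  omega

theorem send_outStep (hx : P.SimInv s E L keep sd P.T x) (I J : Fin M) :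
    (P.outStep sd).send I (x I) J =
      (Finset.univ.filter fun p : Fin N × Fin N => P.own p.1 = J ∧ ∃ i, P.blk _ i = I ∧
        P.simOutputs E L keep sd i p.1 = some p.2).toList.map (fun p => (0, 0, p.1, p.2)) ++
      (Finset.univ.filter fun v => (∃ e ∈ E, P.ownE e = I ∧ v ∈ e.map L) ∧ P.own v = J).toList.map
        (fun v => (1, 0, v, 0)) := by
  classical
  simp only [outStep]
  congr 2
  · rw [hx.mem I]
    congr 1
    ext p
    simp only [Finset.mem_filter, Finset.mem_univ, true_and]
    refine and_congr_right fun _ => exists_congr fun i => and_congr_right fun hi => ?_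
    rw [if_pos hi]
    rfl
  · congr 1
    ext v
    rw [Finset.mem_filter, mem_labels hx.inv]
    simp

theorem mem_send_outStep_zero (hx : P.SimInv s E L keep sd P.T x) {I J : Fin M} {v a : Fin N} :
    (0, 0, v, a) ∈ (P.outStep sd).send I (x I) J ↔
      P.own v = J ∧ ∃ i, P.blk _ i = I ∧ P.simOutputs E L keep sd i v = some a := by
  rw [send_outStep hx]
  simp

theorem mem_send_outStep_one (hx : P.SimInv s E L keep sd P.T x) {I J : Fin M} {v : Fin N} :
    (1, 0, v, 0) ∈ (P.outStep sd).send I (x I) J ↔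
      (∃ e ∈ E, P.ownE e = I ∧ v ∈ e.map L) ∧ P.own v = J := by
  rw [send_outStep hx]
  simp

theorem okStep_outStep (hs : P.Fits s) (hb : P.Balanced s E L) (hR : 1 ≤ R)
    (hx : P.SimInv s E L keep sd P.T x) (hok : P.PhaseOk E L keep sd) :
    OkStep (P.outStep sd) s R x := by
  classical
  have hm := Nat.le_of_lt_succ (numContracted E keep).2
  refine ⟨fun k => ⟨?_, ?_⟩, fun i j a ha => ?_⟩
  · simp only [send_outStep hx, List.length_append, List.length_map, Finset.length_toList,
      Finset.sum_add_distrib]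
    have h1 : ∑ J, (Finset.univ.filter fun p : Fin N × Fin N => P.own p.1 = J ∧
        ∃ i, P.blk _ i = k ∧ P.simOutputs E L keep sd i p.1 = some p.2).card ≤ s := by
      refine le_trans (Finset.sum_card_le_card_of_injOn
        (U := (Finset.univ.filter fun i => P.blk (numContracted E keep) i = k).biUnion fun i =>
          Finset.univ.filter fun v => (P.simOutputs E L keep sd i v).isSome) (fun _ p => p.1) ?_ ?_)
        ((Finset.card_biUnion_le_card_mul _ _ (P.SA (numContracted E keep)) fun i _ => ?_).trans
          (hs.blk _ hm k))
      · intro J p hp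
        simp only [Finset.mem_filter, Finset.mem_univ, true_and, Finset.mem_biUnion] at hp ⊢
        obtain ⟨-, i, hi, h⟩ := hp
        exact ⟨i, hi, by simp [h]⟩
      · rintro J J' ⟨v, a⟩ ⟨v', a'⟩ hp hp' h
        simp only [Finset.mem_filter, Finset.mem_univ, true_and] at hp hp' h
        subst h
        obtain ⟨rfl, i, -, h⟩ := hp
        obtain ⟨rfl, i', -, h'⟩ := hp'
        exact ⟨rfl, by rw [(hok.output_unique h h').2]⟩
      · have := hok.ident.1 i
        omega
    have h2 : ∑ J, (Finset.univ.filter fun v => (∃ e ∈ E, P.ownE e = k ∧ v ∈ e.map L) ∧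
        P.own v = J).card ≤ 2 * s := by
      refine le_trans ?_ (card_labels_le hx.inv k)
      refine Finset.sum_card_le_card_of_injOn (fun _ v => v) ?_ ?_
      · intro J v hv
        rw [mem_labels hx.inv]
        exact (Finset.mem_filter.1 hv).2.1
      · intro J J' v v' hv hv' h
        subst h
        exact ⟨(Finset.mem_filter.1 hv).2.2.symm.trans (Finset.mem_filter.1 hv').2.2, rfl⟩
    omega
  · simp only [send_outStep hx, List.length_append, List.length_map, Finset.length_toList,
      Finset.sum_add_distrib]
    have h1 : ∑ I, (Finset.univ.filter fun p : Fin N × Fin N => P.own p.1 = k ∧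
        ∃ i, P.blk _ i = I ∧ P.simOutputs E L keep sd i p.1 = some p.2).card ≤ s := by
      refine le_trans (Finset.sum_card_le_card_of_injOn (fun _ p => p.1) ?_ ?_) (hs.own k)
      · intro J p hp
        simp only [Finset.mem_filter, Finset.mem_univ, true_and] at hp ⊢
        exact hp.1
      · rintro J J' ⟨v, a⟩ ⟨v', a'⟩ hp hp' h
        simp only [Finset.mem_filter, Finset.mem_univ, true_and] at hp hp' h
        subst h
        obtain ⟨-, i, rfl, h⟩ := hp
        obtain ⟨-, i', rfl, h'⟩ := hp'
        obtain ⟨rfl, rfl⟩ := hok.output_unique h h'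
        exact ⟨rfl, rfl⟩
    have h2 : ∑ I, (Finset.univ.filter fun v => (∃ e ∈ E, P.ownE e = I ∧ v ∈ e.map L) ∧
        P.own v = k).card ≤ 2 * s := by
      refine le_trans (le_of_eq ?_) (sum_card_askers_le hs hb k)
      simp only [Finset.card_filter, Finset.sum_filter]
      rw [Finset.sum_comm]
      refine Finset.sum_congr rfl fun v _ => ?_
      by_cases hv : P.own v = k <;> simp [hv]
    omega
  · rw [send_outStep hx, List.mem_append, List.mem_map, List.mem_map] at ha
    rcases ha with ⟨p, -, rfl⟩ | ⟨p, -, rfl⟩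
    · exact ⟨Nat.zero_le _, Nat.zero_le _⟩
    · exact ⟨hR, Nat.zero_le _⟩

/-- The states when the new labels have been looked up. -/
structure AnsInv (P : Setup n N M) (s : ℕ) (E : Finset (Sym2 (Fin n))) (L : Fin n → Fin N)
    (keep : Sym2 (Fin n) → Bool) (sd : ∀ m : Fin (n + 1), (P.A m).Seed) (x : Fin M → St P) :
    Prop where
  inv : P.Inv s E L x
  ans : ∀ k p, p ∈ (x k).ans ↔ P.own p.2.1 = k ∧ (∃ e ∈ E, P.ownE e = p.1 ∧ p.2.1 ∈ e.map L) ∧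
    p.2.2 = P.newLabel E L keep sd p.2.1

theorem apply_outStep (hs : P.Fits s) (hb : P.Balanced s E L)
    (hx : P.SimInv s E L keep sd P.T x) (hok : P.PhaseOk E L keep sd) :
    P.AnsInv s E L keep sd ((P.outStep sd).apply x) := by
  classical
  have hans : ∀ k p, p ∈ ((P.outStep sd).apply x k).ans ↔ P.own p.2.1 = k ∧
      (∃ e ∈ E, P.ownE e = p.1 ∧ p.2.1 ∈ e.map L) ∧ p.2.2 = P.newLabel E L keep sd p.2.1 := by
    rintro k ⟨k', v, a⟩
    have : (k', v, a) ∈ ((P.outStep sd).apply x k).ans ↔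
        (1, 0, v, 0) ∈ (P.outStep sd).send k' (x k') k ∧
          ∃ I, (0, 0, v, a) ∈ (P.outStep sd).send I (x I) k := by
      simp only [Step.apply, outStep, Finset.mem_filter, Finset.mem_univ, true_and]
    rw [this]
    simp only [mem_send_outStep_one hx, mem_send_outStep_zero hx]
    constructor
    · rintro ⟨⟨h1, h2⟩, I, -, i, -, h3⟩
      exact ⟨h2, h1, hok.output_eq h3⟩
    · rintro ⟨h2, h1, rfl⟩
      obtain ⟨i, hi⟩ := hok.exists_output v
      exact ⟨⟨h1, h2⟩, P.blk _ i, h2, i, rfl, hi⟩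
  refine ⟨⟨hx.inv.recs, fun k => ⟨(hx.inv.ok k).1, (hx.inv.ok k).2.1, (hx.inv.ok k).2.2.1, ?_⟩⟩,
    hans⟩
  refine le_trans ?_ (sum_card_askers_le hs hb k)
  rw [← Finset.card_sigma]
  refine Finset.card_le_card_of_injOn (fun p => ⟨p.2.1, p.1⟩) ?_ ?_
  · intro p hp
    obtain ⟨h1, h2, -⟩ := (hans k p).1 hp
    simp only [Finset.coe_sigma, Set.mem_sigma_iff, Finset.mem_coe, Finset.mem_filter,
      Finset.mem_univ, true_and]
    exact ⟨h1, h2⟩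
  · rintro ⟨k1, v1, a1⟩ hp ⟨k2, v2, a2⟩ hp' h
    obtain ⟨-, -, h1⟩ := (hans k _).1 hp
    obtain ⟨-, -, h2⟩ := (hans k _).1 hp'
    simp only [Sigma.mk.injEq, heq_eq_eq] at h h1 h2
    obtain ⟨rfl, rfl⟩ := h
    rw [h1, h2]

theorem mem_send_replyStep (hx : P.AnsInv s E L keep sd x) {I J : Fin M} {a : Msg N} :
    a ∈ (P.replyStep keep).send I (x I) J ↔ ∃ v, P.own v = I ∧
      (∃ e ∈ E, P.ownE e = J ∧ v ∈ e.map L) ∧ a = (0, 0, v, P.newLabel E L keep sd v) := by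
  simp only [replyStep, List.mem_map, Finset.mem_toList, Finset.mem_image, Finset.mem_filter,
    hx.ans]
  constructor
  · rintro ⟨p, ⟨q, ⟨⟨h1, h2, h3⟩, h4⟩, rfl⟩, rfl⟩
    exact ⟨q.2.1, h1, h4 ▸ h2, by rw [h3]⟩
  · rintro ⟨v, h1, h2, rfl⟩
    exact ⟨(v, P.newLabel E L keep sd v), ⟨(J, v, P.newLabel E L keep sd v),
      ⟨⟨h1, h2, rfl⟩, rfl⟩, rfl⟩, rfl⟩

theorem okStep_replyStep (hx : P.AnsInv s E L keep sd x) :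
    OkStep (P.replyStep keep) s R x := by
  classical
  refine ⟨fun k => ⟨?_, ?_⟩, fun i j a ha => ?_⟩
  · have h1 : ∀ J, ((P.replyStep keep).send k (x k) J).length ≤
        ((x k).ans.filter fun p => p.1 = J).card := by
      intro J
      simp only [replyStep, List.length_map, Finset.length_toList]
      exact Finset.card_image_le
    refine (Finset.sum_le_sum fun J _ => h1 J).trans ?_
    rw [← Finset.card_eq_sum_card_fiberwise (by simp)]
    exact (hx.inv.ok k).2.2.2.trans (by omega)
  · refine le_trans ?_ ((card_labels_le hx.inv k).trans (by omega))
    have h1 : ∀ I, ((P.replyStep keep).send I (x I) k).length =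
        (((x I).ans.filter fun p => p.1 = k).image (·.2)).card := by
      intro I
      simp only [replyStep, List.length_map, Finset.length_toList]
    simp only [h1]
    refine Finset.sum_card_le_card_of_injOn (fun _ p => p.1) ?_ ?_
    · intro I p hp
      obtain ⟨q, hq, rfl⟩ := Finset.mem_image.1 hp
      rw [Finset.mem_filter, hx.ans] at hq
      rw [mem_labels hx.inv]
      exact hq.2 ▸ hq.1.2.1
    · intro I I' p p' hp hp' h
      obtain ⟨q, hq, rfl⟩ := Finset.mem_image.1 hp
      obtain ⟨q', hq', rfl⟩ := Finset.mem_image.1 hp'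
      rw [Finset.mem_filter, hx.ans] at hq hq'
      refine ⟨?_, Prod.ext h ?_⟩
      · rw [← hq.1.1, ← hq'.1.1, h]
      · rw [hq.1.2.2, hq'.1.2.2, h]
  · obtain ⟨v, -, -, rfl⟩ := (mem_send_replyStep hx).1 ha
    exact ⟨Nat.zero_le _, Nat.zero_le _⟩

theorem apply_replyStep (hx : P.AnsInv s E L keep sd x) :
    P.Inv s (E.filter fun e => keep e) (P.newLabel E L keep sd ∘ L)
      ((P.replyStep keep).apply x) := by
  classical
  have hlook : ∀ k v, (∃ e ∈ E, P.ownE e = k ∧ v ∈ e.map L) →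
      lookup (fun j => (P.replyStep keep).send j (x j) k) v = P.newLabel E L keep sd v := by
    intro k v hv
    have hex : ∃ a j, (0, 0, v, a) ∈ (P.replyStep keep).send j (x j) k :=
      ⟨_, P.own v, (mem_send_replyStep hx).2 ⟨v, rfl, hv, rfl⟩⟩
    unfold lookup
    rw [dif_pos hex]
    obtain ⟨j, hj⟩ := hex.choose_spec
    obtain ⟨v', -, -, h⟩ := (mem_send_replyStep hx).1 hj
    simp only [Prod.mk.injEq, true_and] at h
    rw [h.2, ← h.1]
  have hrecs : ∀ k, ((P.replyStep keep).apply x k).recs =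
      P.idealRecs (E.filter fun e => keep e) (P.newLabel E L keep sd ∘ L) k := by
    intro k
    have h1 : ((P.replyStep keep).apply x k).recs =
        ((x k).recs.filter fun r => keep r.1).image fun r =>
          (r.1, lookup (fun j => (P.replyStep keep).send j (x j) k) r.2.1,
            lookup (fun j => (P.replyStep keep).send j (x j) k) r.2.2) := by
      simp only [Step.apply, replyStep]
    rw [h1, hx.inv.recs, idealRecs_filter (fun e => (keep e : Prop)), idealRecs, idealRecs,
      Finset.image_image]
    refine Finset.image_congr fun e he => ?_
    simp only [Finset.coe_filter, Finset.mem_filter, Set.mem_ofPred_eq] at he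
    simp only [Function.comp_apply]
    have hmem : L e.inf ∈ e.map L ∧ L e.sup ∈ e.map L := by
      conv => rw [← Sym2.mk_inf_sup_eq e]
      rw [Sym2.map_mk]
      simp [Sym2.mk_inf_sup_eq]
    rw [hlook k _ ⟨e, he.1.1, he.2, hmem.1⟩, hlook k _ ⟨e, he.1.1, he.2, hmem.2⟩]
  refine ⟨hrecs, fun k => ⟨?_, (hx.inv.ok k).2⟩⟩
  have h1 : ((P.replyStep keep).apply x k).recs.card ≤ (x k).recs.card := by
    simp only [Step.apply, replyStep]
    exact Finset.card_image_le.trans (Finset.card_filter_le _ _)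
  exact h1.trans (hx.inv.ok k).1

/-! ### A phase -/

/-- A phase in which the simulated algorithm succeeds respects all limits, drops the contracted
edges and updates the labels. -/
theorem run_phaseStep (hs : P.Fits s) (hRn : n ≤ R) (hR : 1 ≤ R)
    (hRM : P.MA (numContracted E keep) ≤ R)
    (hb : P.Balanced s E L) (hx : P.Inv s E L x) (hok : P.PhaseOk E L keep sd) :
    (∀ t < P.T + 4, OkStep (P.phaseStep keep sd t) s R (Step.run (P.phaseStep keep sd) x t) ∧
      ∀ k, Step.run (P.phaseStep keep sd) x t k ∈ P.okState s k) ∧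
    P.Inv s (E.filter fun e => keep e) (P.newLabel E L keep sd ∘ L)
      (Step.run (P.phaseStep keep sd) x (P.T + 4)) := by
  obtain ⟨h0, hoff, hmem⟩ := apply_cntStep (keep := keep) hb hx
  have e0 : P.phaseStep keep sd 0 = P.cntStep keep := by simp [phaseStep]
  have e1 : P.phaseStep keep sd 1 = P.loadStep keep sd := by simp [phaseStep]
  have e2 : ∀ t < P.T, P.phaseStep keep sd (t + 2) = P.simStep sd t := by
    intro t ht; simp [phaseStep, ht]
  have e3 : P.phaseStep keep sd (P.T + 2) = P.outStep sd := by simp [phaseStep]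
  have e4 : P.phaseStep keep sd (P.T + 3) = P.replyStep keep := by simp [phaseStep]
  have r1 : Step.run (P.phaseStep keep sd) x 1 = (P.cntStep keep).apply x := by
    rw [Step.run, e0]; rfl
  have r2 : ∀ t ≤ P.T, P.SimInv s E L keep sd t (Step.run (P.phaseStep keep sd) x (t + 2)) := by
    intro t
    induction t with
    | zero =>
      intro _
      rw [Step.run, e1, r1]
      exact apply_loadStep h0 hoff hmem
    | succ t ih =>
      intro ht
      rw [Step.run, e2 t (by omega)]
      exact apply_simStep (ih (by omega))
  have r3 := r2 P.T le_rfl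
  have r4 : P.AnsInv s E L keep sd (Step.run (P.phaseStep keep sd) x (P.T + 3)) := by
    rw [Step.run, e3]
    exact apply_outStep hs hb r3 hok
  refine ⟨fun t ht => ?_, ?_⟩
  · rcases t with _ | _ | t
    · rw [e0]
      exact ⟨okStep_cntStep hs hRn hb hx, hx.ok⟩
    · rw [e1, r1]
      exact ⟨okStep_loadStep hs hb hRM h0 hoff hmem, h0.ok⟩
    · rcases lt_trichotomy t P.T with h | rfl | h
      · rw [e2 t h]
        exact ⟨okStep_simStep hs hRM (r2 t h.le) (hok.band t h), (r2 t h.le).inv.ok⟩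
      · rw [e3]
        exact ⟨okStep_outStep hs hb hR r3 hok, r3.inv.ok⟩
      · obtain rfl : t = P.T + 1 := by omega
        rw [e4]
        exact ⟨okStep_replyStep r4, r4.inv.ok⟩
  · rw [Step.run, e4]
    exact apply_replyStep r4

end

end Setup

/-! ### The whole algorithm -/

namespace Step

variable {M : ℕ} {X α : Type}

theorem run_add (P : ℕ → Step M X α) (x : Fin M → X) (a b : ℕ) :
    run P x (a + b) = run (fun t => P (a + t)) (run P x a) b := by
  induction b with
  | zero => rfl
  | succ b ih => rw [← add_assoc, run, run, ih]

theorem run_congr {P Q : ℕ → Step M X α} {x : Fin M → X} {t : ℕ} (h : ∀ i < t, P i = Q i) :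
    run P x t = run Q x t := by
  induction t with
  | zero => rfl
  | succ t ih => rw [run, run, ih fun i hi => h i (by omega), h t (by omega)]

end Step

/-- The edges of a graph as a finite set. -/
noncomputable def edges {n : ℕ} (G : SimpleGraph (Fin n)) : Finset (Sym2 (Fin n)) := by
  classical exact Finset.univ.filter fun e => e ∈ G.edgeSet

theorem mem_edges {n : ℕ} {G : SimpleGraph (Fin n)} {e : Sym2 (Fin n)} :
    e ∈ edges G ↔ e ∈ G.edgeSet := by
  classical
  simp [edges]

/-- The edges that remain after `j` phases. -/
def edgesAt {n : ℕ} (E : Finset (Sym2 (Fin n))) (keeps : ℕ → Sym2 (Fin n) → Bool) :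
    ℕ → Finset (Sym2 (Fin n))
  | 0 => E
  | j + 1 => (edgesAt E keeps j).filter fun e => keeps j e

theorem edgesAt_anti {n : ℕ} {E : Finset (Sym2 (Fin n))} {keeps : ℕ → Sym2 (Fin n) → Bool}
    {j k : ℕ} (h : j ≤ k) : edgesAt E keeps k ⊆ edgesAt E keeps j := by
  induction k, h using Nat.le_induction with
  | base => exact subset_rfl
  | succ k _ ih => exact (Finset.filter_subset _ _).trans ih

theorem mem_edgesAt {n : ℕ} {E : Finset (Sym2 (Fin n))} {keeps : ℕ → Sym2 (Fin n) → Bool}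
    {j : ℕ} {e : Sym2 (Fin n)} : e ∈ edgesAt E keeps j ↔ e ∈ E ∧ ∀ i < j, keeps i e := by
  induction j with
  | zero => simp [edgesAt]
  | succ j ih =>
    simp only [edgesAt, Finset.mem_filter, ih, Nat.lt_succ_iff_lt_or_eq, or_imp, forall_and,
      forall_eq, and_assoc]

namespace Setup

variable {n N M : ℕ} {P : Setup n N M} {s R : ℕ} {G : SimpleGraph (Fin n)}
  {σ : Equiv.Perm (Fin n)}

/-- The labels of the vertices after `j` phases. -/
noncomputable def labelsAt (P : Setup n N M) (E : Finset (Sym2 (Fin n))) (L : Fin n → Fin N)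
    (keeps : ℕ → Sym2 (Fin n) → Bool) (sds : ℕ → ∀ m : Fin (n + 1), (P.A m).Seed) :
    ℕ → Fin n → Fin N
  | 0 => L
  | j + 1 => P.newLabel (edgesAt E keeps j) (labelsAt P E L keeps sds j) (keeps j) (sds j) ∘
      labelsAt P E L keeps sds j

/-- The labels depend on the seeds of the previous phases only. -/
theorem labelsAt_congr {E : Finset (Sym2 (Fin n))} {L : Fin n → Fin N}
    {keeps : ℕ → Sym2 (Fin n) → Bool} {sds sds' : ℕ → ∀ m : Fin (n + 1), (P.A m).Seed} {j : ℕ}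
    (h : ∀ i < j, sds i = sds' i) :
    P.labelsAt E L keeps sds j = P.labelsAt E L keeps sds' j := by
  induction j with
  | zero => rfl
  | succ j ih => rw [labelsAt, labelsAt, ih fun i hi => h i (by omega), h j (by omega)]

/-- The simulated algorithm succeeds in phase `j`. -/
def OkAt (P : Setup n N M) (E : Finset (Sym2 (Fin n))) (L : Fin n → Fin N)
    (keeps : ℕ → Sym2 (Fin n) → Bool) (sds : ℕ → ∀ m : Fin (n + 1), (P.A m).Seed) (j : ℕ) : Prop :=
  P.PhaseOk (edgesAt E keeps j) (P.labelsAt E L keeps sds j) (keeps j) (sds j)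

theorem coe_contracted {E : Finset (Sym2 (Fin n))} {keep : Sym2 (Fin n) → Bool} :
    (contracted E keep : Set (Sym2 (Fin n))) =
      (E : Set (Sym2 (Fin n))) \ (E.filter fun e => keep e : Finset (Sym2 (Fin n))) := by
  ext e
  simp [contracted]
  tauto

theorem coe_edgesAt_subset {keeps : ℕ → Sym2 (Fin n) → Bool} (j : ℕ) :
    (edgesAt (edges G) keeps j : Set (Sym2 (Fin n))) ⊆ G.edgeSet :=
  fun _ he => mem_edges.1 (edgesAt_anti (Nat.zero_le j) he)

/-- After successful phases, the labels are the components of the graph without the remaining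
edges. -/
theorem labelsAt_eq_iff {L : Fin n → Fin N} (hL : Function.Injective L)
    {keeps : ℕ → Sym2 (Fin n) → Bool} {sds : ℕ → ∀ m : Fin (n + 1), (P.A m).Seed} {j : ℕ}
    (h : ∀ i < j, P.OkAt (edges G) L keeps sds i) (u v : Fin n) :
    P.labelsAt (edges G) L keeps sds j u = P.labelsAt (edges G) L keeps sds j v ↔
      (G.deleteEdges (edgesAt (edges G) keeps j : Set (Sym2 (Fin n)))).Reachable u v := by
  induction j generalizing u v with
  | zero =>
    rw [labelsAt, hL.eq_iff]
    constructor
    · rintro rfl; exact SimpleGraph.Reachable.refl _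
    · rintro ⟨p⟩
      cases p with
      | nil => rfl
      | cons hab p =>
        rw [SimpleGraph.deleteEdges_adj] at hab
        exact absurd (mem_edges.2 hab.1) hab.2
  | succ j ih =>
    have ih := ih fun i hi => h i (by omega)
    rw [labelsAt, Function.comp_apply, Function.comp_apply, (h j (by omega)).newLabel_eq_iff,
      coe_contracted]
    exact labelGraph_reachable (coe_edgesAt_subset j) (Finset.coe_subset.2 (edgesAt_anti
      (Nat.le_succ j))) ih u v

/-- The rounds of the algorithm: `K` phases, and two rounds to determine the answer. -/
noncomputable def steps [NeZero N] (P : Setup n N M) (K : ℕ) (keeps : ℕ → Sym2 (Fin n) → Bool)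
    (sds : ℕ → ∀ m : Fin (n + 1), (P.A m).Seed) (t : ℕ) : Step M (St P) (Msg N) :=
  if t < K * (P.T + 4) then
    P.phaseStep (keeps (t / (P.T + 4))) (sds (t / (P.T + 4))) (t % (P.T + 4))
  else if t = K * (P.T + 4) then P.gatherStep else P.castStep

/-- The initial state of a machine with the given edges. -/
noncomputable def initState [NeZero N] (P : Setup n N M) (L : Fin n → Fin N)
    (E : Finset (Sym2 (Fin n))) : St P where
  recs := E.image fun e => (e, L e.inf, L e.sup)
  off := 0
  mem := ⟨0, fun _ _ => 0⟩
  ans := ∅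
  fin := false

theorem card_edges_le (h : IsCycleCover G σ) : (edges G).card ≤ n := by
  have : edges G ⊆ Finset.univ.image fun v => s(v, σ v) := fun e he => by
    obtain ⟨v, rfl⟩ := h.exists_eq_of_mem_edgeSet (mem_edges.1 he)
    exact Finset.mem_image_of_mem _ (Finset.mem_univ _)
  simpa using (Finset.card_le_card this).trans Finset.card_image_le

theorem balanced_of_subset (h : IsCycleCover G σ) {E : Finset (Sym2 (Fin n))} (hE : E ⊆ edges G)
    (hown : ∀ k, ((edges G).filter fun e => P.ownE e = k).card ≤ s) {L : Fin n → Fin N}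
    (hL : ∀ u v, L u = L v ↔ (G.deleteEdges (E : Set (Sym2 (Fin n)))).Reachable u v) :
    P.Balanced s E L where
  card := (Finset.card_le_card hE).trans (card_edges_le h)
  own k := (Finset.card_le_card (Finset.filter_subset_filter _ hE)).trans (hown k)
  label := h.card_incident_le (fun _ he => mem_edges.1 (hE he)) hL

variable [NeZero N]

theorem inv_initState (hown : ∀ k, ((edges G).filter fun e => P.ownE e = k).card ≤ s)
    (L : Fin n → Fin N) :
    P.Inv s (edges G) L (fun k => P.initState L (ownedEdges G P.ownE k)) := by
  have hE : ∀ k, ownedEdges G P.ownE k = (edges G).filter fun e => P.ownE e = k := by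
    intro k; ext e; simp [ownedEdges, mem_edges]
  refine ⟨fun k => ?_, fun k => ⟨?_, Nat.zero_le _, fun i _ => rfl, by simp [initState]⟩⟩
  · simp only [initState, idealRecs, hE]
  · simp only [initState, hE]
    exact Finset.card_image_le.trans (hown k)

theorem reachable_pow (h : IsCycleCover G σ) (w : ℕ) (u : Fin n) : G.Reachable u ((σ ^ w) u) := by
  induction w with
  | zero => exact SimpleGraph.Reachable.refl _
  | succ w ih =>
    rw [perm_pow_succ_apply]
    exact ih.trans (SimpleGraph.Adj.reachable (h.mem_edgeSet _))

theorem okStep_gatherStep {E : Finset (Sym2 (Fin n))} {L : Fin n → Fin N} {x : Fin M → St P}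
    (hx : P.Inv s E L x) (hcard : E.card ≤ s) : OkStep P.gatherStep s R x := by
  have hrec : ∀ k, (x k).recs.card = _ := fun k => by rw [hx.recs, card_idealRecs]
  refine ⟨fun k => ⟨?_, ?_⟩, fun i j a ha => ?_⟩
  · have h1 : ∀ J, (P.gatherStep.send k (x k) J).length =
        if J = P.root then (x k).recs.card else 0 := by
      intro J; simp only [gatherStep]; split_ifs <;> simp
    simp only [h1, Finset.sum_ite_eq', Finset.mem_univ, if_true]
    exact (hx.ok k).1.trans (by omega)
  · have h1 : ∀ I, (P.gatherStep.send I (x I) k).length ≤ (x I).recs.card := by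
      intro I; simp only [gatherStep]; split_ifs <;> simp
    refine (Finset.sum_le_sum fun I _ => h1 I).trans ?_
    simp only [hrec, sum_card_own]
    omega
  · simp only [gatherStep] at ha
    split_ifs at ha
    · obtain ⟨r, -, rfl⟩ := List.mem_map.1 ha
      exact ⟨Nat.zero_le _, Nat.zero_le _⟩
    · simp at ha

/-- If the remaining edges meet every cycle, then the machine that gathers them can decide whether
the graph is connected. -/
theorem fin_gatherStep (h : IsCycleCover G σ) {E : Finset (Sym2 (Fin n))} {L : Fin n → Fin N}
    {x : Fin M → St P} (hE : E ⊆ edges G) (hx : P.Inv s E L x)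
    (hL : ∀ u v, L u = L v ↔ (G.deleteEdges (E : Set (Sym2 (Fin n)))).Reachable u v)
    (hits : ∀ v, ∃ w : ℕ, s((σ ^ w) v, (σ ^ (w + 1)) v) ∈ E) :
    (P.gatherStep.apply x P.root).fin = true ↔ G.Preconnected := by
  have hmem : ∀ k (r : Msg N), r ∈ P.gatherStep.send k (x k) P.root ↔
      ∃ e ∈ E, P.ownE e = k ∧ r = (0, 0, L e.inf, L e.sup) := by
    intro k r
    simp only [gatherStep, if_true, List.mem_map, Finset.mem_toList, hx.recs, mem_idealRecs]
    constructor
    · rintro ⟨r, ⟨h1, h2, h3, h4⟩, rfl⟩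
      exact ⟨r.1, h1, h2, by rw [h3, h4]⟩
    · rintro ⟨e, he, hk, rfl⟩
      exact ⟨(e, L e.inf, L e.sup), ⟨he, hk, rfl, rfl⟩, rfl⟩
  have hgraph : SimpleGraph.fromEdgeSet {e : Sym2 (Fin N) |
      ∃ k, ∃ r ∈ P.gatherStep.send k (x k) P.root, e = s(r.2.2.1, r.2.2.2)} =
      labelGraph L ((E : Set (Sym2 (Fin n))) \ ∅) := by
    unfold labelGraph
    congr 1
    ext e
    simp only [hmem, Set.mem_ofPred_eq, Set.mem_image, Set.sdiff_empty, Finset.mem_coe]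
    constructor
    · rintro ⟨k, r, ⟨e, he, -, rfl⟩, rfl⟩
      exact ⟨e, he, by conv_lhs => rw [← Sym2.mk_inf_sup_eq e, Sym2.map_mk]⟩
    · rintro ⟨e, he, rfl⟩
      exact ⟨P.ownE e, _, ⟨e, he, rfl, rfl⟩, by
        conv_lhs => rw [← Sym2.mk_inf_sup_eq e, Sym2.map_mk]⟩
  have hreach : ∀ u v, (labelGraph L ((E : Set (Sym2 (Fin n))) \ ∅)).Reachable (L u) (L v) ↔
      G.Reachable u v := by
    intro u v
    rw [labelGraph_reachable (G := G) (fun _ he => mem_edges.1 (hE he)) (Set.empty_subset _) hL,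
      SimpleGraph.deleteEdges_empty]
  have hfin : (P.gatherStep.apply x P.root).fin = true ↔ ∀ e ∈ E, ∀ e' ∈ E,
      G.Reachable e.inf e'.inf := by
    have h1 : (P.gatherStep.apply x P.root).fin = true ↔ ∀ k k',
        ∀ r ∈ P.gatherStep.send k (x k) P.root, ∀ r' ∈ P.gatherStep.send k' (x k') P.root,
        (SimpleGraph.fromEdgeSet {e : Sym2 (Fin N) | ∃ k, ∃ r ∈ P.gatherStep.send k (x k) P.root,
          e = s(r.2.2.1, r.2.2.2)}).Reachable r.2.2.1 r'.2.2.1 := decide_eq_true_iff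
    rw [h1, hgraph]
    constructor
    · intro h2 e he e' he'
      have := h2 _ _ _ ((hmem _ _).2 ⟨e, he, rfl, rfl⟩) _ ((hmem _ _).2 ⟨e', he', rfl, rfl⟩)
      exact (hreach _ _).1 this
    · intro h2 k k' r hr r' hr'
      obtain ⟨e, he, -, rfl⟩ := (hmem _ _).1 hr
      obtain ⟨e', he', -, rfl⟩ := (hmem _ _).1 hr'
      exact (hreach _ _).2 (h2 e he e' he')
  rw [hfin]
  constructor
  · intro h2 u v
    have key : ∀ v : Fin n, ∃ e ∈ E, G.Reachable v e.inf := by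
      intro v
      obtain ⟨w, hw⟩ := hits v
      refine ⟨_, hw, ?_⟩
      have : (s((σ ^ w) v, (σ ^ (w + 1)) v)).inf = (σ ^ w) v ∨
          (s((σ ^ w) v, (σ ^ (w + 1)) v)).inf = (σ ^ (w + 1)) v := by
        rw [Sym2.inf_mk]
        exact min_choice _ _
      rcases this with h3 | h3
      · rw [h3]; exact reachable_pow h w v
      · rw [h3]; exact reachable_pow h (w + 1) v
    obtain ⟨e, he, h3⟩ := key u
    obtain ⟨e', he', h4⟩ := key v
    exact h3.trans ((h2 e he e' he').trans h4.symm)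
  · intro h2 e _ e' _
    exact h2 _ _

/-- If the simulated algorithm succeeds in all phases and the remaining edges meet every cycle and
fit onto one machine, then the algorithm respects all limits and finds out whether the graph is
connected. -/
theorem run_steps (h : IsCycleCover G σ) (hs : P.Fits s) (hRn : n ≤ R) (hR : 1 ≤ R)
    (hRM : ∀ m ≤ n, 0 < P.SA m → P.MA m ≤ R)
    (hown : ∀ k, ((edges G).filter fun e => P.ownE e = k).card ≤ s)
    {L : Fin n → Fin N} (hL : Function.Injective L) {K : ℕ} {keeps : ℕ → Sym2 (Fin n) → Bool}
    {sds : ℕ → ∀ m : Fin (n + 1), (P.A m).Seed}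
    (hits : ∀ v, ∃ w : ℕ, s((σ ^ w) v, (σ ^ (w + 1)) v) ∈ edgesAt (edges G) keeps K)
    (hcard : (edgesAt (edges G) keeps K).card ≤ s)
    (hok : ∀ j < K, P.OkAt (edges G) L keeps sds j) :
    (∀ t ≤ K * (P.T + 4) + 2, ∀ k, Step.run (P.steps K keeps sds)
      (fun k => P.initState L (ownedEdges G P.ownE k)) t k ∈ P.okState s k) ∧
    (∀ t < K * (P.T + 4) + 2, OkStep (P.steps K keeps sds t) s R (Step.run (P.steps K keeps sds)
      (fun k => P.initState L (ownedEdges G P.ownE k)) t)) ∧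
    ∀ k, (Step.run (P.steps K keeps sds) (fun k => P.initState L (ownedEdges G P.ownE k))
      (K * (P.T + 4) + 2) k).fin = true ↔ G.Preconnected := by
  set x0 : Fin M → St P := fun k => P.initState L (ownedEdges G P.ownE k) with hx0
  have hphase : ∀ j < K, ∀ r < P.T + 4, P.steps K keeps sds (j * (P.T + 4) + r) =
      P.phaseStep (keeps j) (sds j) r := by
    intro j hj r hr
    have h1 : j * (P.T + 4) + r < K * (P.T + 4) := by
      calc j * (P.T + 4) + r < (j + 1) * (P.T + 4) := by rw [add_mul]; omega
        _ ≤ K * (P.T + 4) := Nat.mul_le_mul_right _ hj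
    have h2 : (j * (P.T + 4) + r) / (P.T + 4) = j := by
      rw [mul_comm, Nat.mul_add_div (by omega), Nat.div_eq_of_lt hr, add_zero]
    have h3 : (j * (P.T + 4) + r) % (P.T + 4) = r := by
      rw [mul_comm, Nat.mul_add_mod, Nat.mod_eq_of_lt hr]
    simp only [steps, h1, if_true, h2, h3]
  have hlab : ∀ j ≤ K, ∀ u v, _ := fun j hj =>
    labelsAt_eq_iff (P := P) (G := G) hL (keeps := keeps) (sds := sds) (j := j)
      fun i hi => hok i (by omega)
  have hbal : ∀ j ≤ K,
      P.Balanced s (edgesAt (edges G) keeps j) (P.labelsAt (edges G) L keeps sds j) :=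
    fun j hj => balanced_of_subset h (edgesAt_anti (Nat.zero_le j)) hown (hlab j hj)
  have hrun : ∀ j, ∀ r ≤ P.T + 4, j < K → Step.run (P.steps K keeps sds) x0 (j * (P.T + 4) + r) =
      Step.run (P.phaseStep (keeps j) (sds j))
        (Step.run (P.steps K keeps sds) x0 (j * (P.T + 4))) r := by
    intro j r hr hj
    rw [Step.run_add]
    exact Step.run_congr fun i hi => hphase j hj i (by omega)
  have hinv : ∀ j ≤ K, P.Inv s (edgesAt (edges G) keeps j) (P.labelsAt (edges G) L keeps sds j)
      (Step.run (P.steps K keeps sds) x0 (j * (P.T + 4))) := by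
    intro j
    induction j with
    | zero =>
      intro _
      rw [zero_mul]
      exact inv_initState hown L
    | succ j ih =>
      intro hj
      rw [add_mul, one_mul, hrun j _ le_rfl (by omega)]
      exact (run_phaseStep hs hRn hR (hRM _ (Nat.le_of_lt_succ (numContracted _ _).2)
        (hok j (by omega)).SA_pos) (hbal j (by omega)) (ih (by omega)) (hok j (by omega))).2
  have hmain : ∀ t < K * (P.T + 4), OkStep (P.steps K keeps sds t) s R
      (Step.run (P.steps K keeps sds) x0 t) ∧
      ∀ k, Step.run (P.steps K keeps sds) x0 t k ∈ P.okState s k := by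
    intro t ht
    have hj : t / (P.T + 4) < K := Nat.div_lt_of_lt_mul (by rwa [mul_comm] at ht)
    have hr : t % (P.T + 4) < P.T + 4 := Nat.mod_lt _ (by omega)
    rw [show t = t / (P.T + 4) * (P.T + 4) + t % (P.T + 4) from (Nat.div_add_mod' t _).symm,
      hrun _ _ hr.le hj, hphase _ hj _ hr]
    exact (run_phaseStep hs hRn hR (hRM _ (Nat.le_of_lt_succ (numContracted _ _).2)
        (hok _ hj).SA_pos) (hbal _ hj.le) (hinv _ hj.le) (hok _ hj)).1 _ hr
  have eg : P.steps K keeps sds (K * (P.T + 4)) = P.gatherStep := by simp [steps]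
  have ec : P.steps K keeps sds (K * (P.T + 4) + 1) = P.castStep := by simp [steps]
  have hK := hinv K le_rfl
  set y := Step.run (P.steps K keeps sds) x0 (K * (P.T + 4)) with hy
  have y1 : Step.run (P.steps K keeps sds) x0 (K * (P.T + 4) + 1) = P.gatherStep.apply y := by
    rw [Step.run, eg]
  have y2 : Step.run (P.steps K keeps sds) x0 (K * (P.T + 4) + 2) =
      P.castStep.apply (P.gatherStep.apply y) := by
    rw [Step.run, y1, ec]
  refine ⟨fun t ht k => ?_, fun t ht => ?_, fun k => ?_⟩
  · obtain ht | rfl | rfl | rfl : t < K * (P.T + 4) ∨ t = K * (P.T + 4) ∨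
      t = K * (P.T + 4) + 1 ∨ t = K * (P.T + 4) + 2 := by omega
    · exact (hmain t ht).2 k
    · exact hK.ok k
    · rw [y1]; exact hK.ok k
    · rw [y2]; exact hK.ok k
  · obtain ht | rfl | rfl : t < K * (P.T + 4) ∨ t = K * (P.T + 4) ∨
      t = K * (P.T + 4) + 1 := by omega
    · exact (hmain t ht).1
    · rw [eg]; exact okStep_gatherStep hK hcard
    · rw [ec]
      have hM := hs.machines
      have h1 : ∀ I J (z : St P), (P.castStep.send I z J).length ≤ 1 := by
        intro I J z; simp only [castStep]; split_ifs <;> simp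
      refine ⟨fun I => ⟨?_, ?_⟩, fun i j a ha => ?_⟩
      · refine (Finset.sum_le_card_nsmul _ _ 1 fun J _ => h1 _ _ _).trans ?_
        simp; omega
      · refine (Finset.sum_le_card_nsmul _ _ 1 fun J _ => h1 _ _ _).trans ?_
        simp; omega
      · simp only [castStep] at ha
        split_ifs at ha
        · rw [List.mem_singleton] at ha
          subst ha
          refine ⟨?_, Nat.zero_le _⟩
          exact hR
        · rw [List.mem_singleton] at ha
          subst ha
          exact ⟨Nat.zero_le _, Nat.zero_le _⟩
        · simp at ha
  · rw [y2, ← fin_gatherStep h (edgesAt_anti (Nat.zero_le K)) hK (hlab K le_rfl) hits]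
    simp only [Step.apply, castStep, if_true, decide_eq_true_eq]
    split_ifs <;> simp_all

end Setup

/-! ### Random subsets of the edges -/

section

variable {α β : Type*} [Fintype α] [DecidableEq α] [Fintype β] [DecidableEq β] [Nonempty β]

/-- The generating function of the number of elements of `W` that a random function maps to `b`. -/
theorem sum_prod_ite (W : Finset α) (b : β) (x : ℝ) :
    (∑ f : α → β, ∏ e ∈ W, if f e = b then x else 1) =
      (1 + (x - 1) / Fintype.card β) ^ W.card * Fintype.card (α → β) := by
  have hc : (Fintype.card β : ℝ) ≠ 0 := by exact_mod_cast Fintype.card_ne_zero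
  have h1 : ∀ f : α → β, (∏ e ∈ W, if f e = b then x else 1) =
      ∏ e, if e ∈ W then (if f e = b then x else 1) else 1 := by
    intro f
    rw [Finset.prod_ite_mem, Finset.univ_inter]
  simp only [h1]
  have h2 := Finset.prod_univ_sum (fun _ : α => (Finset.univ : Finset β))
    (fun e c => if e ∈ W then (if c = b then x else 1) else (1 : ℝ))
  rw [Fintype.piFinset_univ] at h2
  rw [← h2]
  have h3 : ∀ e : α, (∑ c : β, if e ∈ W then (if c = b then x else 1) else (1 : ℝ)) =
      (if e ∈ W then (1 + (x - 1) / Fintype.card β) else 1) * Fintype.card β := by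
    intro e
    split_ifs
    · have : ∀ c : β, (if c = b then x else 1) = 1 + if c = b then x - 1 else 0 := by
        intro c; split_ifs <;> ring
      simp only [this, Finset.sum_add_distrib, Finset.sum_ite_eq', Finset.mem_univ, if_true]
      simp
      field_simp
    · simp
  simp only [h3, Finset.prod_mul_distrib]
  rw [Finset.prod_ite_mem, Finset.univ_inter, Finset.prod_const, Finset.prod_const,
    Fintype.card_fun, Finset.card_univ]
  push_cast
  rfl

theorem pr_forall_ne (W : Finset α) (b : β) :
    pr (fun f : α → β => ∀ e ∈ W, f e ≠ b) = (1 - 1 / (Fintype.card β : ℝ)) ^ W.card := by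
  classical
  have hc : (Fintype.card (α → β) : ℝ) ≠ 0 := by exact_mod_cast Fintype.card_ne_zero
  unfold pr
  rw [div_eq_iff hc]
  have := sum_prod_ite W b 0
  rw [zero_sub, neg_div, ← sub_eq_add_neg] at this
  rw [← this, Finset.card_filter]
  push_cast
  refine Finset.sum_congr rfl fun f _ => ?_
  split_ifs with h
  · exact (Finset.prod_eq_one fun e he => if_neg (h e he)).symm
  · push Not at h
    obtain ⟨e, he, h⟩ := h
    exact (Finset.prod_eq_zero he (by simp [h])).symm

/-- An exponential moment bounds the probability that many elements of `W` are mapped to `b`. -/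
theorem pr_le_card_filter (W : Finset α) (b : β) (s : ℕ) :
    pr (fun f : α → β => s ≤ (W.filter fun e => f e = b).card) ≤
      (1 + 1 / (Fintype.card β : ℝ)) ^ W.card / 2 ^ s := by
  classical
  have hc : (0 : ℝ) < Fintype.card (α → β) := by exact_mod_cast Fintype.card_pos
  unfold pr
  rw [div_le_iff₀ hc, div_mul_eq_mul_div, le_div_iff₀ (by positivity)]
  have := sum_prod_ite (α := α) W b 2
  rw [show (2 : ℝ) - 1 = 1 by norm_num] at this
  rw [← this, Finset.card_filter]
  push_cast
  rw [Finset.sum_mul]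
  refine Finset.sum_le_sum fun f _ => ?_
  have h1 : (∏ e ∈ W, if f e = b then (2 : ℝ) else 1) = 2 ^ (W.filter fun e => f e = b).card := by
    rw [Finset.prod_ite, Finset.prod_const, Finset.prod_const_one, mul_one]
  rw [h1]
  split_ifs with h
  · rw [one_mul]
    exact pow_le_pow_right₀ (by norm_num) h
  · simp

end

/-- The edges that are kept in phase `j` according to the hash values `h`. -/
def keepsOf {n K q : ℕ} [NeZero q] (h : Fin K → Sym2 (Fin n) → Fin q) (j : ℕ)
    (e : Sym2 (Fin n)) : Bool :=
  if hj : j < K then decide (h ⟨j, hj⟩ e = 0) else true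

/-- The properties of the hash values that the algorithm needs: every arc with `D` remaining edges
contains an edge that is kept, some edges of every cycle remain until the end, but not too many. -/
structure GoodHashes {n K q : ℕ} [NeZero q] (G : SimpleGraph (Fin n)) (σ : Equiv.Perm (Fin n))
    (D s : ℕ) (h : Fin K → Sym2 (Fin n) → Fin q) : Prop where
  window : ∀ j < K, ∀ u w, D ≤ (edgesAt (edges G) (keepsOf h) j ∩ arc σ u w).card →
    ∃ e ∈ arc σ u w, e ∈ edgesAt (edges G) (keepsOf h) (j + 1)
  hits : ∀ v, ∃ w : ℕ, s((σ ^ w) v, (σ ^ (w + 1)) v) ∈ edgesAt (edges G) (keepsOf h) K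
  card : (edgesAt (edges G) (keepsOf h) K).card ≤ s

theorem pr_piComm {n K q : ℕ} (Q : (Sym2 (Fin n) → Fin K → Fin q) → Prop) :
    pr (fun h : Fin K → Sym2 (Fin n) → Fin q => Q fun e j => h j e) = pr Q :=
  pr_equiv (Equiv.piComm fun (_ : Fin K) (_ : Sym2 (Fin n)) => Fin q) Q

section

variable {n K q : ℕ} [NeZero q] {G : SimpleGraph (Fin n)} {σ : Equiv.Perm (Fin n)}

theorem edgesAt_congr {E : Finset (Sym2 (Fin n))} {keeps keeps' : ℕ → Sym2 (Fin n) → Bool} {j : ℕ}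
    (h : ∀ i < j, keeps i = keeps' i) : edgesAt E keeps j = edgesAt E keeps' j := by
  ext e
  rw [mem_edgesAt, mem_edgesAt]
  refine and_congr_right fun _ => forall_congr' fun i => forall_congr' fun hi => ?_
  rw [h i hi]

theorem mem_edgesAt_last {E : Finset (Sym2 (Fin n))} {h : Fin K → Sym2 (Fin n) → Fin q}
    {e : Sym2 (Fin n)} :
    e ∈ edgesAt E (keepsOf h) K ↔ e ∈ E ∧ (fun j => h j e) = fun _ => 0 := by
  rw [mem_edgesAt]
  refine and_congr_right fun _ => ?_
  constructor
  · intro hh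
    funext j
    simpa [keepsOf] using hh j j.2
  · intro hh i hi
    have : h ⟨i, hi⟩ e = 0 := congrFun hh ⟨i, hi⟩
    simp [keepsOf, hi, this]

/-- In every phase, the next `D` remaining edges after a vertex are unlikely to be all contracted:
they are determined by the previous hash values, so that the new ones are independent of them. -/
theorem pr_not_window_le (D : ℕ) (j : Fin K) :
    pr (fun h : Fin K → Sym2 (Fin n) → Fin q =>
      ∃ u w, D ≤ (edgesAt (edges G) (keepsOf h) j ∩ arc σ u w).card ∧
        ∀ e ∈ arc σ u w, e ∉ edgesAt (edges G) (keepsOf h) (j + 1)) ≤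
      n * (1 - 1 / (q : ℝ)) ^ D := by
  classical
  have hq : (1 : ℝ) ≤ q := by exact_mod_cast NeZero.one_le
  have h0 : 0 ≤ 1 - 1 / (q : ℝ) := by
    rw [sub_nonneg, div_le_one (by linarith)]; exact hq
  have h1 : 1 - 1 / (q : ℝ) ≤ 1 := by
    have : 0 ≤ 1 / (q : ℝ) := by positivity
    linarith
  refine pr_pi_le (by positivity) j fun ω => ?_
  set E := edgesAt (edges G) (keepsOf ω) j with hE
  have hupd : ∀ x : Sym2 (Fin n) → Fin q,
      edgesAt (edges G) (keepsOf (Function.update ω j x)) j = E := by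
    intro x
    refine edgesAt_congr fun i hi => ?_
    funext e
    unfold keepsOf
    split_ifs with h
    · rw [Function.update_of_ne]
      exact fun hh => hi.ne (congrArg Fin.val hh)
    · rfl
  have hupd' : ∀ (x : Sym2 (Fin n) → Fin q) e,
      e ∈ edgesAt (edges G) (keepsOf (Function.update ω j x)) (j + 1) ↔ e ∈ E ∧ x e = 0 := by
    intro x e
    rw [edgesAt, hupd, Finset.mem_filter]
    simp [keepsOf]
  -- the shortest arc from `u` with `D` remaining edges
  let W : Fin n → Finset (Sym2 (Fin n)) := fun u =>
    if h : ∃ w, D ≤ (E ∩ arc σ u w).card then E ∩ arc σ u (Nat.find h) else ∅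
  refine le_trans (pr_mono (Q := fun x => ∃ u ∈ (Finset.univ : Finset (Fin n)),
    D ≤ (W u).card ∧ ∀ e ∈ W u, x e ≠ 0) ?_) ((pr_exists_le _ _).trans ?_)
  · rintro x ⟨u, w, hw, ha⟩
    rw [hupd] at hw
    have hex : ∃ w, D ≤ (E ∩ arc σ u w).card := ⟨w, hw⟩
    refine ⟨u, Finset.mem_univ _, ?_⟩
    simp only [W, dif_pos hex]
    refine ⟨Nat.find_spec hex, fun e he hx => ?_⟩
    rw [Finset.mem_inter] at he
    exact ha e (arc_mono u (Nat.find_min' hex hw) he.2) ((hupd' x e).2 ⟨he.1, hx⟩)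
  · refine (Finset.sum_le_card_nsmul _ _ ((1 - 1 / (q : ℝ)) ^ D) fun u _ => ?_).trans
      (by simp)
    by_cases hD : D ≤ (W u).card
    · refine (pr_mono (Q := fun x : Sym2 (Fin n) → Fin q => ∀ e ∈ W u, x e ≠ 0)
        fun x hx => hx.2).trans ?_
      rw [pr_forall_ne, Fintype.card_fin]
      exact pow_le_pow_of_le_one h0 h1 hD
    · refine (pr_mono (Q := fun _ => False) fun x hx => hD hx.1).trans ?_
      rw [pr_false]
      positivity

/-- An edge remains until the end with probability `q ^ (-K)`, and a cycle has `k` edges. -/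
theorem pr_not_hits_le (hG : IsCycleCover G σ) {k : ℕ} (hk : HasLargeCycles σ k) :
    pr (fun h : Fin K → Sym2 (Fin n) → Fin q =>
      ∃ v, ∀ w : ℕ, s((σ ^ w) v, (σ ^ (w + 1)) v) ∉ edgesAt (edges G) (keepsOf h) K) ≤
      n * (1 - 1 / (q : ℝ) ^ K) ^ k := by
  classical
  have hq : (1 : ℝ) ≤ (q : ℝ) ^ K := one_le_pow₀ (by exact_mod_cast NeZero.one_le)
  have h0 : 0 ≤ 1 - 1 / (q : ℝ) ^ K := by
    rw [sub_nonneg, div_le_one (by linarith)]; exact hq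
  have h1 : 1 - 1 / (q : ℝ) ^ K ≤ 1 := by
    have : 0 ≤ 1 / (q : ℝ) ^ K := by positivity
    linarith
  choose S hS hS' using hk
  refine le_trans (pr_mono (Q := fun h => ∃ v ∈ (Finset.univ : Finset (Fin n)),
    ∀ e ∈ (S v).image fun x => s(x, σ x), (fun j => h j e) ≠ fun _ => 0) ?_)
    ((pr_exists_le _ _).trans ?_)
  · rintro h ⟨v, hv⟩
    refine ⟨v, Finset.mem_univ _, fun e he h0 => ?_⟩
    obtain ⟨x, hx, rfl⟩ := Finset.mem_image.1 he
    obtain ⟨w, rfl⟩ := hS' v x hx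
    refine hv w ?_
    rw [perm_pow_succ_apply, mem_edgesAt_last]
    exact ⟨mem_edges.2 (hG.mem_edgeSet _), h0⟩
  · refine (Finset.sum_le_card_nsmul _ _ ((1 - 1 / (q : ℝ) ^ K) ^ k) fun v _ => ?_).trans
      (by simp)
    rw [pr_piComm (fun f => ∀ e ∈ (S v).image fun x => s(x, σ x), f e ≠ fun _ => 0), pr_forall_ne,
      Finset.card_image_of_injective _ hG.edge_injective]
    simp only [Fintype.card_fun, Fintype.card_fin, Nat.cast_pow]
    exact pow_le_pow_of_le_one h0 h1 (hS v)

theorem pr_card_edgesAt_le (hG : IsCycleCover G σ) (s : ℕ) :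
    pr (fun h : Fin K → Sym2 (Fin n) → Fin q => s ≤ (edgesAt (edges G) (keepsOf h) K).card) ≤
      (1 + 1 / (q : ℝ) ^ K) ^ n / 2 ^ s := by
  classical
  have h1 : ∀ h : Fin K → Sym2 (Fin n) → Fin q, edgesAt (edges G) (keepsOf h) K =
      (edges G).filter fun e => (fun j => h j e) = fun _ => 0 := by
    intro h; ext e; rw [mem_edgesAt_last, Finset.mem_filter]
  simp only [h1]
  rw [pr_piComm (fun f => s ≤ ((edges G).filter fun e => f e = fun _ => 0).card)]
  refine (pr_le_card_filter _ _ _).trans ?_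
  simp only [Fintype.card_fun, Fintype.card_fin, Nat.cast_pow]
  gcongr
  · have : (0 : ℝ) ≤ 1 / (q : ℝ) ^ K := by positivity
    linarith
  · exact Setup.card_edges_le hG

theorem pr_not_goodHashes_le (hG : IsCycleCover G σ) {k : ℕ} (hk : HasLargeCycles σ k) (D s : ℕ) :
    pr (fun h : Fin K → Sym2 (Fin n) → Fin q => ¬ GoodHashes G σ D s h) ≤
      K * (n * (1 - 1 / (q : ℝ)) ^ D) + n * (1 - 1 / (q : ℝ) ^ K) ^ k +
        (1 + 1 / (q : ℝ) ^ K) ^ n / 2 ^ s := by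
  have h1 := pr_exists_le (Finset.univ : Finset (Fin K))
    (fun j (h : Fin K → Sym2 (Fin n) → Fin q) =>
      ∃ u w, D ≤ (edgesAt (edges G) (keepsOf h) j ∩ arc σ u w).card ∧
        ∀ e ∈ arc σ u w, e ∉ edgesAt (edges G) (keepsOf h) (j + 1))
  have h2 := Finset.sum_le_card_nsmul (Finset.univ : Finset (Fin K)) _ _
    fun j _ => pr_not_window_le (G := G) (σ := σ) (q := q) D j
  rw [Finset.card_univ, Fintype.card_fin, nsmul_eq_mul] at h2
  refine le_trans (pr_mono ?_) ((pr_or_le _ _).trans (add_le_add ((pr_or_le _ _).trans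
    (add_le_add (h1.trans h2) (pr_not_hits_le hG hk))) (pr_card_edgesAt_le hG s)))
  intro h hh
  by_contra hcon
  push Not at hcon
  refine hh ⟨fun j hj u w hw => ?_, hcon.1.2, hcon.2.le⟩
  exact hcon.1.1 ⟨j, hj⟩ (Finset.mem_univ _) u w hw

end

/-! ### The probability of failure -/

/-- A finite sequence of seeds, continued arbitrarily. -/
noncomputable def extSeeds {Ξ : Type*} [Nonempty Ξ] {K : ℕ} (f : Fin K → Ξ) (j : ℕ) : Ξ :=
  if h : j < K then f ⟨j, h⟩ else Classical.arbitrary Ξ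

theorem extSeeds_update {Ξ : Type*} [Nonempty Ξ] {K : ℕ} (f : Fin K → Ξ) (j : Fin K) (x : Ξ) :
    extSeeds (Function.update f j x) j = x ∧
      ∀ i < (j : ℕ), extSeeds (Function.update f j x) i = extSeeds f i := by
  refine ⟨by simp [extSeeds], fun i hi => ?_⟩
  unfold extSeeds
  split_ifs with h
  · rw [Function.update_of_ne]
    exact fun hh => hi.ne (congrArg Fin.val hh)
  · rfl

theorem MPCAlgorithm.successProb_eq_pr {n M S : ℕ} {O : Type} (A : MPCAlgorithm n M S O)
    (inp : Fin M → Finset (Sym2 (Fin n))) (T : ℕ) (correct : (Fin M → O) → Prop) :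
    A.successProb inp T correct =
      pr fun s : A.Seed => A.RespectsBandwidth inp s T ∧ correct (A.outputs inp s T) := by
  unfold pr MPCAlgorithm.successProb
  congr

namespace Setup

variable {n N M : ℕ} {P : Setup n N M} {s R : ℕ} {G : SimpleGraph (Fin n)}
  {σ : Equiv.Perm (Fin n)}

/-- With probability at least `1 - δ`, the algorithms of the setup succeed on graphs of diameter at
most `D`. -/
def Succeeds (P : Setup n N M) (D : ℕ) (δ : ℝ) : Prop :=
  ∀ m ≤ n, ∀ H : SimpleGraph (Fin N), H.edgeSet.ncard = m → DiameterAtMost H D →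
    ∀ inp : Fin (P.MA m) → Finset (Sym2 (Fin N)), IsEdgeDistribution H (P.SA m) inp →
      1 - δ ≤ (P.A m).successProb inp P.T (IdentifiesComponents H (P.SA m))

/-- In a phase, the simulated algorithm is run on a graph of small diameter, so that it fails with
probability at most `δ`. -/
theorem pr_not_phaseOk_le (h : IsCycleCover G σ) (hs : P.Fits s) {D : ℕ} {δ : ℝ}
    (hA : P.Succeeds D δ) {E : Finset (Sym2 (Fin n))} {L : Fin n → Fin N}
    {keep : Sym2 (Fin n) → Bool} (hE : E ⊆ edges G) (hEn : E.card ≤ n)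
    (hL : ∀ u v, L u = L v ↔ (G.deleteEdges (E : Set (Sym2 (Fin n)))).Reachable u v)
    (hits : ∀ v, ∃ w : ℕ, s((σ ^ w) v, (σ ^ (w + 1)) v) ∈ E.filter fun e => keep e)
    (hwin : ∀ u w, D ≤ (E ∩ arc σ u w).card → ∃ e ∈ arc σ u w, e ∈ E.filter fun e => keep e) :
    pr (fun sd : ∀ m : Fin (n + 1), (P.A m).Seed => ¬ P.PhaseOk E L keep sd) ≤ δ := by
  classical
  have hEG : (E : Set (Sym2 (Fin n))) ⊆ G.edgeSet := fun _ he => mem_edges.1 (hE he)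
  have hE'E : ((E.filter fun e => keep e : Finset (Sym2 (Fin n))) : Set (Sym2 (Fin n))) ⊆ E :=
    Finset.coe_subset.2 (Finset.filter_subset _ _)
  have hdiag : ∀ e ∈ contracted E keep, ¬ (e.map L).IsDiag := fun e he =>
    h.not_isDiag_map hEG hE'E hL hits (by rw [← coe_contracted]; exact he)
  have hinj : Set.InjOn (Sym2.map L) (contracted E keep) := by
    rw [coe_contracted]
    exact h.injOn_map hEG hE'E hL hits
  have hm := Nat.le_of_lt_succ (numContracted E keep).2
  have hcard : (labelGraph L (contracted E keep)).edgeSet.ncard = numContracted E keep := by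
    have h1 : (labelGraph L (contracted E keep)).edgeSet =
        Sym2.map L '' (contracted E keep : Set (Sym2 (Fin n))) := by
      rw [labelGraph, SimpleGraph.edgeSet_fromEdgeSet, sdiff_eq_left, Set.disjoint_left]
      rintro _ ⟨e, he, rfl⟩
      exact hdiag e he
    rw [h1, hinj.ncard_image, Set.ncard_coe_finset, val_numContracted hEn]
  have hdiam : DiameterAtMost (labelGraph L (contracted E keep)) D := by
    intro x y hxy
    rw [coe_contracted] at hxy ⊢
    exact h.dist_labelGraph_le hEG (Finset.filter_subset _ _) hL hwin x y hxy
  have key := hA _ hm _ hcard hdiam _ (isEdgeDistribution_simInput hs hEn hdiag hinj)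
  rw [MPCAlgorithm.successProb_eq_pr] at key
  have h2 := pr_not (fun sd : (P.A (numContracted E keep)).Seed =>
    (P.A (numContracted E keep)).RespectsBandwidth (P.simInput E L keep) sd P.T ∧
      IdentifiesComponents (labelGraph L (contracted E keep)) (P.SA (numContracted E keep))
        ((P.A (numContracted E keep)).outputs (P.simInput E L keep) sd P.T))
  refine le_trans ?_ (le_trans (pr_pi_eval_le (X := fun m : Fin (n + 1) => (P.A m).Seed)
    (numContracted E keep) (fun sd => ¬ ((P.A (numContracted E keep)).RespectsBandwidth
      (P.simInput E L keep) sd P.T ∧ IdentifiesComponents (labelGraph L (contracted E keep))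
        (P.SA (numContracted E keep))
        ((P.A (numContracted E keep)).outputs (P.simInput E L keep) sd P.T)))) (by linarith))
  exact pr_mono fun sd hsd hh => hsd ⟨hh.1, hh.2⟩

/-- The random choices of the algorithm: the hash values and the seeds for all phases. -/
abbrev Seeds (P : Setup n N M) (K q : ℕ) : Type :=
  (Fin K → Sym2 (Fin n) → Fin q) × (Fin K → ∀ m : Fin (n + 1), (P.A m).Seed)

/-- The probability that some phase fails. In the first phase that fails, the graph on the labels
depends on the hash values and the seeds of previous phases only, and not on the seed of this
phase. -/
theorem pr_not_ok_le (h : IsCycleCover G σ) (hs : P.Fits s) {D K q : ℕ} [NeZero q] {δ : ℝ}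
    (hδ : 0 ≤ δ) (hA : P.Succeeds D δ) {L : Fin n → Fin N} (hL : Function.Injective L) :
    pr (fun ω : P.Seeds K q => ¬ (GoodHashes G σ D s ω.1 ∧
      ∀ j < K, P.OkAt (edges G) L (keepsOf ω.1) (extSeeds ω.2) j)) ≤
      pr (fun h : Fin K → Sym2 (Fin n) → Fin q => ¬ GoodHashes G σ D s h) + K * δ := by
  classical
  refine le_trans (pr_mono (Q := fun ω : P.Seeds K q => ¬ GoodHashes G σ D s ω.1 ∨
    ∃ j ∈ (Finset.univ : Finset (Fin K)), GoodHashes G σ D s ω.1 ∧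
      (∀ i < (j : ℕ), P.OkAt (edges G) L (keepsOf ω.1) (extSeeds ω.2) i) ∧
      ¬ P.OkAt (edges G) L (keepsOf ω.1) (extSeeds ω.2) j) ?_)
    ((pr_or_le _ _).trans (add_le_add ?_ ((pr_exists_le _ _).trans
      ((Finset.sum_le_card_nsmul _ _ δ ?_).trans (by simp)))))
  · intro ω hω
    by_cases hg : GoodHashes G σ D s ω.1
    · right
      have hex : ∃ j, j < K ∧ ¬ P.OkAt (edges G) L (keepsOf ω.1) (extSeeds ω.2) j := by
        by_contra hcon
        push Not at hcon
        exact hω ⟨hg, hcon⟩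
      refine ⟨⟨Nat.find hex, (Nat.find_spec hex).1⟩, Finset.mem_univ _, hg, fun i hi => ?_,
        (Nat.find_spec hex).2⟩
      have := Nat.find_min hex hi
      by_contra hcon
      exact this ⟨hi.trans (Nat.find_spec hex).1, hcon⟩
    · exact Or.inl hg
  · exact pr_prod_le_of_fst (pr_nonneg _) fun y => le_rfl
  · intro j _
    refine pr_prod_le_of_snd hδ fun g => pr_pi_le hδ j fun sds => ?_
    have hupd := fun x => extSeeds_update sds j x
    have hlab : ∀ x, ∀ i ≤ (j : ℕ), P.labelsAt (edges G) L (keepsOf g)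
        (extSeeds (Function.update sds j x)) i =
        P.labelsAt (edges G) L (keepsOf g) (extSeeds sds) i := fun x i hi =>
      labelsAt_congr fun i' hi' => (hupd x).2 i' (by omega)
    have hokat : ∀ x, ∀ i < (j : ℕ),
        (P.OkAt (edges G) L (keepsOf g) (extSeeds (Function.update sds j x)) i ↔
          P.OkAt (edges G) L (keepsOf g) (extSeeds sds) i) := by
      intro x i hi
      unfold OkAt
      rw [hlab x i hi.le, (hupd x).2 i hi]
    by_cases hgood : GoodHashes G σ D s g ∧
        ∀ i < (j : ℕ), P.OkAt (edges G) L (keepsOf g) (extSeeds sds) i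
    · refine le_trans (pr_mono fun x hx => ?_) (pr_not_phaseOk_le h hs hA (keep := keepsOf g j)
        (edgesAt_anti (keeps := keepsOf g) (Nat.zero_le j))
        ((Finset.card_le_card (edgesAt_anti (Nat.zero_le j))).trans (card_edges_le h))
        (labelsAt_eq_iff hL hgood.2) (fun v => ?_) (hgood.1.window j j.2))
      · have h3 := hx.2.2
        unfold OkAt at h3
        rw [hlab x j le_rfl, (hupd x).1] at h3
        exact h3
      · obtain ⟨w, hw⟩ := hgood.1.hits v
        exact ⟨w, edgesAt_anti (Nat.succ_le_of_lt j.2) hw⟩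
    · refine (pr_mono (Q := fun _ => False) fun x hx => hgood ⟨hx.1, fun i hi => ?_⟩).trans ?_
      · exact (hokat x i hi).1 (hx.2.1 i hi)
      · rw [pr_false]
        exact hδ

/-! ### The number of states -/

theorem add_one_le_pow_succ {n a b : ℕ} (hn : 2 ≤ n) (hab : a ≤ n ^ b) : a + 1 ≤ n ^ (b + 1) := by
  have h1 : 1 ≤ n ^ b := Nat.one_le_pow _ _ (by omega)
  calc a + 1 ≤ n ^ b * 2 := by omega
    _ ≤ n ^ b * n := Nat.mul_le_mul_left _ hn
    _ = n ^ (b + 1) := (pow_succ _ _).symm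

theorem ncard_okMsg_le (N R : ℕ) :
    (okMsg N R).Finite ∧ (okMsg N R).ncard ≤ (R + 1) * ((R + 1) * (N * N)) := by
  have hsub : okMsg N R = ((Finset.range (R + 1) ×ˢ (Finset.range (R + 1) ×ˢ
      (Finset.univ : Finset (Fin N × Fin N))) : Finset (Msg N)) : Set (Msg N)) := by
    ext r
    simp [okMsg]
  rw [hsub]
  refine ⟨Finset.finite_toSet _, ?_⟩
  rw [Set.ncard_coe_finset]
  simp

theorem ncard_okMsg_le_pow {R : ℕ} (hn : 2 ≤ n) (hNn : N ≤ n ^ 2) (hR : R ≤ n ^ 2) :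
    (okMsg N R).Finite ∧ (okMsg N R).ncard ≤ n ^ 10 := by
  obtain ⟨h1, h2⟩ := ncard_okMsg_le N R
  refine ⟨h1, h2.trans ?_⟩
  have h3 : R + 1 ≤ n ^ 3 := add_one_le_pow_succ hn hR
  calc _ ≤ n ^ 3 * (n ^ 3 * (n ^ 2 * n ^ 2)) :=
        Nat.mul_le_mul h3 (Nat.mul_le_mul h3 (Nat.mul_le_mul hNn hNn))
    _ = n ^ 10 := by simp only [← pow_add]

variable [NeZero N]

instance (P : Setup n N M) : Nonempty (St P) := ⟨⟨∅, 0, ⟨0, fun _ _ => 0⟩, ∅, false⟩⟩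

theorem ncard_okState_le (hs : P.Fits s) (I : Fin M) :
    (P.okState s I).Finite ∧ (P.okState s I).ncard ≤
      (Fintype.card (EdgeRec n N) + 1) ^ s * ((n + 1) * (((n + 1) * N ^ s) *
        ((Fintype.card (Fin M × Fin N × Fin N) + 1) ^ (2 * s) * 2))) := by
  classical
  let Fm : Finset (Σ m : Fin (n + 1), Fin (P.MA m) → MPCMemory N (P.SA m)) :=
    Finset.univ.sigma fun m => Fintype.piFinset fun i =>
      if P.blk m i = I then Finset.univ else {fun _ => 0}
  have hFm : Fm.card ≤ (n + 1) * N ^ s := by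
    rw [Finset.card_sigma]
    refine (Finset.sum_le_card_nsmul _ _ (N ^ s) fun m _ => ?_).trans (by simp)
    rw [Fintype.card_piFinset]
    have h1 : ∀ i : Fin (P.MA m),
        (if P.blk m i = I then (Finset.univ : Finset (MPCMemory N (P.SA m))) else
          {fun _ => 0}).card = if P.blk m i = I then N ^ P.SA m else 1 := by
      intro i
      split_ifs <;> simp
    simp only [h1]
    rw [Finset.prod_ite, Finset.prod_const, Finset.prod_const_one, mul_one, ← pow_mul, mul_comm]
    exact Nat.pow_le_pow_right (NeZero.pos N) (hs.blk m (Nat.le_of_lt_succ m.2) I)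
  let U : Set (Finset (EdgeRec n N) × ℕ × (Σ m : Fin (n + 1), Fin (P.MA m) → MPCMemory N (P.SA m)) ×
      Finset (Fin M × Fin N × Fin N) × Bool) :=
    {F | F.card ≤ s} ×ˢ ((Finset.range (n + 1) : Finset ℕ) : Set ℕ) ×ˢ (Fm : Set _) ×ˢ
      {F | F.card ≤ 2 * s} ×ˢ (Set.univ : Set Bool)
  have hU : U.Finite := (Set.toFinite _).prod ((Finset.finite_toSet _).prod
    ((Finset.finite_toSet _).prod ((Set.toFinite _).prod (Set.toFinite _))))
  let f : St P → _ := fun x => (x.recs, x.off, x.mem, x.ans, x.fin)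
  have hf : Function.Injective f := by
    intro x y hxy
    simp only [f, Prod.mk.injEq] at hxy
    exact St.ext hxy.1 hxy.2.1 hxy.2.2.1 hxy.2.2.2.1 hxy.2.2.2.2
  have hmaps : ∀ x ∈ P.okState s I, f x ∈ U := by
    rintro x ⟨h1, h2, h3, h4⟩
    refine ⟨h1, by simpa [f, Nat.lt_succ_iff] using h2, ?_, h4, Set.mem_univ _⟩
    simp only [f, Fm, Finset.mem_coe, Finset.mem_sigma, Finset.mem_univ, true_and,
      Fintype.mem_piFinset]
    intro i
    split_ifs with hi
    · exact Finset.mem_univ _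
    · exact Finset.mem_singleton.2 (h3 i hi)
  refine ⟨Set.Finite.of_injOn hmaps hf.injOn hU, ?_⟩
  refine (Set.ncard_le_ncard_of_injOn f hmaps hf.injOn hU).trans ?_
  simp only [U, Set.ncard_prod, Set.ncard_coe_finset, Finset.card_range, Set.ncard_univ,
    Nat.card_eq_fintype_card, Fintype.card_bool]
  gcongr
  · exact ncard_finset_le s
  · exact ncard_finset_le (2 * s)

theorem ncard_okState_le_pow (hn : 2 ≤ n) (hNn : N ≤ n ^ 2) (hs : P.Fits s) (hs0 : 0 < s)
    (hsn : s ≤ n) (I : Fin M) :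
    (P.okState s I).Finite ∧ (P.okState s I).ncard ≤ n ^ (26 * s) := by
  obtain ⟨h1, h2⟩ := ncard_okState_le hs I
  refine ⟨h1, h2.trans ?_⟩
  have hn0 : 0 < n := by omega
  have hMn : M ≤ n := hs.machines.trans hsn
  have hN4 : N * N ≤ n ^ 2 * n ^ 2 := Nat.mul_le_mul hNn hNn
  have hpow2 : n + 1 ≤ n ^ 2 := by nlinarith
  have e1 : Fintype.card (EdgeRec n N) + 1 ≤ n ^ 7 := by
    refine add_one_le_pow_succ hn ?_
    rw [Fintype.card_prod, Fintype.card_prod, Sym2.card, Fintype.card_fin, Fintype.card_fin,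
      Nat.choose_two_right]
    have h3 : (n + 1) * (n + 1 - 1) / 2 ≤ n ^ 2 := by
      have h4 : (n + 1) * (n + 1 - 1) / 2 * 2 ≤ (n + 1) * (n + 1 - 1) := Nat.div_mul_le_self _ _
      simp only [Nat.add_sub_cancel] at *
      nlinarith
    calc _ ≤ n ^ 2 * (n ^ 2 * n ^ 2) := Nat.mul_le_mul h3 hN4
      _ = n ^ 6 := by rw [← pow_add, ← pow_add]
  have e2 : Fintype.card (Fin M × Fin N × Fin N) + 1 ≤ n ^ 6 := by
    refine add_one_le_pow_succ hn ?_
    rw [Fintype.card_prod, Fintype.card_prod, Fintype.card_fin, Fintype.card_fin]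
    calc _ ≤ n * (n ^ 2 * n ^ 2) := Nat.mul_le_mul hMn hN4
      _ = n ^ 5 := by rw [← pow_add, ← pow_succ']
  have e3 : N ^ s ≤ (n ^ 2) ^ s := Nat.pow_le_pow_left hNn s
  have e4 : (Fintype.card (EdgeRec n N) + 1) ^ s ≤ (n ^ 7) ^ s := Nat.pow_le_pow_left e1 s
  have e5 : (Fintype.card (Fin M × Fin N × Fin N) + 1) ^ (2 * s) ≤ (n ^ 6) ^ (2 * s) :=
    Nat.pow_le_pow_left e2 _
  refine (Nat.mul_le_mul e4 (Nat.mul_le_mul hpow2 (Nat.mul_le_mul (Nat.mul_le_mul hpow2 e3)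
    (Nat.mul_le_mul e5 hn)))).trans ?_
  have e6 : (n ^ 7) ^ s * (n ^ 2 * (n ^ 2 * (n ^ 2) ^ s * ((n ^ 6) ^ (2 * s) * n))) =
      n ^ (21 * s + 5) := by
    simp only [← pow_mul, ← pow_add, ← pow_succ]
    congr 1
    ring
  rw [e6]
  exact Nat.pow_le_pow_right hn0 (by omega)

/-! ### The reduction for a fixed number of vertices -/

/-- An algorithm that identifies the components of graphs of small diameter on `N` vertices can be
used to distinguish one cycle on `n` vertices from two cycles. -/
theorem exists_cycle_algorithm {n N M : ℕ} [NeZero N] (P : Setup n N M) {s R D K q : ℕ} [NeZero q]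
    {δ : ℝ} (hn : 6 ≤ n) (hnN : n ≤ N) (hNn : N ≤ n ^ 2) (hs : P.Fits s) (hs0 : 0 < s) (hsn : s ≤ n)
    (hRn : n ≤ R) (hRn2 : R ≤ n ^ 2) (hRM : ∀ m ≤ n, 0 < P.SA m → P.MA m ≤ R)
    (hown : ∀ G σ, IsCycleCover G σ → ∀ k, ((edges G).filter fun e => P.ownE e = k).card ≤ s)
    (hδ : 0 ≤ δ) (hA : P.Succeeds D δ) :
    ∃ B : MPCAlgorithm n M (117 * s) Bool, ∀ G : SimpleGraph (Fin n), IsOneCycle G ∨ IsTwoCycles G →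
      ∀ inp : Fin M → Finset (Sym2 (Fin n)), IsEdgeDistribution G (117 * s) inp →
      1 - 3 * ((K * (n * (1 - 1 / (q : ℝ)) ^ D) + n * (1 - 1 / (q : ℝ) ^ K) ^ (n / 2) +
        (1 + 1 / (q : ℝ) ^ K) ^ n / 2 ^ s) + K * δ) ^ 2 ≤
        B.successProb inp (3 * (K * (P.T + 4) + 2) + 1) (DistinguishesCycles G) := by
  classical
  have : NeZero n := ⟨by omega⟩
  have hn0 : 0 < n := by omega
  let L : Fin n → Fin N := Fin.castLE hnN
  have hL : Function.Injective L := Fin.castLE_injective hnN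
  have hcardX := ncard_okState_le_pow (P := P) (by omega) hNn hs hs0 hsn
  have hcardα := ncard_okMsg_le_pow (n := n) (N := N) (by omega) hNn hRn2
  have hB : 3 * s + 1 ≤ n ^ 10 := by
    calc 3 * s + 1 ≤ n ^ 2 := by nlinarith
      _ ≤ n ^ 10 := Nat.pow_le_pow_right hn0 (by omega)
  obtain ⟨B, hBspec⟩ := exists_amplified (S := 117 * s) (B := 3 * s) (a := 26 * s) (w := 10)
    (fun ω : P.Seeds K q => P.steps K (keepsOf ω.1) (extSeeds ω.2))
    (fun _ E => P.initState L E) (fun x => x.fin) P.ownE (P.okState s) (okMsg N R) (by omega)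
    hcardX hcardα hB (hs.machines.trans (by omega)) (by have := hs.machines; omega) (by omega)
    (K * (P.T + 4) + 2)
  refine ⟨B, fun G hG inp hinp => ?_⟩
  obtain ⟨σ, hσ, hlarge⟩ := exists_isCycleCover hn hG
  have howned : ∀ k, ownedEdges G P.ownE k = (edges G).filter fun e => P.ownE e = k := by
    intro k; ext e; simp [ownedEdges, mem_edges]
  have hp := (pr_not_ok_le (K := K) (q := q) hσ hs hδ hA hL).trans
    (add_le_add_left (pr_not_goodHashes_le (K := K) (q := q) hσ hlarge D s) _)
  have hsucc := hBspec G (fun k => by rw [howned]; have := hown G σ hσ k; omega) inp hinp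
    (decide G.Preconnected)
  refine (hsucc _ (le_trans ?_ hp)).trans ?_
  · refine pr_mono fun ω hω hgood => hω ?_
    obtain ⟨g1, g2, g3⟩ := run_steps hσ hs hRn (by omega) hRM (hown G σ hσ) hL hgood.1.hits
      hgood.1.card hgood.2
    refine ⟨g1, fun t ht => (g2 t ht).1, fun t ht => (g2 t ht).2, fun i => ?_⟩
    rw [Bool.eq_iff_iff, decide_eq_true_iff]
    exact g3 i
  · rw [MPCAlgorithm.successProb_eq_pr, MPCAlgorithm.successProb_eq_pr]
    refine pr_mono fun ω hω => ⟨hω.1, fun h1 i => ?_, fun h2 i => ?_⟩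
    · rw [hω.2 i]
      exact decide_eq_true h1.preconnected
    · rw [hω.2 i]
      exact decide_eq_false (h2.not_preconnected (by omega))

end Setup

/-! ### Placing the simulated algorithm on the machines -/

/-- At most `M * b` objects can be distributed among `M` machines such that each machine has at most
`b` of them. -/
theorem exists_balanced_map {α : Type*} [Fintype α] {M b : ℕ} (h : Fintype.card α ≤ M * b) :
    ∃ f : α → Fin M, ∀ I, (Finset.univ.filter fun x => f x = I).card ≤ b := by
  obtain ⟨e⟩ := Function.Embedding.nonempty_of_card_le (α := α) (β := Fin M × Fin b)
    (by simpa using h)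
  refine ⟨fun x => (e x).1, fun I => ?_⟩
  have := Finset.card_le_card_of_injOn (s := Finset.univ.filter fun x => (e x).1 = I)
    (t := (Finset.univ : Finset (Fin b))) (fun x => (e x).2)
    (fun _ _ => Finset.mem_coe.2 (Finset.mem_univ _))
    fun x hx y hy hxy => by
      simp only [Finset.coe_filter, Finset.mem_univ, true_and, Set.mem_ofPred_eq] at hx hy
      exact e.injective (Prod.ext (hx.trans hy.symm) hxy)
  simpa using this

namespace Setup

/-- If `M` machines with `s` words have at least twice the space of each simulated algorithm, and
`s` is at least the number of words of each simulated machine, then the parts of the contraction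
algorithm fit on the machines. -/
theorem exists_fits {n N M s R D : ℕ} {δ : ℝ} (hn : 0 < n) (hN : N ≤ 2 * n) (hMs : M ≤ s)
    (hs : 2 ≤ s) (hnR : 2 * n ≤ R) (hR : 2 * R ≤ M * s) (MA SA : ℕ → ℕ) (T : ℕ)
    (A : ∀ m, MPCAlgorithm N (MA m) (SA m) (Fin N → Option (Fin N)))
    (hSA : ∀ m ≤ n, SA m ≤ s) (hMSA : ∀ m ≤ n, MA m * SA m ≤ R)
    (hin : ∀ m ≤ n, m ≤ MA m * (SA m / 2))
    (hA : ∀ m ≤ n, ∀ H : SimpleGraph (Fin N), H.edgeSet.ncard = m → DiameterAtMost H D →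
      ∀ inp : Fin (MA m) → Finset (Sym2 (Fin N)), IsEdgeDistribution H (SA m) inp →
        1 - δ ≤ (A m).successProb inp T (IdentifiesComponents H (SA m))) :
    ∃ P : Setup n N M, P.T = T ∧ P.Fits s ∧ P.Succeeds D δ ∧
      (∀ m ≤ n, 0 < P.SA m → P.MA m ≤ R) ∧
      ∀ G σ, IsCycleCover G σ → ∀ k, ((edges G).filter fun e => P.ownE e = k).card ≤ s := by
  have hM : 0 < M := Nat.pos_of_ne_zero fun h => by subst h; omega
  have hnM : n ≤ M * (s / 2) := by
    have h1 : s ≤ 3 * (s / 2) := by omega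
    have h2 := Nat.mul_le_mul_left M h1
    have h3 : M * (3 * (s / 2)) = 3 * (M * (s / 2)) := by ring
    omega
  obtain ⟨own, hown⟩ := exists_balanced_map (α := Fin N) (M := M) (b := s) (by
    rw [Fintype.card_fin]; omega)
  obtain ⟨ownV, hownV⟩ := exists_balanced_map (α := Fin n) (M := M) (b := s / 2)
    (by simpa using hnM)
  -- only the algorithms for at most `n` edges are used
  have hslot : ∀ m, ∃ f : Fin m → Fin (MA (min m n)),
      m ≤ n → ∀ i, (Finset.univ.filter fun r => f r = i).card ≤ SA (min m n) / 2 := by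
    intro m
    by_cases hm : m ≤ n
    · obtain ⟨f, hf⟩ := exists_balanced_map (α := Fin m) (M := MA (min m n)) (b := SA (min m n) / 2)
        (by rw [Fintype.card_fin, min_eq_left hm]; exact hin m hm)
      exact ⟨f, fun _ => hf⟩
    · have h1 : 0 < MA (min m n) := by
        rw [min_eq_right (by omega)]
        refine Nat.pos_of_ne_zero fun h => ?_
        have := hin n le_rfl
        rw [h] at this
        omega
      exact ⟨fun _ => ⟨0, h1⟩, fun h => absurd h hm⟩
  have hblk : ∀ m, ∃ f : Fin (MA (min m n)) → Fin M,
      ∀ I, (Finset.univ.filter fun i => f i = I).card * SA (min m n) ≤ s := by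
    intro m
    have hm := min_le_right m n
    generalize min m n = m' at *
    rcases Nat.eq_zero_or_pos (SA m') with h0 | h0
    · exact ⟨fun _ => ⟨0, hM⟩, fun I => by simp [h0]⟩
    · obtain ⟨f, hf⟩ := exists_balanced_map (α := Fin (MA m')) (M := M) (b := s / SA m') (by
        rw [Fintype.card_fin]
        have h1 : s ≤ 2 * (s / SA m' * SA m') := by
          have h2 := Nat.div_add_mod s (SA m')
          have h3 := Nat.mod_lt s h0
          have h4 : 1 ≤ s / SA m' := (Nat.one_le_div_iff h0).2 (hSA m' hm)
          have h5 := Nat.mul_le_mul_right (SA m') h4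
          rw [mul_comm] at h2
          omega
        have h2 := Nat.mul_le_mul_left M h1
        have h3 := hMSA m' hm
        refine Nat.le_of_mul_le_mul_right (c := SA m') ?_ h0
        have h4 : M * (2 * (s / SA m' * SA m')) = 2 * (M * (s / SA m') * SA m') := by ring
        omega)
      exact ⟨f, fun I => (Nat.mul_le_mul_right _ (hf I)).trans (Nat.div_mul_le_self _ _)⟩
  choose slot hslot using hslot
  choose blk hblk using hblk
  refine ⟨{ MA := fun m => MA (min m n), SA := fun m => SA (min m n), A := fun m => A (min m n),
            T := T, blk := blk, slot := slot, own := own, ownE := fun e => ownV e.inf,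
            root := ⟨0, hM⟩ }, rfl,
          ⟨hMs, fun m _ I => hblk m I, fun m hm i => ?_, hown⟩, ?_, ?_, ?_⟩
  · exact (Nat.mul_le_mul_left 2 (hslot m hm i)).trans (Nat.mul_div_le _ _)
  · intro m hm
    change ∀ H : SimpleGraph (Fin N), H.edgeSet.ncard = m → DiameterAtMost H D →
      ∀ inp : Fin (MA (min m n)) → Finset (Sym2 (Fin N)), IsEdgeDistribution H (SA (min m n)) inp →
        1 - δ ≤ (A (min m n)).successProb inp T (IdentifiesComponents H (SA (min m n)))
    rw [min_eq_left hm]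
    exact hA m hm
  · intro m _ h0
    change 0 < SA (min m n) at h0
    exact (Nat.le_mul_of_pos_right _ h0).trans (hMSA _ (min_le_right m n))
  · intro G σ h k
    -- an edge is `s(v, σ v)` for some `v`, and its smaller endpoint is `v` or `σ v`
    have hsub : (edges G).filter (fun e => ownV e.inf = k) ⊆
        (Finset.univ.filter fun v => ownV v = k).image (fun v => s(v, σ v)) ∪
        (Finset.univ.filter fun v => ownV v = k).image (fun v => s(σ⁻¹ v, v)) := by
      intro e he
      obtain ⟨he, hk⟩ := Finset.mem_filter.1 he
      obtain ⟨v, rfl⟩ := h.exists_eq_of_mem_edgeSet (mem_edges.1 he)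
      rw [Finset.mem_union, Finset.mem_image, Finset.mem_image]
      rcases le_total v (σ v) with hv | hv
      · left
        exact ⟨v, by simpa [hv] using hk, rfl⟩
      · right
        exact ⟨σ v, by simpa [hv] using hk, by simp⟩
    have h1 := (Finset.card_le_card hsub).trans ((Finset.card_union_le _ _).trans
      (Nat.add_le_add Finset.card_image_le Finset.card_image_le))
    have h2 := hownV k
    change ((edges G).filter fun e => ownV e.inf = k).card ≤ s
    omega

end Setup

/-! ### The choice of the parameters -/

theorem one_sub_pow_le_exp {x : ℝ} (hx1 : x ≤ 1) (k : ℕ) :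
    (1 - x) ^ k ≤ Real.exp (-(k * x)) := by
  rw [show -(k * x) = k * (-x) by ring, Real.exp_nat_mul]
  exact pow_le_pow_left₀ (by linarith) (Real.one_sub_le_exp_neg x) k

/-- The bound on the probability of failure of one copy of the contraction algorithm. -/
theorem failure_le {n D q K s : ℕ} {c δ : ℝ} (hn : 0 < n) (hq : 2 ≤ q)
    (h1 : (c + 1) * Real.log n ≤ D / q)
    (h2 : (c + 1) * Real.log n ≤ (n / 2 : ℕ) / (q : ℝ) ^ K)
    (h3 : n / (q : ℝ) ^ K + c * Real.log n ≤ s * Real.log 2)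
    (hδ : δ ≤ (n : ℝ) ^ (-c)) :
    (K * (n * (1 - 1 / (q : ℝ)) ^ D) + n * (1 - 1 / (q : ℝ) ^ K) ^ (n / 2) +
      (1 + 1 / (q : ℝ) ^ K) ^ n / 2 ^ s) + K * δ ≤ 2 * (K + 1) * (n : ℝ) ^ (-c) := by
  have hn' : (0 : ℝ) < n := Nat.cast_pos.2 hn
  have hq1 : (1 : ℝ) ≤ q := by exact_mod_cast (by omega : 1 ≤ q)
  have hQ : (1 : ℝ) ≤ (q : ℝ) ^ K := one_le_pow₀ hq1
  have key : ∀ x : ℝ, (c + 1) * Real.log n ≤ x → n * Real.exp (-x) ≤ (n : ℝ) ^ (-c) := by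
    intro x hx
    rw [Real.rpow_def_of_pos hn']
    nth_rw 1 [← Real.exp_log hn']
    rw [← Real.exp_add]
    exact Real.exp_le_exp.2 (by linarith)
  have e1 : (n : ℝ) * (1 - 1 / (q : ℝ)) ^ D ≤ (n : ℝ) ^ (-c) := by
    refine le_trans (mul_le_mul_of_nonneg_left (one_sub_pow_le_exp ?_ D) hn'.le) (key _ ?_)
    · exact (div_le_one (by linarith)).2 hq1
    · rwa [mul_one_div]
  have e2 : (n : ℝ) * (1 - 1 / (q : ℝ) ^ K) ^ (n / 2) ≤ (n : ℝ) ^ (-c) := by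
    refine le_trans (mul_le_mul_of_nonneg_left (one_sub_pow_le_exp ?_ (n / 2)) hn'.le) (key _ ?_)
    · exact (div_le_one (by linarith)).2 hQ
    · rwa [mul_one_div]
  have e3 : (1 + 1 / (q : ℝ) ^ K) ^ n / 2 ^ s ≤ (n : ℝ) ^ (-c) := by
    rw [div_le_iff₀ (by positivity), Real.rpow_def_of_pos hn']
    have h4 : (2 : ℝ) ^ s = Real.exp (s * Real.log 2) := by
      rw [Real.exp_nat_mul, Real.exp_log two_pos]
    rw [h4, ← Real.exp_add]
    have h5 : (1 + 1 / (q : ℝ) ^ K) ^ n ≤ Real.exp (n * (1 / (q : ℝ) ^ K)) := by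
      rw [Real.exp_nat_mul]
      refine pow_le_pow_left₀ (by positivity) ?_ n
      rw [add_comm]
      exact Real.add_one_le_exp _
    refine h5.trans (Real.exp_le_exp.2 ?_)
    rw [mul_one_div]
    linarith
  have hK : (0 : ℝ) ≤ K := Nat.cast_nonneg K
  have e4 := mul_le_mul_of_nonneg_left e1 hK
  have e5 := mul_le_mul_of_nonneg_left hδ hK
  linarith

/-- A majority vote among three copies makes up for the factor `K` in the probability of failure. -/
theorem three_mul_sq_le {n K : ℕ} {c p : ℝ} (hn : 0 < n) (hK : (K : ℝ) ≤ Real.log n)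
    (hc : 12 * (Real.log n + 1) ^ 2 ≤ (n : ℝ) ^ c) (hp0 : 0 ≤ p)
    (hp : p ≤ 2 * (K + 1) * (n : ℝ) ^ (-c)) : 3 * p ^ 2 ≤ (n : ℝ) ^ (-c) := by
  have hn' : (0 : ℝ) < n := Nat.cast_pos.2 hn
  have hpos := Real.rpow_pos_of_pos hn' (-c)
  have h1 : (n : ℝ) ^ c * (n : ℝ) ^ (-c) = 1 := by
    rw [← Real.rpow_add hn']; simp
  have hK0 : (0 : ℝ) ≤ K := Nat.cast_nonneg K
  have h2 : p ≤ 2 * (Real.log n + 1) * (n : ℝ) ^ (-c) := hp.trans (by gcongr)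
  calc 3 * p ^ 2 ≤ 3 * (2 * (Real.log n + 1) * (n : ℝ) ^ (-c)) ^ 2 := by gcongr
    _ = 12 * (Real.log n + 1) ^ 2 * (n : ℝ) ^ (-c) * (n : ℝ) ^ (-c) := by ring
    _ ≤ (n : ℝ) ^ c * (n : ℝ) ^ (-c) * (n : ℝ) ^ (-c) := by gcongr
    _ = (n : ℝ) ^ (-c) := by rw [h1, one_mul]

theorem tendsto_log_natCast : Tendsto (fun n : ℕ => Real.log n) atTop atTop :=
  Real.tendsto_log_atTop.comp tendsto_natCast_atTop_atTop

theorem eventually_mul_log_le_rpow (C : ℝ) {r : ℝ} (hr : 0 < r) :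
    ∀ᶠ n : ℕ in atTop, C * Real.log n ≤ (n : ℝ) ^ r := by
  have h := ((isLittleO_log_rpow_atTop hr).const_mul_left C).bound one_pos
  filter_upwards [tendsto_natCast_atTop_atTop.eventually h, eventually_gt_atTop 0] with n hn hn0
  rw [one_mul] at hn
  exact (le_abs_self _).trans (hn.trans_eq (abs_of_nonneg (by positivity)))

theorem eventually_const_mul_rpow_le (C : ℝ) {r t : ℝ} (h : r < t) :
    ∀ᶠ n : ℕ in atTop, C * (n : ℝ) ^ r ≤ (n : ℝ) ^ t := by
  have h1 : Tendsto (fun n : ℕ => (n : ℝ) ^ (t - r)) atTop atTop :=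
    (tendsto_rpow_atTop (by linarith)).comp tendsto_natCast_atTop_atTop
  filter_upwards [h1.eventually_ge_atTop C, eventually_gt_atTop 0] with n hn hn0
  have hn' : (0 : ℝ) < n := Nat.cast_pos.2 hn0
  calc C * (n : ℝ) ^ r ≤ (n : ℝ) ^ (t - r) * (n : ℝ) ^ r := by gcongr
    _ = (n : ℝ) ^ t := by rw [← Real.rpow_add hn']; congr 1; ring

theorem eventually_log_sq_le_rpow {c : ℝ} (hc : 0 < c) :
    ∀ᶠ n : ℕ in atTop, 12 * (Real.log n + 1) ^ 2 ≤ (n : ℝ) ^ c := by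
  filter_upwards [eventually_mul_log_le_rpow 8 (half_pos hc),
    tendsto_log_natCast.eventually_ge_atTop 1] with n h1 h2
  have h3 : (n : ℝ) ^ c = ((n : ℝ) ^ (c / 2)) ^ 2 := by
    rw [← Real.rpow_natCast, ← Real.rpow_mul (Nat.cast_nonneg n)]
    congr 1; push_cast; ring
  rw [h3]
  have h4 : (8 * Real.log n) ^ 2 ≤ ((n : ℝ) ^ (c / 2)) ^ 2 := by gcongr
  nlinarith

theorem eventually_log_add_one_le : ∀ᶠ n : ℕ in atTop, Real.log (n + 1) ≤ 6 / 5 * Real.log n := by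
  filter_upwards [eventually_const_mul_rpow_le 2 (by norm_num : (1 : ℝ) < 6 / 5),
    eventually_ge_atTop 1] with n hn hn1
  have hn' : (1 : ℝ) ≤ n := by exact_mod_cast hn1
  rw [← Real.log_rpow (by linarith)]
  refine Real.log_le_log (by linarith) (le_trans ?_ hn)
  rw [Real.rpow_one]
  linarith

/-- In every phase an edge is kept with probability `1 / q`, and there are `K` phases. If `q` is a
small power of `D`, a path of `D` edges with no edge kept is unlikely, while `O(log n / log D)`
phases suffice to make the number of edges polynomially smaller than `n`. -/
theorem exists_parameters (c : ℝ) {ρ : ℝ} (hρ0 : 0 < ρ) (hρ1 : ρ < 1) (D : ℕ → ℕ)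
    (hD : ∀ᶠ n : ℕ in atTop, Real.log n ^ (1 + ρ) ≤ (D n : ℝ))
    (hDn : ∀ᶠ n : ℕ in atTop, D n ≤ n + 1) (s : ℕ → ℕ)
    (hs : ∀ n : ℕ, (n : ℝ) ^ (9 / 10 : ℝ) ≤ s n) :
    ∃ q K : ℕ → ℕ, ∃ a : ℝ, 0 < a ∧ ∀ᶠ n : ℕ in atTop, 2 ≤ q n ∧ (K n : ℝ) ≤ Real.log n ∧
      K n * (a * Real.log (D n)) ≤ Real.log n ∧
      (c + 1) * Real.log n ≤ D n / q n ∧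
      (c + 1) * Real.log n ≤ (n / 2 : ℕ) / (q n : ℝ) ^ K n ∧
      n / (q n : ℝ) ^ K n + c * Real.log n ≤ s n * Real.log 2 := by
  refine ⟨fun n => ⌊(D n : ℝ) ^ (ρ / 4)⌋₊,
    fun n => ⌊Real.log n / (2 * Real.log ⌊(D n : ℝ) ^ (ρ / 4)⌋₊)⌋₊, ρ / 4, by positivity, ?_⟩
  have hlogρ : Tendsto (fun n : ℕ => Real.log n ^ (1 + ρ)) atTop atTop :=
    (tendsto_rpow_atTop (by linarith)).comp tendsto_log_natCast
  have hDt : Tendsto (fun n => (D n : ℝ)) atTop atTop := tendsto_atTop_mono' _ hD hlogρ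
  have hDr : Tendsto (fun n => (D n : ℝ) ^ (ρ / 8)) atTop atTop :=
    (tendsto_rpow_atTop (by linarith)).comp hDt
  have hlr : Tendsto (fun n : ℕ => Real.log n ^ (ρ / 2)) atTop atTop :=
    (tendsto_rpow_atTop (by linarith)).comp tendsto_log_natCast
  filter_upwards [hD, hDn, hDr.eventually_ge_atTop 3, hDt.eventually_ge_atTop 1,
    hlr.eventually_ge_atTop (c + 1), tendsto_log_natCast.eventually_ge_atTop 1,
    eventually_log_add_one_le, eventually_ge_atTop 2,
    eventually_mul_log_le_rpow (4 * (c + 1)) (by norm_num : (0 : ℝ) < 1 / 2),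
    eventually_mul_log_le_rpow (4 * c) (by norm_num : (0 : ℝ) < 9 / 10),
    eventually_const_mul_rpow_le 4 (by norm_num : (4 / 5 : ℝ) < 9 / 10)]
    with n h1 h2 h3 h4 h5 h6 h7 h8 h9 h10 h11
  set q := ⌊(D n : ℝ) ^ (ρ / 4)⌋₊ with hq
  have hn0 : (0 : ℝ) < n := by exact_mod_cast (by omega : 0 < n)
  have hD0 : (0 : ℝ) < D n := by linarith
  have hsq : (D n : ℝ) ^ (ρ / 4) = (D n : ℝ) ^ (ρ / 8) * (D n : ℝ) ^ (ρ / 8) := by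
    rw [← Real.rpow_add hD0]; congr 1; ring
  have hqle : (q : ℝ) ≤ (D n : ℝ) ^ (ρ / 4) := Nat.floor_le (by positivity)
  have hqge : (D n : ℝ) ^ (ρ / 8) ≤ q := by
    have := Nat.lt_floor_add_one ((D n : ℝ) ^ (ρ / 4))
    rw [← hq] at this
    nlinarith
  have hq2 : 2 ≤ q := by
    have : (2 : ℝ) ≤ q := by linarith
    exact_mod_cast this
  have hq0 : (0 : ℝ) < q := by linarith
  have hlq1 : Real.log q ≤ ρ / 4 * Real.log (D n) := by
    rw [← Real.log_rpow hD0]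
    exact Real.log_le_log hq0 hqle
  have hlq2 : ρ / 8 * Real.log (D n) ≤ Real.log q := by
    rw [← Real.log_rpow hD0]
    exact Real.log_le_log (by positivity) hqge
  have hlq3 : 1 ≤ 2 * Real.log q := by
    have h12 := Real.log_two_gt_d9
    have h13 : Real.log 2 ≤ Real.log q := Real.log_le_log two_pos (by exact_mod_cast hq2)
    linarith
  have hlD0 : 0 ≤ Real.log (D n) := Real.log_nonneg h4
  have hlD : Real.log (D n) ≤ 6 / 5 * Real.log n := by
    refine le_trans (Real.log_le_log hD0 ?_) h7
    exact_mod_cast h2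
  set K := ⌊Real.log n / (2 * Real.log q)⌋₊ with hK
  have hK1 : (K : ℝ) * (2 * Real.log q) ≤ Real.log n := by
    rw [← le_div_iff₀ (by linarith)]
    exact Nat.floor_le (div_nonneg (by linarith) (by linarith))
  have hK2 : Real.log n ≤ (K + 1) * (2 * Real.log q) := by
    rw [← div_le_iff₀ (by linarith)]
    exact (Nat.lt_floor_add_one _).le
  have hK0 : (0 : ℝ) ≤ K := Nat.cast_nonneg K
  have hQ : (q : ℝ) ^ K = Real.exp (K * Real.log q) := by
    rw [Real.exp_nat_mul, Real.exp_log hq0]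
  have hrp : ∀ r : ℝ, (n : ℝ) ^ r = Real.exp (r * Real.log n) := fun r => by
    rw [Real.rpow_def_of_pos hn0, mul_comm]
  have hQ1 : (q : ℝ) ^ K ≤ (n : ℝ) ^ (1 / 2 : ℝ) := by
    rw [hQ, hrp]
    exact Real.exp_le_exp.2 (by linarith)
  have hQ2 : (n : ℝ) ^ (1 / 5 : ℝ) ≤ (q : ℝ) ^ K := by
    rw [hQ, hrp]
    refine Real.exp_le_exp.2 ?_
    have h13 : ρ / 4 * Real.log (D n) ≤ 1 / 4 * Real.log (D n) := by gcongr
    nlinarith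
  have hQ0 : (0 : ℝ) < (q : ℝ) ^ K := by positivity
  refine ⟨hq2, ?_, ?_, ?_, ?_, ?_⟩
  · nlinarith
  · have := mul_le_mul_of_nonneg_left hlq2 hK0
    linarith
  · rw [le_div_iff₀ hq0]
    have e1 : (D n : ℝ) = (D n : ℝ) ^ (1 - ρ / 4) * (D n : ℝ) ^ (ρ / 4) := by
      rw [← Real.rpow_add hD0]; simp
    rw [e1]
    refine mul_le_mul ?_ hqle hq0.le (by positivity)
    have h0 : (0 : ℝ) < Real.log n := by linarith
    calc (c + 1) * Real.log n ≤ Real.log n ^ (ρ / 2) * Real.log n := by gcongr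
      _ = Real.log n ^ (1 + ρ / 2) := by rw [add_comm, Real.rpow_add h0, Real.rpow_one]
      _ ≤ Real.log n ^ ((1 + ρ) * (1 - ρ / 4)) :=
          Real.rpow_le_rpow_of_exponent_le h6 (by nlinarith)
      _ = (Real.log n ^ (1 + ρ)) ^ (1 - ρ / 4) := Real.rpow_mul h0.le _ _
      _ ≤ (D n : ℝ) ^ (1 - ρ / 4) := Real.rpow_le_rpow (by positivity) h1 (by linarith)
  · have e1 : (n : ℝ) / 4 ≤ (n / 2 : ℕ) := by
      have : n ≤ 4 * (n / 2) := by omega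
      have : (n : ℝ) ≤ 4 * (n / 2 : ℕ) := by exact_mod_cast this
      linarith
    refine le_trans ?_ (div_le_div_of_nonneg_right e1 hQ0.le)
    rw [le_div_iff₀ hQ0]
    have e2 : (n : ℝ) = (n : ℝ) ^ (1 / 2 : ℝ) * (n : ℝ) ^ (1 / 2 : ℝ) := by
      rw [← Real.rpow_add hn0]; norm_num
    calc (c + 1) * Real.log n * (q : ℝ) ^ K
        ≤ (n : ℝ) ^ (1 / 2 : ℝ) / 4 * (n : ℝ) ^ (1 / 2 : ℝ) :=
          mul_le_mul (by linarith) hQ1 hQ0.le (by positivity)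
      _ = n / 4 := by nth_rw 3 [e2]; ring
  · have e1 : (n : ℝ) / (q : ℝ) ^ K ≤ (n : ℝ) ^ (4 / 5 : ℝ) := by
      rw [div_le_iff₀ hQ0]
      have e2 : (n : ℝ) = (n : ℝ) ^ (4 / 5 : ℝ) * (n : ℝ) ^ (1 / 5 : ℝ) := by
        rw [← Real.rpow_add hn0]; norm_num
      calc (n : ℝ) = (n : ℝ) ^ (4 / 5 : ℝ) * (n : ℝ) ^ (1 / 5 : ℝ) := e2
        _ ≤ _ := by gcongr
    have e2 := Real.log_two_gt_d9
    have e3 := hs n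
    have e4 : (s n : ℝ) * (1 / 2) ≤ s n * Real.log 2 := by gcongr; linarith
    linarith

/-! ### The lower bound on the number of rounds -/

theorem nonempty_mpcAlgorithm {n M S : ℕ} (h : S = 0 ∨ 0 < n) :
    Nonempty (MPCAlgorithm n M S Bool) := by
  have h1 : Nonempty (MPCMemory n S) := by
    rcases h with rfl | h
    · exact ⟨Fin.elim0⟩
    · exact ⟨fun _ => ⟨0, h⟩⟩
  exact ⟨{ Seed := Unit
           load := fun _ _ _ => Classical.choice h1
           send := fun _ _ _ _ _ => []
           update := fun _ _ _ x _ => x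
           output := fun _ _ _ => true }⟩

/-- A lower bound on the number of rounds on graphs with `n + d` vertices for even `n`. -/
theorem TwoCycleConjecture.eventually_le_of_even {c : ℝ} (hconj : TwoCycleConjecture c) (hc : 1 < c)
    {ρ : ℝ} (hρ0 : 0 < ρ) (hρ1 : ρ < 1) (D' : ℕ → ℕ)
    (hD' : ∀ᶠ n : ℕ in atTop, Real.log n ^ (1 + ρ) ≤ (D' n : ℝ))
    (hD'n : ∀ᶠ n : ℕ in atTop, D' n ≤ n)
    (M S : ℕ → ℕ → ℕ) (T : ℕ → ℕ)
    (A : ∀ n m, MPCAlgorithm n (M n m) (S n m) (Fin n → Option (Fin n)))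
    (hspace : ∃ ε : ℝ, 0 < ε ∧ ∀ᶠ n : ℕ in atTop, ∀ m ≤ n.choose 2,
      (S n m : ℝ) ≤ (n : ℝ) ^ (1 - ε))
    (htotal : ∃ C : ℕ, ∀ᶠ n : ℕ in atTop, ∀ m ≤ n.choose 2, M n m * S n m ≤ C * (n + m))
    (hinput : ∀ᶠ n : ℕ in atTop, ∀ m ≤ n.choose 2, m ≤ M n m * (S n m / 2))
    (hcorrect : ∀ᶠ n : ℕ in atTop, ∀ m : ℕ,
      ∀ G : SimpleGraph (Fin n), G.edgeSet.ncard = m → DiameterAtMost G (D' n) →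
      ∀ inp : Fin (M n m) → Finset (Sym2 (Fin n)), IsEdgeDistribution G (S n m) inp →
        1 - (n : ℝ) ^ (-c) ≤
          (A n m).successProb inp (T n) (IdentifiesComponents G (S n m)))
    {d : ℕ} (hd : d ≤ 1) :
    ∃ κ : ℝ, 0 < κ ∧ ∀ᶠ n : ℕ in atTop, Even n → κ * Real.log (D' (n + d)) ≤ T (n + d) := by
  obtain ⟨ε₀, hε₀, hspace⟩ := hspace
  obtain ⟨C, htotal⟩ := htotal
  have shift := tendsto_add_atTop_nat d
  obtain ⟨γ, hγ0, hγ1, hγ2⟩ : ∃ γ : ℝ, 0 < γ ∧ γ ≤ 1 / 10 ∧ 2 * γ ≤ ε₀ :=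
    ⟨min (1 / 10) (ε₀ / 2), by positivity, min_le_left _ _,
      by linarith [min_le_right (1 / 10) (ε₀ / 2)]⟩
  -- up to constant factors, the new algorithm has `MB n` machines with `s n` words each, and `R n`
  -- bounds the total space of the simulated algorithms
  let s : ℕ → ℕ := fun n => ⌈(n : ℝ) ^ (1 - γ)⌉₊
  let R : ℕ → ℕ := fun n => (3 * C + 2) * n
  let MB : ℕ → ℕ := fun n => 2 * R n / s n + 1
  have hs_ge : ∀ n : ℕ, (n : ℝ) ^ (1 - γ) ≤ s n := fun n => Nat.le_ceil _
  have hs9 : ∀ n : ℕ, (n : ℝ) ^ (9 / 10 : ℝ) ≤ s n := by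
    intro n
    rcases Nat.eq_zero_or_pos n with rfl | hn
    · rw [Nat.cast_zero, Real.zero_rpow (by norm_num)]
      exact Nat.cast_nonneg _
    · exact (Real.rpow_le_rpow_of_exponent_le (by exact_mod_cast hn) (by linarith)).trans (hs_ge n)
  have hlog : ∀ᶠ n : ℕ in atTop, Real.log n ^ (1 + ρ) ≤ (D' (n + d) : ℝ) := by
    filter_upwards [shift.eventually hD', eventually_ge_atTop 1] with n hn hn1
    refine le_trans ?_ hn
    have h1 : (1 : ℝ) ≤ n := by exact_mod_cast hn1
    refine Real.rpow_le_rpow (Real.log_nonneg h1) (Real.log_le_log (by linarith) ?_) (by linarith)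
    exact_mod_cast Nat.le_add_right n d
  have hDn : ∀ᶠ n : ℕ in atTop, D' (n + d) ≤ n + 1 := by
    filter_upwards [shift.eventually hD'n] with n hn
    omega
  obtain ⟨q, K, a, ha, hpar⟩ := exists_parameters c hρ0 hρ1 (fun n => D' (n + d)) hlog hDn s hs9
  -- the sizes, for large `n`
  have hsizes : ∀ᶠ n : ℕ in atTop, 6 ≤ n ∧ s n ≤ n ∧ 2 ≤ s n ∧ MB n ≤ s n ∧ 2 * R n ≤ MB n * s n ∧
      2 * n ≤ R n ∧ R n ≤ n ^ 2 ∧ MB n * s n ≤ (6 * C + 5) * n := by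
    filter_upwards [eventually_ge_atTop 6, eventually_ge_atTop (3 * C + 2),
      eventually_const_mul_rpow_le (6 * C + 5) (by norm_num : (1 : ℝ) < 9 / 5),
      eventually_const_mul_rpow_le 2 (by norm_num : (0 : ℝ) < 9 / 10)] with n h1 h2 h3 h4
    have hn1 : (1 : ℝ) ≤ n := by exact_mod_cast (by omega : 1 ≤ n)
    have hsn : s n ≤ n := Nat.ceil_le.2 <| by
      calc (n : ℝ) ^ (1 - γ) ≤ (n : ℝ) ^ (1 : ℝ) :=
            Real.rpow_le_rpow_of_exponent_le hn1 (by linarith)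
        _ = n := Real.rpow_one _
    have hs2 : 2 ≤ s n := by
      rw [Real.rpow_zero, mul_one] at h4
      exact_mod_cast h4.trans (hs9 n)
    have hss : 2 * R n < s n * s n := by
      have e1 : ((n : ℝ) ^ (9 / 10 : ℝ)) * (n : ℝ) ^ (9 / 10 : ℝ) = (n : ℝ) ^ (9 / 5 : ℝ) := by
        rw [← Real.rpow_add (by linarith)]; norm_num
      have e2 := mul_le_mul (hs9 n) (hs9 n) (by positivity) (Nat.cast_nonneg _)
      rw [e1] at e2
      rw [Real.rpow_one] at h3
      have e3 : ((2 * R n : ℕ) : ℝ) < ((s n * s n : ℕ) : ℝ) := by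
        simp only [R]
        push_cast
        nlinarith
      exact_mod_cast e3
    have hdiv := Nat.div_add_mod (2 * R n) (s n)
    have hmod := Nat.mod_lt (2 * R n) (by omega : 0 < s n)
    have hMB : MB n * s n = s n * (2 * R n / s n) + s n := by simp only [MB]; ring
    refine ⟨h1, hsn, hs2, Nat.div_lt_of_lt_mul hss, by omega, ?_, ?_, ?_⟩
    · exact Nat.mul_le_mul_right n (by omega)
    · rw [sq]
      exact Nat.mul_le_mul_right n h2
    · have : (6 * C + 5) * n = 2 * R n + n := by simp only [R]; ring
      omega
  let Works : ∀ n, MPCAlgorithm n (MB n) (117 * s n) Bool → Prop := fun n B =>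
    ∀ G : SimpleGraph (Fin n), IsOneCycle G ∨ IsTwoCycles G →
      ∀ inp : Fin (MB n) → Finset (Sym2 (Fin n)), IsEdgeDistribution G (117 * s n) inp →
        1 - (n : ℝ) ^ (-c) ≤ B.successProb inp (3 * (K n * (T (n + d) + 4) + 2) + 1)
          (DistinguishesCycles G)
  have hgood : ∀ᶠ n : ℕ in atTop, ∃ B, Works n B := by
    filter_upwards [hsizes, hpar, shift.eventually hspace, shift.eventually htotal,
      shift.eventually hinput, shift.eventually hcorrect,
      eventually_log_sq_le_rpow (by linarith : 0 < c),
      eventually_const_mul_rpow_le 2 (by linarith : 1 - 2 * γ < 1 - γ)]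
      with n ⟨hn6, hsn, hs2, hMBs, hRMB, hnR, hRn, _⟩ ⟨hq2, hK, _, hp1, hp2, hp3⟩ hsp htot hinp hcor
        hlogsq hγn
    have hn1 : (1 : ℝ) ≤ n := by exact_mod_cast (by omega : 1 ≤ n)
    have hN2 : n + d ≤ 2 * n := by omega
    have hNsq : n + d ≤ n ^ 2 := by nlinarith
    have hchoose : ∀ m ≤ n, m ≤ (n + d).choose 2 := by
      intro m hm
      refine hm.trans (le_trans ?_ (Nat.choose_le_choose 2 (Nat.le_add_right n d)))
      rw [Nat.choose_two_right, Nat.le_div_iff_mul_le two_pos]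
      exact Nat.mul_le_mul_left n (by omega)
    have hcast : (((n + d : ℕ) : ℝ)) ≤ 2 * n := by exact_mod_cast hN2
    have hSA : ∀ m ≤ n, S (n + d) m ≤ s n := by
      intro m hm
      have hN1 : (1 : ℝ) ≤ ((n + d : ℕ) : ℝ) := by exact_mod_cast (by omega : 1 ≤ n + d)
      have h1 : (S (n + d) m : ℝ) ≤ s n := by
        calc (S (n + d) m : ℝ) ≤ ((n + d : ℕ) : ℝ) ^ (1 - ε₀) := hsp m (hchoose m hm)
          _ ≤ ((n + d : ℕ) : ℝ) ^ (1 - 2 * γ) :=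
              Real.rpow_le_rpow_of_exponent_le hN1 (by linarith)
          _ ≤ (2 * n : ℝ) ^ (1 - 2 * γ) :=
              Real.rpow_le_rpow (by linarith) hcast (by linarith)
          _ = 2 ^ (1 - 2 * γ) * (n : ℝ) ^ (1 - 2 * γ) :=
              Real.mul_rpow two_pos.le (by linarith)
          _ ≤ 2 * (n : ℝ) ^ (1 - 2 * γ) := by
              gcongr
              exact (Real.rpow_le_rpow_of_exponent_le one_le_two (by linarith)).trans_eq
                (Real.rpow_one 2)
          _ ≤ (n : ℝ) ^ (1 - γ) := hγn
          _ ≤ s n := hs_ge n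
      exact_mod_cast h1
    have hMSA : ∀ m ≤ n, M (n + d) m * S (n + d) m ≤ R n := by
      intro m hm
      refine (htot m (hchoose m hm)).trans ?_
      have : C * (n + d + m) ≤ C * (3 * n) := Nat.mul_le_mul_left C (by omega)
      simp only [R]
      nlinarith
    obtain ⟨P, hPT, hfits, hsucc, hRM, hown⟩ := Setup.exists_fits (n := n) (N := n + d) (M := MB n)
      (s := s n) (R := R n) (D := D' (n + d)) (δ := ((n + d : ℕ) : ℝ) ^ (-c)) (by omega) hN2 hMBs
      hs2 hnR hRMB (M (n + d)) (S (n + d)) (T (n + d)) (A (n + d)) hSA hMSA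
      (fun m hm => hinp m (hchoose m hm)) (fun m _ => hcor m)
    have : NeZero (n + d) := ⟨by omega⟩
    have : NeZero (q n) := ⟨by omega⟩
    obtain ⟨B, hB⟩ := Setup.exists_cycle_algorithm P (K := K n) (q := q n) hn6
      (Nat.le_add_right n d) hNsq hfits (by omega) hsn (by omega) hRn hRM hown (by positivity) hsucc
    rw [hPT] at hB
    refine ⟨B, fun G hG inp hdist => le_trans ?_ (hB G hG inp hdist)⟩
    have hδ : ((n + d : ℕ) : ℝ) ^ (-c) ≤ (n : ℝ) ^ (-c) :=
      Real.rpow_le_rpow_of_nonpos (by linarith) (by exact_mod_cast Nat.le_add_right n d)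
        (by linarith)
    have hfail := failure_le (by omega) hq2 hp1 hp2 hp3 hδ
    have hq1 : (1 : ℝ) ≤ q n := by exact_mod_cast (by omega : 1 ≤ q n)
    have hQ1 : (1 : ℝ) ≤ (q n : ℝ) ^ K n := one_le_pow₀ hq1
    have h0 : 0 ≤ 1 - 1 / (q n : ℝ) := sub_nonneg.2 ((div_le_one (by linarith)).2 hq1)
    have h0' : 0 ≤ 1 - 1 / (q n : ℝ) ^ K n := sub_nonneg.2 ((div_le_one (by linarith)).2 hQ1)
    have := three_mul_sq_le (by omega) hK hlogsq (by positivity) hfail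
    linarith
  -- for small `n`, any algorithm will do
  have halg : ∀ n, ∃ B, (∃ B', Works n B') → Works n B := by
    intro n
    by_cases h : ∃ B', Works n B'
    · obtain ⟨B, hB⟩ := h
      exact ⟨B, fun _ => hB⟩
    · obtain ⟨B⟩ := nonempty_mpcAlgorithm (n := n) (M := MB n) (S := 117 * s n) (by
        rcases Nat.eq_zero_or_pos n with rfl | hn
        · left
          have : s 0 = 0 := by
            simp only [s, Nat.cast_zero]
            rw [Real.zero_rpow (by linarith), Nat.ceil_zero]
          rw [this]
        · exact Or.inr hn)
      exact ⟨B, fun hh => absurd hh h⟩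
  choose B hB using halg
  obtain ⟨κ, hκ, hlow⟩ := hconj MB (fun n => 117 * s n)
    (fun n => 3 * (K n * (T (n + d) + 4) + 2) + 1) B
    ⟨γ / 2, by positivity, by
      filter_upwards [eventually_const_mul_rpow_le 234 (by linarith : 1 - γ < 1 - γ / 2),
        eventually_ge_atTop 1] with n h1 hn1
      have hn1' : (1 : ℝ) ≤ n := by exact_mod_cast hn1
      have h2 : (s n : ℝ) < (n : ℝ) ^ (1 - γ) + 1 := Nat.ceil_lt_add_one (by positivity)
      have h3 : (1 : ℝ) ≤ (n : ℝ) ^ (1 - γ) := Real.one_le_rpow hn1' (by linarith)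
      push_cast
      linarith⟩
    ⟨117 * (6 * C + 5), by
      filter_upwards [hsizes] with n hn
      have := Nat.mul_le_mul_left 117 hn.2.2.2.2.2.2.2
      calc MB n * (117 * s n) = 117 * (MB n * s n) := by ring
        _ ≤ _ := this
        _ = _ := by ring⟩
    (by
      filter_upwards [hsizes] with n hn
      have h1 : MB n * s n ≤ MB n * (117 * s n / 2) := Nat.mul_le_mul_left _ (by omega)
      omega)
    (by
      filter_upwards [hgood] with n hn _
      exact hB n hn)
  have hDt : Tendsto (fun n => Real.log (D' (n + d))) atTop atTop :=
    Real.tendsto_log_atTop.comp (tendsto_atTop_mono' _ hlog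
      ((tendsto_rpow_atTop (by linarith)).comp tendsto_log_natCast))
  refine ⟨κ * a / 6, by positivity, ?_⟩
  filter_upwards [hlow, hpar, hDn, eventually_log_add_one_le,
    hDt.eventually_ge_atTop (2 * (12 + 9 * a) / (κ * a)), hDt.eventually_ge_atTop 0,
    tendsto_log_natCast.eventually_ge_atTop 1, hlog]
    with n hlown ⟨_, _, hKn, _⟩ hDnn hlog1 hbig hD0 hln hDlog heven
  -- multiply by `a * log D'` and use that `K * (a * log D') ≤ log n`
  have h1 := hlown heven
  push_cast at h1
  have hpos : (0 : ℝ) < D' (n + d) :=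
    (Real.rpow_pos_of_pos (by linarith) _).trans_le hDlog
  have h2 : Real.log (D' (n + d)) ≤ 6 / 5 * Real.log n := by
    refine le_trans (Real.log_le_log hpos ?_) hlog1
    exact_mod_cast hDnn
  have h3 := mul_le_mul_of_nonneg_left h1 (mul_nonneg ha.le hD0)
  have h4 : (K n * (a * Real.log (D' (n + d)))) * ((T (n + d) : ℝ) + 4) ≤
      Real.log n * ((T (n + d) : ℝ) + 4) := by gcongr
  have h5 : Real.log n * (κ * a * Real.log (D' (n + d))) ≤
      Real.log n * (3 * T (n + d) + 12 + 9 * a) := by nlinarith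
  have h6 := le_of_mul_le_mul_left h5 (by linarith)
  rw [div_le_iff₀ (by positivity)] at hbig
  nlinarith

/-- Families of algorithms are indexed by the number `n` of vertices and the number `m` of edges,
since the number of machines depends on both; `T n` is the number of rounds. -/
theorem theorem2 (c : ℝ) (hc : 1 < c) (hconj : TwoCycleConjecture c)
    (ρ : ℝ) (hρ0 : 0 < ρ) (hρ1 : ρ < 1)
    (D' : ℕ → ℕ)
    (hD' : ∀ᶠ n : ℕ in atTop, Real.log n ^ (1 + ρ) ≤ (D' n : ℝ))
    (hD'n : ∀ᶠ n : ℕ in atTop, D' n ≤ n)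
    (M S : ℕ → ℕ → ℕ) (T : ℕ → ℕ)
    (A : ∀ n m, MPCAlgorithm n (M n m) (S n m) (Fin n → Option (Fin n)))
    (hspace : ∃ ε : ℝ, 0 < ε ∧ ∀ᶠ n : ℕ in atTop, ∀ m ≤ n.choose 2,
      (S n m : ℝ) ≤ (n : ℝ) ^ (1 - ε))
    (htotal : ∃ C : ℕ, ∀ᶠ n : ℕ in atTop, ∀ m ≤ n.choose 2, M n m * S n m ≤ C * (n + m))
    (hinput : ∀ᶠ n : ℕ in atTop, ∀ m ≤ n.choose 2, m ≤ M n m * (S n m / 2))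
    (hcorrect : ∀ᶠ n : ℕ in atTop, ∀ m : ℕ,
      ∀ G : SimpleGraph (Fin n), G.edgeSet.ncard = m → DiameterAtMost G (D' n) →
      ∀ inp : Fin (M n m) → Finset (Sym2 (Fin n)), IsEdgeDistribution G (S n m) inp →
        1 - (n : ℝ) ^ (-c) ≤
          (A n m).successProb inp (T n) (IdentifiesComponents G (S n m))) :
    ∃ κ : ℝ, 0 < κ ∧ ∀ᶠ n : ℕ in atTop, κ * Real.log (D' n) ≤ T n := by
  -- `n` itself or its predecessor is even
  have even_case := fun {d : ℕ} (hd : d ≤ 1) => hconj.eventually_le_of_even hc hρ0 hρ1 D' hD' hD'n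
    M S T A hspace htotal hinput hcorrect hd
  obtain ⟨κ₀, hκ₀, h0⟩ := even_case zero_le_one
  obtain ⟨κ₁, hκ₁, h1⟩ := even_case le_rfl
  refine ⟨min κ₀ κ₁, lt_min hκ₀ hκ₁, ?_⟩
  filter_upwards [h0, (tendsto_sub_atTop_nat 1).eventually h1, eventually_ge_atTop 1]
    with n hn0 hn1 hn
  have hlog : 0 ≤ Real.log (D' n) := Real.log_natCast_nonneg _
  rcases Nat.even_or_odd n with h | h
  · exact (mul_le_mul_of_nonneg_right (min_le_left _ _) hlog).trans (hn0 h)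
  · have h2 := hn1 (Nat.Odd.sub_odd h odd_one)
    rw [Nat.sub_add_cancel hn] at h2
    exact (mul_le_mul_of_nonneg_right (min_le_right _ _) hlog).trans h2
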